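/- A hypergraph $H=(V,E)$ consists of a finite set $V$ of vertices and a set $E$ of subsets of $V$ (hyperedges). Its rank is the maximum size of a hyperedge. A transversal is a set $T\subseteq V$ that meets every hyperedge; it is minimal if no proper subset of it is a transversal. The degree $d(v)$ is the number of hyperedges containing $v$, and $d_2(v)$ is the number of hyperedges of size $2$ containing $v$. Consider the following recursive algorithm. An instance is a hypergraph $(V,E)$ with a set $S$ of already selected vertices; initially $(V,E)$ is the input hypergraph and $S=\emptyset$. To *select* $v$ means to add $v$ to $S$, to remove $v$ from $V$ and to remove all hyperedges containing $v$ from $E$. To *discard* $v$ means to remove $v$ from $V$ and from all hyperedges (hyperedges that become equal are identified). The first applicable rule of the following list is applied, and the algorithm recurses on each of the resulting instances. 1. If $\emptyset\in E$: stop, without output. 2. If $E=\emptyset$: output $S$ if $S$ is a minimal transversal of the input hypergraph, and stop. 3. If there is a vertex $v\in V$ with $d(v)=0$: discard $v$. 4. If some $e_1\in E$ is a proper subset of some $e_2\in E$ with $|e_2|=3$: remove $e_2$ from $E$. 5. If there is a hyperedge $\{v\}$: select $v$. 6. If there is a vertex $v$ with $d(v)=1$, let $e$ be the hyperedge containing $v$.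 - If $e=\{v,u\}$: branch into (i) select $v$, discard $u$; (ii) discard $v$. - If $|e|=3$ and all vertices of $e$ have degree $1$: branch into three instances; in each, one vertex of $e$ is selected and the other two are discarded. - If $e=\{v,u,w\}$ and $u$ or $w$ has degree at least $2$: branch into (i) select $v$, discard $u$ and $w$; (ii) discard $v$. 7. If there is a hyperedge of size $2$: let $v$ have maximum degree among the vertices maximizing $d_2$. Branch into (i) select $v$; (ii) discard $v$ and select every $u$ with $\{v,u\}\in E$. 8. Otherwise all hyperedges have size $3$; let $v$ be a vertex of maximum degree. - If $d(v)\ge 3$: branch into (i) select $v$; (ii) discard $v$. - If $d(v)=2$ and some $u\ne v$ lies in both hyperedges containing $v$: branch into (i) select $v$, discard $u$; (ii) discard $v$. - If $d(v)=2$ and the hyperedges containing $v$ are $\{v,u_1,w_1\}$ and $\{v,u_2,w_2\}$ with no other common vertex: branch into (i) select $v$ and $u_1$, discard $u_2$ and $w_2$; (ii) select $v$, discard $u_1$; (iii) discard $v$. **Theorem.** On every $n$-vertex hypergraph of rank at most $3$ (in particular, of rank $3$), given by lists of its vertices and hyperedges, this algorithm outputs every minimal transversal exactly once and nothing else, in time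 $O(1.6755^n)$, where time is the number of elementary steps (comparisons of two vertices and single steps in walking through lists). Consequently, an $n$-vertex hypergraph of rank at most $3$ has at most $O(1.6755^n)$ minimal transversals. The implied constants are absolute. -/

import Mathlib

/-! ### Hypergraphs: rank and transversals -/

namespace Hypergraph

/-- The rank of a hypergraph: the maximum size of a hyperedge. -/
noncomputable def rank {α : Type} (H : Hypergraph α) : ℕ∞ :=
  ⨆ e ∈ H.edgeSet, e.encard

/-- A transversal: a set of vertices that meets every hyperedge. -/
def IsTransversal {α : Type} (H : Hypergraph α) (T : Set α) : Prop :=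
  T ⊆ H.vertexSet ∧ ∀ e ∈ H.edgeSet, (e ∩ T).Nonempty

/-- An inclusion-minimal transversal. -/
def IsMinimalTransversal {α : Type} (H : Hypergraph α) (T : Set α) : Prop :=
  Minimal H.IsTransversal T

/-- The lists `V` (of vertices) and `E` (of hyperedges, each given as a list of vertices) describe
the hypergraph `H`, every vertex and every hyperedge being listed exactly once. -/
structure IsListedBy {α : Type} (H : Hypergraph α) (V : List α) (E : List (List α)) : Prop where
  nodup_vertices : V.Nodup
  mem_vertices : ∀ x, x ∈ V ↔ x ∈ H.vertexSet
  nodup_edge : ∀ e ∈ E, e.Nodup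
  nodup_edges : (E.map fun e => {x | x ∈ e}).Nodup
  mem_edges : ∀ s : Set α, s ∈ H.edgeSet ↔ ∃ e ∈ E, {x | x ∈ e} = s

end Hypergraph

namespace TransversalEnum

/-! ### Computations with a step count

A value of type `Timed β` is the result of a computation together with the number of elementary
steps made. A comparison of two vertices is one step; each call of a list primitive is one step,
and so is each recursive call made while it walks through its list. All loops are written with the
primitives below, so that only a bounded number of operations on list cells, Booleans and
numbers takes place between two counted steps. -/

structure Timed (β : Type) where
  val : β
  time : ℕ

instance : Monad Timed where
  pure b := ⟨b, 0⟩
  bind x f := ⟨(f x.val).val, x.time + (f x.val).time⟩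

/-- The computation `x`, preceded by one elementary step. -/
def step {β : Type} (x : Timed β) : Timed β := ⟨x.val, x.time + 1⟩

section Primitives

variable {β γ : Type}

/-- Does some element of the list satisfy `p`? -/
def anyT (p : β → Timed Bool) : List β → Timed Bool
  | [] => step (pure false)
  | b :: l => step do if ← p b then pure true else anyT p l

/-- Do all elements of the list satisfy `p`? -/
def allT (p : β → Timed Bool) : List β → Timed Bool
  | [] => step (pure true)
  | b :: l => step do if ← p b then allT p l else pure false

/-- The first element of the list that satisfies `p`, if there is one. -/
def findT (p : β → Timed Bool) : List β → Timed (Option β)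
  | [] => step (pure none)
  | b :: l => step do if ← p b then pure (some b) else findT p l

/-- The elements of the list that satisfy `p`. -/
def filterT (p : β → Timed Bool) : List β → Timed (List β)
  | [] => step (pure [])
  | b :: l => step do
      let c ← p b
      let l' ← filterT p l
      pure (if c then b :: l' else l')

/-- The number of elements of the list that satisfy `p`. -/
def countT (p : β → Timed Bool) : List β → Timed ℕ
  | [] => step (pure 0)
  | b :: l => step do
      let c ← p b
      let k ← countT p l
      pure (if c then k + 1 else k)

/-- The length of the list. -/
def lengthT : List β → Timed ℕ
  | [] => step (pure 0)
  | _ :: l => step do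
      let k ← lengthT l
      pure (k + 1)

/-- Apply `f` to every element of the list. -/
def mapT (f : β → Timed γ) : List β → Timed (List γ)
  | [] => step (pure [])
  | b :: l => step do
      let c ← f b
      let l' ← mapT f l
      pure (c :: l')

/-- Concatenation of two lists. -/
def appendT : List β → List β → Timed (List β)
  | [], m => step (pure m)
  | b :: l, m => step do
      let l' ← appendT l m
      pure (b :: l')

/-- Apply `f` to every element of the list and concatenate the resulting lists. -/
def flatMapT (f : β → Timed (List γ)) : List β → Timed (List γ)
  | [] => step (pure [])
  | b :: l => step do
      let m ← f b
      let m' ← flatMapT f l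
      appendT m m'

/-- An element of the list with the maximum value of `f`, and this value (`none` for the empty
list). -/
def argmaxT (f : β → Timed ℕ) : List β → Timed (Option (β × ℕ))
  | [] => step (pure none)
  | b :: l => step do
      let k ← f b
      match ← argmaxT f l with
      | none => pure (some (b, k))
      | some (b', k') => pure (if k' ≤ k then some (b, k) else some (b', k'))

end Primitives

section Algorithm

variable {α : Type} [DecidableEq α]

/-- Comparison of two vertices. -/
def eqT (x y : α) : Timed Bool := step (pure (decide (x = y)))

def neT (x y : α) : Timed Bool := do
  let b ← eqT x y
  pure (!b)

/-- Is the vertex `x` contained in `e`? -/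
def memT (x : α) (e : List α) : Timed Bool := anyT (eqT x) e

def subsetT (e f : List α) : Timed Bool := allT (fun x => memT x f) e

/-- Are `e` and `f` the same set? -/
def sameSetT (e f : List α) : Timed Bool := do
  if ← subsetT e f then subsetT f e else pure false

/-- Is `e` a proper subset of `f`? -/
def ssubsetT (e f : List α) : Timed Bool := do
  if ← subsetT e f then
    let b ← subsetT f e
    pure (!b)
  else pure false

/-- Has the list length `k`? -/
def hasSizeT (k : ℕ) (e : List α) : Timed Bool := do
  let n ← lengthT e
  pure (n == k)

/-- Remove all but one of several hyperedges that are the same set. -/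
def dedupT : List (List α) → Timed (List (List α))
  | [] => step (pure [])
  | e :: E => step do
      let E' ← dedupT E
      if ← anyT (sameSetT e) E' then pure E' else pure (e :: E')

/-- Degree of the vertex `v`. -/
def degreeT (E : List (List α)) (v : α) : Timed ℕ := countT (memT v) E

/-- Has the vertex `v` degree `k`? -/
def hasDegreeT (E : List (List α)) (k : ℕ) (v : α) : Timed Bool := do
  let d ← degreeT E v
  pure (d == k)

/-- Is `e` a hyperedge of size 2 that contains `v`? -/
def isPairAtT (v : α) (e : List α) : Timed Bool := do
  if ← hasSizeT 2 e then memT v e else pure false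

/-- Number of hyperedges of size 2 that contain `v`. -/
def degreeTwoT (E : List (List α)) (v : α) : Timed ℕ := countT (isPairAtT v) E

/-- Does `e` contain both `v` and `u`? -/
def containsBothT (v u : α) (e : List α) : Timed Bool := do
  if ← memT v e then memT u e else pure false

/-- Is `{v, u}` a hyperedge, with `u ≠ v`? -/
def isPairPartnerT (E : List (List α)) (v u : α) : Timed Bool := do
  if ← neT v u then
    anyT (fun e => do if ← isPairAtT v e then memT u e else pure false) E
  else pure false

/-- Does the set `T` of vertices meet every member of `E`? -/
def hitsAllT (E : List (List α)) (T : List α) : Timed Bool :=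
  allT (anyT (fun x => memT x T)) E

/-- Is the set `T` of vertices a minimal transversal for `E`: it meets all members of `E`, and
it no longer does so when any one of its elements is removed? -/
def isMinimalT (E : List (List α)) (T : List α) : Timed Bool := do
  if ← hitsAllT E T then
    allT (fun v => do
      let T' ← filterT (neT v) T
      let b ← hitsAllT E T'
      pure (!b)) T
  else pure false

/-- An instance of a recursive call: the vertices that may still be selected, the hyperedges that
still have to be hit, and the vertices that have been selected so far. -/
structure Inst (α : Type) where
  V : List α
  E : List (List α)
  S : List α

/-- Select `v`: put it into `S`, remove it from `V`, and remove the hyperedges containing it. -/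
def selectT (v : α) (I : Inst α) : Timed (Inst α) := do
  let V ← filterT (neT v) I.V
  let E ← filterT (fun e => do
    let b ← memT v e
    pure (!b)) I.E
  pure ⟨V, E, v :: I.S⟩

/-- Discard `v`: remove it from `V` and from all hyperedges (which form a set: hyperedges that
become equal are merged). -/
def discardT (v : α) (I : Inst α) : Timed (Inst α) := do
  let V ← filterT (neT v) I.V
  let E ← mapT (filterT (neT v)) I.E
  let E ← dedupT E
  pure ⟨V, E, I.S⟩

/-- Select all vertices of a list, one after the other. -/
def selectAllT : List α → Inst α → Timed (Inst α)
  | [], I => step (pure I)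
  | v :: l, I => step do
      let J ← selectT v I
      selectAllT l J

/-- Discard all vertices of a list, one after the other. -/
def discardAllT : List α → Inst α → Timed (Inst α)
  | [], I => step (pure I)
  | v :: l, I => step do
      let J ← discardT v I
      discardAllT l J

/-- What a rule does: halt with a list of transversals to output, or recurse into subinstances. -/
inductive Outcome (α : Type) where
  | halt (out : List (List α))
  | branch (subinstances : List (Inst α))

/-- Branching at a vertex `v` of degree 1, where `e` is the hyperedge that contains it. -/
def branchDegreeOne (I : Inst α) (v : α) (e : List α) : Timed (Outcome α) := do
  match ← filterT (neT v) e with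
  | [u] =>
    let J₁ ← selectT v I
    let J₁ ← discardT u J₁
    let J₂ ← discardT v I
    pure (.branch [J₁, J₂])
  | [u, w] =>
    let du ← degreeT I.E u
    let dw ← degreeT I.E w
    if du = 1 ∧ dw = 1 then
      let J₁ ← selectT v I
      let J₁ ← discardAllT [u, w] J₁
      let J₂ ← selectT u I
      let J₂ ← discardAllT [v, w] J₂
      let J₃ ← selectT w I
      let J₃ ← discardAllT [v, u] J₃
      pure (.branch [J₁, J₂, J₃])
    else
      let J₁ ← selectT v I
      let J₁ ← discardAllT [u, w] J₁
      let J₂ ← discardT v I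
      pure (.branch [J₁, J₂])
  -- impossible for hyperedges of size 2 or 3
  | _ => pure (.halt [])

/-- Branching when there is a hyperedge of size 2. The vertex `v` has maximum degree among the
vertices in a maximum number of hyperedges of size 2. It is either selected, or discarded, and then
all vertices that form a hyperedge of size 2 with it are selected. -/
def branchPair (I : Inst α) : Timed (Outcome α) := do
  match ← argmaxT (degreeTwoT I.E) I.V with
  | some (_, k) =>
    let C ← filterT (fun x => do
      let d ← degreeTwoT I.E x
      pure (d == k)) I.V
    match ← argmaxT (degreeT I.E) C with
    | some (v, _) =>
      let U ← filterT (isPairPartnerT I.E v) I.V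
      let J₁ ← selectT v I
      let J₂ ← discardT v I
      let J₂ ← selectAllT U J₂
      pure (.branch [J₁, J₂])
    -- impossible, because `C` is not empty
    | none => pure (.halt [])
  -- impossible, because `I.V` is not empty
  | none => pure (.halt [])

/-- Branching when all hyperedges have size 3: `v` is a vertex of maximum degree. -/
def branchTriple (I : Inst α) : Timed (Outcome α) := do
  match ← argmaxT (degreeT I.E) I.V with
  | some (v, d) =>
    if 3 ≤ d then
      let J₁ ← selectT v I
      let J₂ ← discardT v I
      pure (.branch [J₁, J₂])
    else
      -- a vertex that shares two hyperedges with `v`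
      let u? ← findT (fun u => do
        if ← neT v u then
          let k ← countT (containsBothT v u) I.E
          pure (k == 2)
        else pure false) I.V
      match u? with
      | some u =>
        let J₁ ← selectT v I
        let J₁ ← discardT u J₁
        let J₂ ← discardT v I
        pure (.branch [J₁, J₂])
      | none =>
        let F ← filterT (memT v) I.E
        match ← mapT (filterT (neT v)) F with
        | [[u₁, _], [u₂, w₂]] =>
          let J₀ ← selectT v I
          let J₁ ← selectT u₁ J₀
          let J₁ ← discardAllT [u₂, w₂] J₁
          let J₂ ← discardT u₁ J₀
          let J₃ ← discardT v I
          pure (.branch [J₁, J₂, J₃])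
        -- impossible, because `v` has degree 2 and all hyperedges have size 3
        | _ => pure (.halt [])
  -- impossible, because `I.V` is not empty
  | none => pure (.halt [])

/-- The first applicable rule, applied to the instance `I`; the list `E₀` holds the hyperedges of
the input hypergraph. -/
def applyRule (E₀ : List (List α)) (I : Inst α) : Timed (Outcome α) := do
  -- an empty hyperedge: there is nothing to enumerate
  if ← anyT (hasSizeT 0) I.E then pure (.halt []) else
  -- no hyperedge remains: output `S` if it is a minimal transversal of the input
  if I.E.isEmpty then
    if ← isMinimalT E₀ I.S then pure (.halt [I.S]) else pure (.halt [])
  else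
  -- a vertex of degree 0: discard it
  match ← findT (hasDegreeT I.E 0) I.V with
  | some v =>
    let J ← discardT v I
    pure (.branch [J])
  | none =>
  -- a hyperedge of size 3 with another hyperedge as a subset: remove it
  match ← findT (fun f => do
      if ← hasSizeT 3 f then anyT (fun e => ssubsetT e f) I.E else pure false) I.E with
  | some f =>
    let E ← filterT (fun e => do
      let b ← sameSetT e f
      pure (!b)) I.E
    pure (.branch [⟨I.V, E, I.S⟩])
  | none =>
  -- a hyperedge of size 1: select its vertex
  match ← findT (hasSizeT 1) I.E with
  | some e =>
    let J ← selectAllT e I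
    pure (.branch [J])
  | none =>
  -- a vertex of degree 1
  match ← findT (hasDegreeT I.E 1) I.V with
  | some v =>
    match ← findT (memT v) I.E with
    | some e => branchDegreeOne I v e
    -- impossible, because `v` has degree 1
    | none => pure (.halt [])
  | none =>
  if ← anyT (hasSizeT 2) I.E then branchPair I else branchTriple I

/-- The search tree: apply a rule, and solve the resulting subinstances recursively. The natural
number bounds the depth of the recursion. -/
def search (E₀ : List (List α)) : ℕ → Inst α → Timed (List (List α))
  | 0, _ => step (pure [])
  | depth + 1, I => step do
      match ← applyRule E₀ I with
      | .halt out => pure out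
      | .branch subinstances => flatMapT (search E₀ depth) subinstances

/-- The algorithm on the hypergraph with vertices `V` and hyperedges `E`, starting from `S = ∅`.
Each recursive call decreases the number of vertices plus hyperedges, so that
the bound on the depth of the recursion is never reached. -/
def enumerate (V : List α) (E : List (List α)) : Timed (List (List α)) :=
  search E (V.length + E.length + 1) ⟨V, E, []⟩

end Algorithm

end TransversalEnum

/-! The proof is by measure and conquer. A family of hyperedges receives a `weight`: the product of
`vertexFactor (degree v)` over its vertices, times `pairFactor` of the number of hyperedges of size
2. The vertex factors increase with the degree from 1 to 67/40 = 1.675. The pair factors decrease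
from 3/2 to 1, so that shrinking a triple to a pair counts as progress. The weight lies between 1
and 3/2 · 1.675 ^ n. If the subinstances produced by a rule never have larger total weight than the
instance, then by induction the number of outputs is at most the initial weight.

The weight only looks at `core`, the inclusion-minimal hyperedges with at least two elements. Hence
removing supersets (`core_erase`), selecting forced vertices (`core_restrict_of_singletons`) and
discarding vertices of degree 0 leave it unchanged, and only the branching rules need an estimate.
They act on families of pairwise incomparable pairs and triples. `weight_restrict_mul_le` bounds the
weight of a subinstance by the factors that disappear or drop. The sum over the branches then
becomes an inequality between rational numbers. Since the factors are constant from degree 4 and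
from 5 pairs on, finitely many cases remain, apart from a few uniform tails. The results are the
lemmas `weight_branch_pair`, `weight_branch_degree_three` and their companions.

Correctness rests on private hyperedges: a transversal is minimal exactly when each of its elements
is the only one in some hyperedge. `Inst.Valid.exists_private` transfers this to the current
instance, for vertices not yet selected. This shows that no discard made by a branching rule loses a
minimal transversal. Two branches never yield the same set, because some vertex is selected in one
and discarded in the other.

For the time, one application of a rule costs a power of M = (n + 3) ^ 3 and the recursion depth is
at most M. `isGoodResult_search` therefore bounds the time by a polynomial times the weight. The gap
between 1.675 and 1.6755 absorbs the polynomial (`exists_poly_mul_pow_le`). -/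

namespace TransversalEnum

/-! ### Numerical factors of the measure -/

section Factors

/-- The weight that a vertex contributes to the measure, depending on its degree. -/
def vertexFactor : ℕ → ℚ
  | 0 => 1
  | 1 => 151 / 100
  | 2 => 163 / 100
  | 3 => 333 / 200
  | _ => 67 / 40

/-- The weight contributed to the measure by the number of hyperedges of size 2. -/
def pairFactor : ℕ → ℚ
  | 0 => 3 / 2
  | 1 => 11 / 8
  | 2 => 63 / 50
  | 3 => 231 / 200
  | 4 => 107 / 100
  | _ => 1

lemma vertexFactor_of_four_le {n : ℕ} (h : 4 ≤ n) : vertexFactor n = 67 / 40 := by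
  obtain ⟨k, rfl⟩ := Nat.exists_eq_add_of_le' h
  rfl

lemma pairFactor_of_five_le {n : ℕ} (h : 5 ≤ n) : pairFactor n = 1 := by
  obtain ⟨k, rfl⟩ := Nat.exists_eq_add_of_le' h
  rfl

lemma vertexFactor_monotone : Monotone vertexFactor := by
  refine monotone_nat_of_le_succ fun n => ?_
  rcases n with _ | _ | _ | _ | n
  iterate 4 norm_num [vertexFactor]
  exact le_rfl

lemma pairFactor_antitone : Antitone pairFactor := by
  refine antitone_nat_of_succ_le fun n => ?_
  rcases n with _ | _ | _ | _ | _ | n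
  iterate 5 norm_num [pairFactor]
  exact le_rfl

lemma one_le_vertexFactor (n : ℕ) : 1 ≤ vertexFactor n :=
  vertexFactor_monotone (Nat.zero_le n)

lemma vertexFactor_pos (n : ℕ) : 0 < vertexFactor n :=
  one_pos.trans_le (one_le_vertexFactor n)

lemma vertexFactor_le (n : ℕ) : vertexFactor n ≤ 67 / 40 := by
  rcases n with _ | _ | _ | _ | n
  iterate 4 norm_num [vertexFactor]
  exact le_rfl

lemma one_le_pairFactor (n : ℕ) : 1 ≤ pairFactor n := by
  rcases n with _ | _ | _ | _ | _ | n
  iterate 5 norm_num [pairFactor]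
  exact le_rfl

lemma pairFactor_pos (n : ℕ) : 0 < pairFactor n :=
  one_pos.trans_le (one_le_pairFactor n)

lemma pairFactor_le (n : ℕ) : pairFactor n ≤ 3 / 2 :=
  pairFactor_antitone (Nat.zero_le n)

lemma vertexFactor_min (n : ℕ) : vertexFactor (min n 4) = vertexFactor n := by
  rcases le_total n 4 with h | h
  · rw [min_eq_left h]
  · rw [min_eq_right h, vertexFactor_of_four_le h, vertexFactor_of_four_le le_rfl]

end Factors

/-! ### The measure of a family and its behaviour under selecting and discarding -/

section Clutters

open Finset

variable {α : Type*} [DecidableEq α]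

/-- The number of members of `F` that contain `v`. -/
def degree (F : Finset (Finset α)) (v : α) : ℕ := #{e ∈ F | v ∈ e}

/-- The members of size 2. -/
def pairs (F : Finset (Finset α)) : Finset (Finset α) := {e ∈ F | #e = 2}

/-- The inclusion-minimal members that have at least two elements. -/
def core (F : Finset (Finset α)) : Finset (Finset α) :=
  {e ∈ F | 2 ≤ #e ∧ ∀ f ∈ F, f ⊆ e → f = e}

/-- Select all elements of `P` and discard all elements of `D`. -/
def restrict (F : Finset (Finset α)) (P D : Finset α) : Finset (Finset α) :=
  {e ∈ F | Disjoint e P}.image (· \ D)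

/-- The measure of a set of hyperedges. -/
def weight (F : Finset (Finset α)) : ℚ :=
  pairFactor #(pairs (core F)) *
    ∏ v ∈ (core F).biUnion id, vertexFactor (degree (core F) v)

/-- The members of `F` have at least two elements and are pairwise incomparable. -/
def IsClutter (F : Finset (Finset α)) : Prop :=
  ∀ e ∈ F, 2 ≤ #e ∧ ∀ f ∈ F, f ⊆ e → f = e

/-- The vertices that form a hyperedge of size 2 with `v`. -/
def partners (F : Finset (Finset α)) (v : α) : Finset α :=
  {u ∈ F.biUnion id | u ≠ v ∧ {v, u} ∈ F}

variable {F : Finset (Finset α)} {P D : Finset α} {v x : α}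

lemma mem_restrict {s : Finset α} :
    s ∈ restrict F P D ↔ ∃ e ∈ F, Disjoint e P ∧ e \ D = s := by
  simp [restrict, and_assoc]

lemma IsClutter.core_eq (h : IsClutter F) : core F = F := by
  ext e
  simp only [core, mem_filter, and_iff_left_iff_imp]
  exact h e

lemma mem_partners {u : α} : u ∈ partners F v ↔ u ≠ v ∧ {v, u} ∈ F := by
  simp only [partners, mem_filter, mem_biUnion, id, and_iff_right_iff_imp]
  exact fun h => ⟨_, h.2, by simp⟩

lemma degree_pos_iff : 0 < degree F v ↔ ∃ e ∈ F, v ∈ e := by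
  simp [degree, card_pos, Finset.Nonempty]

lemma degree_eq_zero_of_notMem (h : v ∉ F.biUnion id) : degree F v = 0 := by
  by_contra h0
  obtain ⟨e, he, hv⟩ := degree_pos_iff.1 (Nat.pos_of_ne_zero h0)
  exact h (mem_biUnion.2 ⟨e, he, hv⟩)

/-- Vertices outside all hyperedges have degree 0 and `vertexFactor 0 = 1`. This allows two weights
to be compared over a common set of vertices. -/
lemma prod_vertexFactor_eq {U : Finset α} (h : F.biUnion id ⊆ U) :
    ∏ v ∈ F.biUnion id, vertexFactor (degree F v) = ∏ v ∈ U, vertexFactor (degree F v) :=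
  prod_subset h fun v _ hv => by rw [degree_eq_zero_of_notMem hv]; rfl

lemma weight_eq {U : Finset α} (h : (core F).biUnion id ⊆ U) :
    weight F = pairFactor #(pairs (core F)) * ∏ v ∈ U, vertexFactor (degree (core F) v) := by
  rw [weight, prod_vertexFactor_eq h]

lemma one_le_weight (F : Finset (Finset α)) : 1 ≤ weight F :=
  one_le_mul_of_one_le_of_one_le (one_le_pairFactor _)
    (Finset.one_le_prod fun _ _ => one_le_vertexFactor _)

lemma weight_le {U : Finset α} (h : ∀ e ∈ F, e ⊆ U) : weight F ≤ 3 / 2 * (67 / 40) ^ #U := by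
  have hU : (core F).biUnion id ⊆ U := biUnion_subset.2 fun e he => h e (mem_filter.1 he).1
  rw [weight_eq hU]
  gcongr
  · exact prod_nonneg fun _ _ => (vertexFactor_pos _).le
  · exact pairFactor_le _
  · exact (prod_le_prod (fun _ _ => (vertexFactor_pos _).le) fun _ _ => vertexFactor_le _).trans
      (by rw [prod_const])

lemma weight_eq_of_core_eq {G : Finset (Finset α)} (h : core F = core G) :
    weight F = weight G := by
  rw [weight, weight, h]

/-- Removing a set that properly contains another hyperedge does not change the core. -/
lemma core_erase {e f : Finset α} (he : e ∈ F) (hf : e ⊂ f) : core (F.erase f) = core F := by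
  ext g
  simp only [core, mem_filter, mem_erase]
  constructor
  · rintro ⟨⟨hg, hgF⟩, hc, hm⟩
    refine ⟨hgF, hc, fun h hh hs => ?_⟩
    by_cases hhf : h = f
    · subst hhf
      -- If the erased set lies below `g`, then so does `e`; minimality gives `g = e`, which is too
      -- small to contain the erased set.
      have := hm e ⟨hf.ne, he⟩ (hf.subset.trans hs)
      subst this
      exact absurd hs (not_subset_of_ssubset hf)
    · exact hm h ⟨hhf, hh⟩ hs
  · rintro ⟨hgF, hc, hm⟩
    refine ⟨⟨?_, hgF⟩, hc, fun h hh hs => hm h hh.2 hs⟩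
    rintro rfl
    exact hf.ne (hm e he hf.subset)

/-- Selecting vertices that form hyperedges of size 1 does not change the core. -/
lemma core_restrict_of_singletons (h : ∀ u ∈ P, {u} ∈ F) : core (restrict F P ∅) = core F := by
  ext g
  simp only [core, mem_filter, mem_restrict, sdiff_empty]
  constructor
  · rintro ⟨⟨e, heF, hP, rfl⟩, hc, hm⟩
    -- A competitor below a set that avoids `P` avoids `P` as well, so it also survives the
    -- selection.
    exact ⟨heF, hc, fun f hf hs => hm f ⟨f, hf, hP.mono_left hs, rfl⟩ hs⟩
  · rintro ⟨hgF, hc, hm⟩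
    refine ⟨⟨g, hgF, Finset.disjoint_left.2 fun u hu huP => ?_, rfl⟩, hc, ?_⟩
    -- A minimal set containing `u ∈ P` would equal `{u}`, which is too small for the core.
    · rw [← hm _ (h u huP) (singleton_subset_iff.2 hu)] at hc
      simp at hc
    · rintro f ⟨f', hf, -, rfl⟩ hs
      exact hm _ hf hs

lemma restrict_restrict {P' D' : Finset α} (h : Disjoint D P') :
    restrict (restrict F P D) P' D' = restrict F (P ∪ P') (D ∪ D') := by
  ext g
  simp only [mem_restrict]
  constructor
  · rintro ⟨_, ⟨e, he, hP, rfl⟩, hP', rfl⟩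
    refine ⟨e, he, ?_, by rw [sdiff_sdiff_left, sup_eq_union]⟩
    rw [disjoint_union_right]
    refine ⟨hP, ?_⟩
    rw [Finset.disjoint_left] at hP' h ⊢
    intro a ha hap
    exact hP' (mem_sdiff.2 ⟨ha, fun hD => h hD hap⟩) hap
  · rintro ⟨e, he, hP, rfl⟩
    rw [disjoint_union_right] at hP
    exact ⟨e \ D, ⟨e, he, hP.1, rfl⟩, hP.2.mono_left sdiff_subset,
      by rw [sdiff_sdiff_left, sup_eq_union]⟩

lemma restrict_empty : restrict F ∅ ∅ = F := by
  ext; simp [mem_restrict]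

/-- Discarding may merge hyperedges and the core may drop some, but neither raises a degree. -/
lemma degree_core_restrict_le (F : Finset (Finset α)) (P D : Finset α) (x : α) :
    degree (core (restrict F P D)) x ≤ #{e ∈ F | x ∈ e ∧ Disjoint e P} := by
  refine (card_le_card (t := image (· \ D) {e ∈ F | x ∈ e ∧ Disjoint e P}) ?_).trans card_image_le
  intro s hs
  simp only [core, mem_filter, mem_restrict] at hs
  obtain ⟨⟨⟨e, he, hP, rfl⟩, -⟩, hx⟩ := hs
  exact mem_image.2 ⟨e, mem_filter.2 ⟨he, (mem_sdiff.1 hx).1, hP⟩, rfl⟩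

lemma degree_core_restrict_le_degree (F : Finset (Finset α)) (P D : Finset α) (x : α) :
    degree (core (restrict F P D)) x ≤ degree F x :=
  (degree_core_restrict_le F P D x).trans
    (card_le_card fun e => by simp only [mem_filter]; tauto)

lemma degree_core_restrict_lt {e : Finset α} (he : e ∈ F) (hx : x ∈ e) (hP : ¬Disjoint e P) :
    degree (core (restrict F P D)) x < degree F x := by
  refine (degree_core_restrict_le F P D x).trans_lt (card_lt_card ⟨?_, fun h => ?_⟩)
  · intro f
    simp only [mem_filter]
    tauto
  · exact hP (mem_filter.1 (h (mem_filter.2 ⟨he, hx⟩))).2.2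

lemma degree_core_restrict_eq_zero (h : x ∈ P ∪ D) : degree (core (restrict F P D)) x = 0 := by
  by_contra h0
  obtain ⟨s, hs, hx⟩ := degree_pos_iff.1 (Nat.pos_of_ne_zero h0)
  obtain ⟨e, -, hP, rfl⟩ := mem_restrict.1 (mem_filter.1 hs).1
  rw [mem_sdiff] at hx
  rcases mem_union.1 h with h | h
  · exact Finset.disjoint_left.1 hP hx.1 h
  · exact hx.2 h

/-- Any minimal set through `x` would be `{x}`, which the core omits. A forced vertex has thus left
the measure before it is selected. -/
lemma degree_core_eq_zero_of_singleton_mem (h : {x} ∈ F) : degree (core F) x = 0 := by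
  by_contra h0
  obtain ⟨s, hs, hx⟩ := degree_pos_iff.1 (Nat.pos_of_ne_zero h0)
  obtain ⟨-, hc, hm⟩ := mem_filter.1 hs
  rw [← hm _ h (singleton_subset_iff.2 hx)] at hc
  simp at hc

/-- The decrease of the measure, from the decrease of the degrees of the vertices in `X`. -/
lemma weight_restrict_mul_le (hF : IsClutter F) (X : Finset α) (ρ : α → ℚ)
    (h0 : ∀ x ∈ X, 0 ≤ ρ x)
    (h : ∀ x ∈ X, vertexFactor (degree (core (restrict F P D)) x) * ρ x ≤
      vertexFactor (degree F x))
    {m : ℕ} (hm : m ≤ #(pairs (core (restrict F P D)))) :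
    weight (restrict F P D) * (pairFactor #(pairs F) * ∏ x ∈ X, ρ x) ≤
      weight F * pairFactor m := by
  -- A common index set for both products and for the gains; additional vertices contribute the
  -- factor 1.
  set U : Finset α := (core F).biUnion id ∪ (core (restrict F P D)).biUnion id ∪ X with hU
  rw [weight_eq (F := F) (U := U) (fun x hx => by simp only [hU, mem_union, hx, true_or]),
    weight_eq (F := restrict F P D) (U := U)
      (fun x hx => by simp only [hU, mem_union, hx, true_or, or_true]), hF.core_eq]
  have h1 : (∏ x ∈ U, vertexFactor (degree (core (restrict F P D)) x)) * ∏ x ∈ X, ρ x ≤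
      ∏ x ∈ U, vertexFactor (degree F x) := by
    have : ∏ x ∈ X, ρ x = ∏ x ∈ U, if x ∈ X then ρ x else 1 := by
      rw [← prod_filter]
      congr 1
      ext x
      simp only [hU, mem_filter, mem_union]
      tauto
    rw [this, ← prod_mul_distrib]
    refine prod_le_prod (fun x _ => mul_nonneg (vertexFactor_pos _).le ?_) fun x _ => ?_
    · split_ifs with hx
      exacts [h0 x hx, zero_le_one]
    · split_ifs with hx
      · exact h x hx
      · rw [mul_one]
        exact vertexFactor_monotone (degree_core_restrict_le_degree F P D x)
  have h2 := pairFactor_antitone hm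
  have h3 : (0 : ℚ) ≤ ∏ x ∈ U, vertexFactor (degree F x) :=
    prod_nonneg fun _ _ => (vertexFactor_pos _).le
  have h4 := pairFactor_pos #(pairs F)
  have h5 := pairFactor_pos #(pairs (core (restrict F P D)))
  calc _ = (pairFactor #(pairs F) * pairFactor #(pairs (core (restrict F P D)))) *
        ((∏ x ∈ U, vertexFactor (degree (core (restrict F P D)) x)) * ∏ x ∈ X, ρ x) := by ring
    _ ≤ (pairFactor #(pairs F) * pairFactor m) * ∏ x ∈ U, vertexFactor (degree F x) := by
        refine mul_le_mul (mul_le_mul_of_nonneg_left h2 h4.le) h1 ?_ (by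
          exact mul_nonneg h4.le (pairFactor_pos _).le)
        exact mul_nonneg (prod_nonneg fun _ _ => (vertexFactor_pos _).le) (prod_nonneg h0)
    _ = _ := by ring

/-- The decrease of the measure when the vertices in `G` disappear and those in `X` lose
a hyperedge. -/
lemma weight_restrict_mul_le_of_drop (hF : IsClutter F) (G X : Finset α) (hGX : Disjoint G X)
    (hG : ∀ x ∈ G, degree (core (restrict F P D)) x = 0)
    (hX : ∀ x ∈ X, degree (core (restrict F P D)) x < degree F x)
    {m : ℕ} (hm : m ≤ #(pairs (core (restrict F P D)))) :
    weight (restrict F P D) * (pairFactor #(pairs F) *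
      ((∏ x ∈ G, vertexFactor (degree F x)) *
        ∏ x ∈ X, vertexFactor (degree F x) / vertexFactor (degree F x - 1))) ≤
      weight F * pairFactor m := by
  have key := weight_restrict_mul_le (P := P) (D := D) hF (G ∪ X)
    -- A vertex that disappears gains its whole factor. One that loses at least one hyperedge gains
    -- at least the ratio of two consecutive factors.
    (fun x => if x ∈ G then vertexFactor (degree F x) else
      vertexFactor (degree F x) / vertexFactor (degree F x - 1))
    (fun x _ => by
      have := vertexFactor_pos (degree F x)
      have := vertexFactor_pos (degree F x - 1)
      split_ifs <;> positivity)
    (fun x hx => by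
      split_ifs with hxG
      · rw [hG x hxG]
        simp [vertexFactor]
      · have hlt := hX x ((mem_union.1 hx).resolve_left hxG)
        have h1 := vertexFactor_monotone
          (show degree (core (restrict F P D)) x ≤ degree F x - 1 by omega)
        have h2 := vertexFactor_pos (degree F x - 1)
        have h3 := vertexFactor_pos (degree F x)
        rw [mul_div_assoc', div_le_iff₀ h2, mul_comm (vertexFactor (degree F x))]
        gcongr) hm
  rw [prod_union hGX] at key
  convert key using 4
  · exact prod_congr rfl fun x hx => by rw [if_pos hx]
  · exact prod_congr rfl fun x hx => by rw [if_neg (Finset.disjoint_right.1 hGX hx)]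

lemma weight_restrict_mul_le_of_gone (hF : IsClutter F) (G : Finset α)
    (hG : ∀ x ∈ G, degree (core (restrict F P D)) x = 0)
    {m : ℕ} (hm : m ≤ #(pairs (core (restrict F P D)))) :
    weight (restrict F P D) * (pairFactor #(pairs F) * ∏ x ∈ G, vertexFactor (degree F x)) ≤
      weight F * pairFactor m := by
  simpa using weight_restrict_mul_le_of_drop hF G ∅ (disjoint_empty_right _) hG (by simp) hm

/-- If no hyperedge becomes empty or a singleton, then all sets of size 2 stay in the core. -/
lemma card_le_card_pairs_core {G : Finset (Finset α)} (h : ∀ e ∈ F, 2 ≤ #e) (hG : G ⊆ pairs F) :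
    #G ≤ #(pairs (core F)) := by
  refine card_le_card fun e he => ?_
  obtain ⟨heF, hc⟩ := mem_filter.1 (hG he)
  refine mem_filter.2 ⟨mem_filter.2 ⟨heF, hc.ge, fun f hf hs => ?_⟩, hc⟩
  exact eq_of_subset_of_card_le hs (hc.trans_le (h f hf))

end Clutters

/-! ### Inequalities between the factors -/

section Numerics

/-- Combine the estimates for two subinstances. -/
lemma add_le_of_mul_le {w w₁ w₂ c₁ c₂ b₁ b₂ : ℚ} (hw : 0 ≤ w) (hc₁ : 0 < c₁) (hc₂ : 0 < c₂)
    (h₁ : w₁ * c₁ ≤ w * b₁) (h₂ : w₂ * c₂ ≤ w * b₂) (h : b₁ * c₂ + b₂ * c₁ ≤ c₁ * c₂) :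
    w₁ + w₂ ≤ w := by
  have hc := mul_pos hc₁ hc₂
  refine le_of_mul_le_mul_right ?_ hc
  calc (w₁ + w₂) * (c₁ * c₂) = (w₁ * c₁) * c₂ + (w₂ * c₂) * c₁ := by ring
    _ ≤ (w * b₁) * c₂ + (w * b₂) * c₁ := by gcongr
    _ = w * (b₁ * c₂ + b₂ * c₁) := by ring
    _ ≤ w * (c₁ * c₂) := by gcongr

lemma vertexFactor_min_five (n : ℕ) : vertexFactor (min n 5) = vertexFactor n := by
  rcases le_total n 5 with h | h
  · rw [min_eq_left h]
  · rw [min_eq_right h, vertexFactor_of_four_le (by omega), vertexFactor_of_four_le (by omega)]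

lemma vertexFactor_min_five_sub_one (n : ℕ) :
    vertexFactor (min n 5 - 1) = vertexFactor (n - 1) := by
  rcases le_total n 5 with h | h
  · rw [min_eq_left h]
  · rw [min_eq_right h, vertexFactor_of_four_le (by omega), vertexFactor_of_four_le (by omega)]

/-- Since `pairFactor` is constant from 5 on, parameters may be truncated; this turns the
inequalities below into finite checks. -/
lemma pairFactor_min_sub {m a : ℕ} (c : ℕ) (ha : c + 5 ≤ a) :
    pairFactor (min m a - c) = pairFactor (m - c) := by
  rcases le_total m a with h | h
  · rw [min_eq_left h]
  · rw [min_eq_right h, pairFactor_of_five_le (by omega), pairFactor_of_five_le (by omega)]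

lemma pairFactor_min {m a : ℕ} (ha : 5 ≤ a) : pairFactor (min m a) = pairFactor m :=
  pairFactor_min_sub 0 ha

/-- Case of a pair `{v, u}` where `v` has degree 1 and `u` lies in no other pair: each branch loses
one pair and two vertices of factor at least 151/100. -/
lemma pairFactor_one_pair {m : ℕ} (hm : 1 ≤ m) :
    2 * pairFactor (m - 1) ≤ pairFactor m * (151 / 100 * (151 / 100)) := by
  have key : ∀ m ∈ Finset.Icc 1 6,
      2 * pairFactor (m - 1) ≤ pairFactor m * (151 / 100 * (151 / 100)) := by decide +kernel
  have := key (min m 6) (by simp; omega)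
  rwa [pairFactor_min_sub 1 (by omega), pairFactor_min (by omega)] at this

/-- Case of a pair `{v, u}` where `v` has degree 1 and `u` lies in exactly two pairs. The summand 1
belongs to the branch discarding `u`, estimated by `weight_restrict_forced`; the other branch
selects `u` and may lose two pairs. -/
lemma pairFactor_two_pairs {m : ℕ} (hm : 2 ≤ m) :
    1 + pairFactor (m - 2) ≤ pairFactor m * (151 / 100 * (163 / 100)) := by
  have key : ∀ m ∈ Finset.Icc 2 7,
      1 + pairFactor (m - 2) ≤ pairFactor m * (151 / 100 * (163 / 100)) := by decide +kernel
  have := key (min m 7) (by simp; omega)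
  rwa [pairFactor_min_sub 2 (by omega), pairFactor_min (by omega)] at this

/-- Here `m` counts the pairs, and `d`, `x` are the degrees of `v` and its only partner. Discarding
`v` loses one pair and shrinks `d - 1` triples to pairs, whence the index `m + d - 2`. -/
lemma factors_one_partner {m d x : ℕ} (hm : 1 ≤ m) (hx : 2 ≤ x) (hxd : x ≤ d) :
    vertexFactor (x - 1) * pairFactor (m - 1) + pairFactor (m + d - 2) ≤
      pairFactor m * (vertexFactor d * vertexFactor x) := by
  have key : ∀ m ∈ Finset.Icc 1 6, ∀ d ∈ Finset.Icc 2 5, ∀ x ∈ Finset.Icc 2 d,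
      vertexFactor (x - 1) * pairFactor (m - 1) + pairFactor (m + d - 2) ≤
        pairFactor m * (vertexFactor d * vertexFactor x) := by decide +kernel
  have := key (min m 6) (by simp; omega) (min d 5) (by simp; omega) (min x 5) (by simp; omega)
  rw [pairFactor_min_sub 1 (by omega), pairFactor_min (by omega), vertexFactor_min_five,
    vertexFactor_min_five, vertexFactor_min_five_sub_one] at this
  refine le_trans ?_ this
  gcongr
  -- Below the cut, truncating `d` can only increase the antitone factor; beyond it, the factor for
  -- the true parameters is already 1.
  rcases le_total m 6 with h | h
  · exact pairFactor_antitone (by omega)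
  · rw [pairFactor_of_five_le (by omega)]
    exact one_le_pairFactor _

/-- The partners of `v` have degrees `x`, `y` and lie in `p`, `q` pairs. Discarding `v` creates `d -
2` pairs, and selecting the partners destroys at most `p + q`. A partner that also lies in two pairs
competes with `v` in the tie-break, which gives `hpx` and `hqy`. -/
lemma factors_two_partners {m d x y p q : ℕ} (hm : 2 ≤ m) (hd : 2 ≤ d) (hx : 2 ≤ x) (hy : 2 ≤ y)
    (hp : p ∈ Finset.Icc 1 2) (hq : q ∈ Finset.Icc 1 2) (hpx : p = 2 → x ≤ d)
    (hqy : q = 2 → y ≤ d) :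
    vertexFactor (x - 1) * vertexFactor (y - 1) * pairFactor (m - 2) +
      pairFactor (m + d - 2 - (p + q)) ≤
      pairFactor m * (vertexFactor d * (vertexFactor x * vertexFactor y)) := by
  -- The cut is at 9 = 5 + 4: as `p + q ≤ 4` and `d ≥ 2`, the last index is at least 5 once `m ≥ 9`.
  have key : ∀ m ∈ Finset.Icc 2 9, ∀ d ∈ Finset.Icc 2 5, ∀ x ∈ Finset.Icc 2 5,
      ∀ y ∈ Finset.Icc 2 5, ∀ p ∈ Finset.Icc 1 2, ∀ q ∈ Finset.Icc 1 2,
      (p = 2 → x ≤ d) → (q = 2 → y ≤ d) →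
      vertexFactor (x - 1) * vertexFactor (y - 1) * pairFactor (m - 2) +
        pairFactor (m + d - 2 - (p + q)) ≤
        pairFactor m * (vertexFactor d * (vertexFactor x * vertexFactor y)) := by
    decide +kernel
  have := key (min m 9) (by simp; omega) (min d 5) (by simp; omega) (min x 5) (by simp; omega)
    (min y 5) (by simp; omega) p hp q hq (by omega) (by omega)
  rw [pairFactor_min_sub 2 (by omega), pairFactor_min (by omega), vertexFactor_min_five,
    vertexFactor_min_five, vertexFactor_min_five, vertexFactor_min_five_sub_one,
    vertexFactor_min_five_sub_one] at this
  refine le_trans ?_ this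
  gcongr
  rcases le_total m 9 with h | h
  · exact pairFactor_antitone (by omega)
  · rw [pairFactor_of_five_le (by simp at hp hq; omega)]
    exact one_le_pairFactor _

/-- With three or more partners so many vertices disappear when `v` is discarded that the worst pair
factor 3/2 is affordable. The base 163/100 is the factor of a partner of degree 2. -/
lemma factors_many_partners {m d k : ℕ} (hk : 3 ≤ k) (hkm : k ≤ m) (hkd : k ≤ d) :
    (163 / 100) ^ k * pairFactor (m - k) + 3 / 2 ≤
      pairFactor m * (vertexFactor d * (163 / 100) ^ k) := by
  have key : ∀ k ∈ Finset.Icc 3 4, ∀ m ∈ Finset.Icc k 9, ∀ d ∈ Finset.Icc k 4,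
      (163 / 100) ^ k * pairFactor (m - k) + 3 / 2 ≤
        pairFactor m * (vertexFactor d * (163 / 100) ^ k) := by
    decide +kernel
  rcases le_or_gt k 4 with h4 | h4
  · have := key k (by simp; omega) (min m 9) (by simp; omega) (min d 4) (by simp; omega)
    rwa [pairFactor_min_sub k (by omega), pairFactor_min (by omega), vertexFactor_min] at this
  -- For `k ≥ 5` all relevant factors have their limit values, and 3/2 + 3/2 · 1.63 ^ (-5) < 1.675
  -- suffices.
  · rw [pairFactor_of_five_le (n := m) (by omega), vertexFactor_of_four_le (by omega)]
    have h1 := pairFactor_le (m - k)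
    have h2 : (163 / 100 : ℚ) ^ 5 ≤ (163 / 100) ^ k := pow_le_pow_right₀ (by norm_num) h4
    nlinarith [pow_pos (show (0 : ℚ) < 163 / 100 by norm_num) k]

/-- The ratios of consecutive vertex factors do not increase with the degree. -/
lemma vertexFactor_sub_one_mul_le {d k : ℕ} (hd : 3 ≤ d) (hk : 1 ≤ k) (hkd : k ≤ d) :
    vertexFactor (k - 1) * vertexFactor d ≤ vertexFactor (d - 1) * vertexFactor k := by
  have key : ∀ d ∈ Finset.Icc 3 5, ∀ k ∈ Finset.Icc 1 d,
      vertexFactor (k - 1) * vertexFactor d ≤ vertexFactor (d - 1) * vertexFactor k := by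
    decide +kernel
  have := key (min d 5) (by simp; omega) (min k 5) (by simp; omega)
  rwa [vertexFactor_min_five, vertexFactor_min_five, vertexFactor_min_five_sub_one,
    vertexFactor_min_five_sub_one] at this

/-- Every lost hyperedge gains at least the ratio at the maximum degree `d`. The total gain is thus
bounded in terms of the number of lost incidences, however these are distributed over the vertices.
-/
lemma vertexFactor_sub_mul_pow_le {d k : ℕ} (hd : 3 ≤ d) (hkd : k ≤ d) (c : ℕ) (hc : c ≤ k) :
    vertexFactor (k - c) * (vertexFactor d / vertexFactor (d - 1)) ^ c ≤ vertexFactor k := by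
  have h0 := vertexFactor_pos (d - 1)
  have h1 := vertexFactor_pos d
  induction c with
  | zero => simp
  | succ c ih =>
    refine le_trans ?_ (ih (by omega))
    have h2 := vertexFactor_sub_one_mul_le (k := k - c) hd (by omega) (by omega)
    rw [Nat.sub_sub] at h2
    have h3 : vertexFactor (k - (c + 1)) * (vertexFactor d / vertexFactor (d - 1)) ≤
        vertexFactor (k - c) := by
      rw [mul_div_assoc', div_le_iff₀ h0]
      linarith
    rw [pow_succ', ← mul_assoc]
    gcongr

/-- The exponent is the number of incidences lost by the other vertices when a vertex of degree `d`
is selected. For `d ≥ 5` the ratio is 1 and the claim is 3/2 + 1 ≤ 3/2 · 67/40, so the limit of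
`vertexFactor` cannot be below 5/3. -/
lemma factors_triples {d : ℕ} (hd : 3 ≤ d) :
    3 / 2 + pairFactor d * (vertexFactor d / vertexFactor (d - 1)) ^ (2 * d) ≤
      3 / 2 * (vertexFactor d * (vertexFactor d / vertexFactor (d - 1)) ^ (2 * d)) := by
  rcases Nat.lt_or_ge d 5 with h | h
  · have key : ∀ d ∈ Finset.Icc 3 4,
        3 / 2 + pairFactor d * (vertexFactor d / vertexFactor (d - 1)) ^ (2 * d) ≤
        3 / 2 * (vertexFactor d * (vertexFactor d / vertexFactor (d - 1)) ^ (2 * d)) := by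
      decide +kernel
    exact key d (by simp; omega)
  · rw [pairFactor_of_five_le h, vertexFactor_of_four_le (by omega : 4 ≤ d),
      vertexFactor_of_four_le (by omega : 4 ≤ d - 1)]
    norm_num

end Numerics

/-! ### Each branching does not increase the total weight -/

section Branching

open Finset

variable {α : Type*} [DecidableEq α] {F : Finset (Finset α)} {P D : Finset α} {v u w : α}

lemma mem_pairs {β : Type*} {F : Finset (Finset β)} {e : Finset β} :
    e ∈ pairs F ↔ e ∈ F ∧ #e = 2 := mem_filter

lemma card_partners (F : Finset (Finset α)) (v : α) :
    #(partners F v) = degree (pairs F) v := by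
  refine card_bij (fun u _ => {v, u}) (fun u hu => ?_) (fun a ha b hb hab => ?_) fun e he => ?_
  · rw [mem_partners] at hu
    rw [mem_filter, mem_pairs]
    exact ⟨⟨hu.2, card_pair hu.1.symm⟩, by simp⟩
  · rw [mem_partners] at ha hb
    have : a ∈ ({v, b} : Finset α) := hab ▸ (by simp)
    simpa [ha.1] using this
  · rw [mem_filter, mem_pairs] at he
    obtain ⟨u, hu⟩ := card_eq_one.1 (show #(e.erase v) = 1 by rw [card_erase_of_mem he.2, he.1.2])
    have he' : {v, u} = e := by rw [← hu, insert_erase he.2]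
    have huv : u ∈ e.erase v := hu ▸ mem_singleton_self u
    exact ⟨u, mem_partners.2 ⟨(mem_erase.1 huv).1, he' ▸ he.1.1⟩, he'⟩

lemma degree_pairs_le (F : Finset (Finset α)) (v : α) : degree (pairs F) v ≤ degree F v :=
  card_le_card (filter_subset_filter _ (filter_subset _ _))

lemma degree_le_card (F : Finset (Finset α)) (v : α) : degree F v ≤ #F :=
  card_le_card (filter_subset _ _)

lemma degree_pos_of_mem {e : Finset α} (he : e ∈ F) (hv : v ∈ e) : 0 < degree F v :=
  degree_pos_iff.2 ⟨e, he, hv⟩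

/-- The vertices in `U` meet at most `∑ u ∈ U, degree F u` members of `F`. -/
lemma card_le_card_disjoint_add (F : Finset (Finset α)) (U : Finset α) :
    #F ≤ #{e ∈ F | Disjoint e U} + ∑ u ∈ U, degree F u := by
  rw [← card_filter_add_card_filter_not (s := F) (fun e => Disjoint e U)]
  gcongr
  refine (card_le_card (t := U.biUnion fun u => {e ∈ F | u ∈ e}) fun e he => ?_).trans
    card_biUnion_le
  obtain ⟨heF, h⟩ := mem_filter.1 he
  obtain ⟨u, hue, huU⟩ := Finset.not_disjoint_iff.1 h
  exact mem_biUnion.2 ⟨u, huU, mem_filter.2 ⟨heF, hue⟩⟩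

lemma two_le_card_of_mem_restrict_select (hF : IsClutter F) :
    ∀ e ∈ restrict F P ∅, 2 ≤ #e := by
  intro e he
  obtain ⟨e, heF, -, rfl⟩ := mem_restrict.1 he
  simpa using (hF e heF).1

/-- Selecting removes hyperedges without shrinking any, so every pair that avoids `v` stays in the
core. Vertices of `X` lose a hyperedge shared with `v`. -/
lemma weight_select (hF : IsClutter F) (X : Finset α)
    (hX : ∀ x ∈ X, x ≠ v ∧ ∃ e ∈ F, v ∈ e ∧ x ∈ e) :
    weight (restrict F {v} ∅) * (pairFactor #(pairs F) * (vertexFactor (degree F v) *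
      ∏ x ∈ X, vertexFactor (degree F x) / vertexFactor (degree F x - 1))) ≤
      weight F * pairFactor (#(pairs F) - degree (pairs F) v) := by
  have h := weight_restrict_mul_le_of_drop (P := {v}) (D := ∅) hF {v} X
    (disjoint_singleton_left.2 fun h => (hX v h).1 rfl)
    (fun x hx => degree_core_restrict_eq_zero (by simpa using hx))
    (fun x hx => by
      obtain ⟨-, e, he, hv, hx⟩ := hX x hx
      exact degree_core_restrict_lt he hx (by simpa using hv))
    (m := #(pairs F) - degree (pairs F) v) ?_
  · simpa using h
  · refine le_trans ?_ (card_le_card_pairs_core (G := {e ∈ pairs F | Disjoint e {v}})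
      (two_le_card_of_mem_restrict_select hF) fun e he => ?_)
    · have := card_le_card_disjoint_add (pairs F) {v}
      simp only [sum_singleton] at this
      omega
    · simp only [mem_filter, mem_pairs] at he
      exact mem_pairs.2 ⟨mem_restrict.2 ⟨e, he.1.1, he.2, by simp⟩, he.1.2⟩

/-- Discarding `v` produces a singleton `{u}` only from the pair `{v, u}`, and this pair is removed
by selecting `u`. -/
lemma two_le_card_of_mem_restrict_partners (hF : IsClutter F) :
    ∀ e ∈ restrict F (partners F v) {v}, 2 ≤ #e := by
  intro e he
  obtain ⟨e, heF, hP, rfl⟩ := mem_restrict.1 he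
  have h2 := (hF e heF).1
  by_cases hv : v ∈ e
  · rw [sdiff_singleton_eq_erase, card_erase_of_mem hv]
    by_contra hlt
    obtain ⟨u, hu⟩ := card_eq_one.1 (show #(e.erase v) = 1 by rw [card_erase_of_mem hv]; omega)
    have huv : u ∈ e.erase v := hu ▸ mem_singleton_self u
    refine Finset.disjoint_left.1 hP (mem_erase.1 huv).2 (mem_partners.2 ⟨(mem_erase.1 huv).1, ?_⟩)
    rwa [← hu, insert_erase hv]
  · rwa [sdiff_singleton_eq_erase, erase_eq_of_notMem hv]

/-- Pairs avoiding the partners survive, and each of the `degree F v - #(partners F v)` triples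
through `v` shrinks to a pair. The new pairs are distinct from the old ones because no pair of `F`
lies inside a triple of `F`. -/
lemma card_pairs_restrict_partners (hF : IsClutter F) (h3 : ∀ e ∈ F, #e ≤ 3) (v : α) :
    #(pairs F) + degree F v ≤ #(pairs (core (restrict F (partners F v) {v}))) +
      #(partners F v) + ∑ u ∈ partners F v, degree (pairs F) u := by
  set U := partners F v with hU
  have hA := card_le_card_disjoint_add (pairs F) U
  set A : Finset (Finset α) := {e ∈ pairs F | Disjoint e U} with hAdef
  set T : Finset (Finset α) := {e ∈ F | v ∈ e ∧ #e = 3} with hT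
  have hvA : ∀ e ∈ A, v ∉ e := by
    intro e he hv
    simp only [hAdef, mem_filter, mem_pairs] at he
    obtain ⟨u, hu⟩ := card_eq_one.1
      (show #(e.erase v) = 1 by rw [card_erase_of_mem hv, he.1.2])
    have huv : u ∈ e.erase v := hu ▸ mem_singleton_self u
    have hvu : {v, u} = e := by rw [← hu, insert_erase hv]
    exact Finset.disjoint_left.1 he.2 (mem_erase.1 huv).2
      (mem_partners.2 ⟨(mem_erase.1 huv).1, hvu ▸ he.1.1⟩)
  have hTcard : degree F v = #T + #U := by
    rw [hU, card_partners, degree, degree,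
      ← card_filter_add_card_filter_not (s := {e ∈ F | v ∈ e}) (fun e => #e = 3)]
    congr 1
    · rw [filter_filter]
    · congr 1
      ext e
      simp only [mem_filter, mem_pairs]
      constructor
      · rintro ⟨⟨he, hv⟩, h⟩
        have := h3 e he
        have := (hF e he).1
        exact ⟨⟨he, by omega⟩, hv⟩
      · rintro ⟨⟨he, hc⟩, hv⟩
        exact ⟨⟨he, hv⟩, by omega⟩
  have hAT : #(A ∪ T.image (·.erase v)) = #A + #T := by
    rw [card_union_of_disjoint, card_image_of_injOn]
    · intro e he f hf hef
      rw [← insert_erase (mem_filter.1 he).2.1, ← insert_erase (mem_filter.1 hf).2.1]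
      exact congrArg _ hef
    · rw [Finset.disjoint_left]
      intro e he heT
      obtain ⟨f, hf, rfl⟩ := mem_image.1 heT
      simp only [hT, hAdef, mem_filter, mem_pairs] at he hf
      have := (hF f hf.1).2 _ he.1.1 (erase_subset _ _)
      have h := he.1.2
      rw [this] at h
      omega
  have hle := card_le_card_pairs_core (G := A ∪ T.image (·.erase v))
    (two_le_card_of_mem_restrict_partners (v := v) hF) fun e he => ?_
  · rw [hAT, ← hU] at hle
    omega
  · rcases mem_union.1 he with he | he
    · have hv := hvA e he
      simp only [hAdef, mem_filter, mem_pairs] at he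
      exact mem_pairs.2 ⟨mem_restrict.2 ⟨e, he.1.1, he.2,
        by rw [sdiff_singleton_eq_erase, erase_eq_of_notMem hv]⟩, he.1.2⟩
    · obtain ⟨f, hf, rfl⟩ := mem_image.1 he
      simp only [hT, mem_filter] at hf
      refine mem_pairs.2 ⟨mem_restrict.2 ⟨f, hf.1, ?_, by rw [sdiff_singleton_eq_erase]⟩, ?_⟩
      -- A triple through `v` and a partner `u` would contain the pair `{v, u}`, so all triples
      -- through `v` avoid the selected vertices.
      · rw [Finset.disjoint_left]
        intro u huf hu
        obtain ⟨huv, hp⟩ := mem_partners.1 hu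
        have := (hF f hf.1).2 _ hp (insert_subset hf.2.1 (singleton_subset_iff.2 huf))
        have hc := hf.2.2
        rw [← this, card_pair huv.symm] at hc
        omega
      · rw [card_erase_of_mem hf.2.1, hf.2.2]

lemma weight_discard (hF : IsClutter F) (h3 : ∀ e ∈ F, #e ≤ 3) {m : ℕ}
    (hm : m ≤ #(pairs F) + degree F v -
      (#(partners F v) + ∑ u ∈ partners F v, degree (pairs F) u)) :
    weight (restrict F (partners F v) {v}) * (pairFactor #(pairs F) * (vertexFactor (degree F v) *
      ∏ u ∈ partners F v, vertexFactor (degree F u))) ≤ weight F * pairFactor m := by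
  have hv : v ∉ partners F v := fun h => (mem_partners.1 h).1 rfl
  have h := weight_restrict_mul_le_of_gone (P := partners F v) (D := {v}) hF
    (insert v (partners F v))
    (fun x hx => degree_core_restrict_eq_zero (by simpa [or_comm] using hx))
    (m := m) (by
      have := card_pairs_restrict_partners hF h3 v
      omega)
  rwa [prod_insert hv] at h

/-- Once `v` is discarded its partners are singletons, which the core ignores, so selecting them
costs and gains nothing. Branches that merely discard `v` thus obey `weight_discard`. -/
lemma weight_discard_eq (F : Finset (Finset α)) (v : α) :
    weight (restrict F ∅ {v}) = weight (restrict F (partners F v) {v}) := by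
  have h : restrict (restrict F ∅ {v}) (partners F v) ∅ = restrict F (partners F v) {v} := by
    rw [restrict_restrict, empty_union, union_empty]
    exact disjoint_singleton_left.2 fun h => (mem_partners.1 h).1 rfl
  rw [← h]
  refine (weight_eq_of_core_eq (core_restrict_of_singletons fun u hu => ?_)).symm
  obtain ⟨huv, he⟩ := mem_partners.1 hu
  refine mem_restrict.2 ⟨_, he, by simp, ?_⟩
  ext x
  simp only [mem_sdiff, mem_insert, mem_singleton]
  constructor
  · tauto
  · rintro rfl
    exact ⟨Or.inr rfl, huv⟩

/-- If discarding `D` forces another vertex, then the loss of pairs is compensated. -/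
lemma weight_restrict_forced (hF : IsClutter F) {x : α} (hx : {x} ∈ restrict F P D) :
    weight (restrict F P D) * (pairFactor #(pairs F) *
      ∏ y ∈ P ∪ D, vertexFactor (degree F y)) ≤ weight F := by
  obtain ⟨e, he, heP, hex⟩ := mem_restrict.1 hx
  have hxe : x ∈ e \ D := hex ▸ mem_singleton_self x
  have hxP : x ∉ P ∪ D := by
    rw [mem_sdiff] at hxe
    rw [mem_union, not_or]
    exact ⟨Finset.disjoint_left.1 heP hxe.1, hxe.2⟩
  have h := weight_restrict_mul_le_of_gone (P := P) (D := D) hF (insert x (P ∪ D))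
    (fun y hy => by
      rcases mem_insert.1 hy with rfl | hy
      · exact degree_core_eq_zero_of_singleton_mem hx
      · exact degree_core_restrict_eq_zero hy) (m := 0) (Nat.zero_le _)
  rw [prod_insert hxP] at h
  -- The forced vertex has positive degree; its factor is at least 151/100 and outweighs the worst
  -- pair factor 3/2.
  have h1 : (151 / 100 : ℚ) ≤ vertexFactor (degree F x) :=
    vertexFactor_monotone (degree_pos_of_mem he (mem_sdiff.1 hxe).1)
  have h2 : 0 ≤ weight (restrict F P D) * (pairFactor #(pairs F) *
      ∏ y ∈ P ∪ D, vertexFactor (degree F y)) :=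
    mul_nonneg (zero_le_one.trans (one_le_weight _)) (mul_nonneg (pairFactor_pos _).le
      (prod_nonneg fun _ _ => (vertexFactor_pos _).le))
  have h3 : pairFactor 0 = 3 / 2 := rfl
  rw [h3] at h
  nlinarith

lemma eq_of_degree_eq_one (hv : degree F v = 1) {e f : Finset α} (he : e ∈ F) (hve : v ∈ e)
    (hf : f ∈ F) (hvf : v ∈ f) : e = f :=
  card_le_one.1 hv.le e (mem_filter.2 ⟨he, hve⟩) f (mem_filter.2 ⟨hf, hvf⟩)

/-- Selecting a vertex and discarding the rest of one of its hyperedges. -/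
lemma weight_select_discard (hF : IsClutter F) {e : Finset α} (he : e ∈ F)
    (hve : v ∈ e) :
    weight (restrict F {v} (e.erase v)) * (pairFactor #(pairs F) *
      ∏ y ∈ e, vertexFactor (degree F y)) ≤
      weight F * pairFactor (#(pairs F) - degree (pairs F) v) := by
  have hun : {v} ∪ e.erase v = e := by rw [singleton_union, insert_erase hve]
  -- Either some vertex becomes forced, which pays for any loss of pairs, or no remaining set falls
  -- below size 2 and the pairs avoiding `v` are untouched.
  by_cases hx : ∃ x, {x} ∈ restrict F {v} (e.erase v)
  · obtain ⟨x, hx⟩ := hx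
    have h := weight_restrict_forced hF hx
    rw [hun] at h
    exact h.trans (le_mul_of_one_le_right (zero_le_one.trans (one_le_weight _))
      (one_le_pairFactor _))
  · have hne : ∀ f ∈ F, Disjoint f {v} → 2 ≤ #(f \ e.erase v) := by
      intro f hf hfv
      by_contra hlt
      rcases Nat.lt_or_ge #(f \ e.erase v) 1 with h0 | h1
      · rw [Nat.lt_one_iff, card_eq_zero, sdiff_eq_empty_iff_subset] at h0
        have := (hF e he).2 f hf (h0.trans (erase_subset _ _))
        subst this
        simp [hve] at hfv
      · obtain ⟨x, hx'⟩ := card_eq_one.1 (show #(f \ e.erase v) = 1 by omega)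
        exact hx ⟨x, mem_restrict.2 ⟨f, hf, hfv, hx'⟩⟩
    have h := weight_restrict_mul_le_of_gone (P := {v}) (D := e.erase v) hF e
      (fun y hy => degree_core_restrict_eq_zero (by rwa [hun]))
      (m := #(pairs F) - degree (pairs F) v) ?_
    · exact h
    · refine le_trans ?_ (card_le_card_pairs_core (G := {e ∈ pairs F | Disjoint e {v}})
        (fun s hs => ?_) fun f hf => ?_)
      · have := card_le_card_disjoint_add (pairs F) {v}
        simp only [sum_singleton] at this
        omega
      · obtain ⟨f, hf, hfv, rfl⟩ := mem_restrict.1 hs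
        exact hne f hf hfv
      · simp only [mem_filter, mem_pairs] at hf
        have hle := hne f hf.1.1 hf.2
        have heq : f \ e.erase v = f :=
          eq_of_subset_of_card_le sdiff_subset (by rw [hf.1.2]; exact hle)
        exact mem_pairs.2 ⟨mem_restrict.2 ⟨f, hf.1.1, hf.2, heq⟩, hf.1.2⟩

lemma pow_le_prod_vertexFactor (U : Finset α) (k : ℕ) (h : ∀ u ∈ U, k ≤ degree F u) :
    vertexFactor k ^ #U ≤ ∏ u ∈ U, vertexFactor (degree F u) := by
  rw [← prod_const]
  exact prod_le_prod (fun _ _ => (vertexFactor_pos _).le) fun u hu => vertexFactor_monotone (h u hu)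

lemma weight_nonneg (F : Finset (Finset α)) : 0 ≤ weight F := zero_le_one.trans (one_le_weight F)

lemma partners_eq_of_degree_eq_one (hv : degree F v = 1) (huv : u ≠ v) (he : {v, u} ∈ F) :
    partners F v = {u} := by
  ext x
  rw [mem_partners, mem_singleton]
  constructor
  · rintro ⟨hx, hxe⟩
    have := eq_of_degree_eq_one hv he (by simp) hxe (by simp)
    have : x ∈ ({v, u} : Finset α) := this ▸ (by simp)
    simpa [hx] using this
  · rintro rfl
    exact ⟨huv, he⟩

/-- Branching at a vertex of degree 1 in a hyperedge of size 2. -/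
lemma weight_branch_degree_one_pair (hF : IsClutter F) (h3 : ∀ e ∈ F, #e ≤ 3)
    (hv : degree F v = 1) (huv : u ≠ v) (he : {v, u} ∈ F) :
    weight (restrict F {v} {u}) + weight (restrict F ∅ {v}) ≤ weight F := by
  have hp := partners_eq_of_degree_eq_one hv huv he
  have hdv : degree (pairs F) v = 1 := by rw [← card_partners, hp, card_singleton]
  have her : ({v, u} : Finset α).erase v = {u} := by
    rw [erase_insert (by simpa using huv.symm)]
  have h1 := weight_select_discard hF he (mem_insert_self v {u})
  rw [her, prod_pair huv.symm, hv, hdv] at h1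
  have hv1 : vertexFactor 1 = 151 / 100 := rfl
  rw [weight_discard_eq, hp]
  set d := degree F u
  set j := degree (pairs F) u with hj
  have hjd : j ≤ d := degree_pairs_le F u
  have hjm : j ≤ #(pairs F) := degree_le_card _ _
  have hj1 : 1 ≤ j := degree_pos_of_mem (mem_pairs.2 ⟨he, card_pair huv.symm⟩) (by simp)
  have h2 := weight_discard (v := v) hF h3 (m := #(pairs F) - j)
    (by rw [hp, hv, sum_singleton, card_singleton]; omega)
  rw [hp, prod_singleton, hv] at h2
  have hb := pairFactor_pos #(pairs F)
  have hd := vertexFactor_pos d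
  have hd1 : 151 / 100 ≤ vertexFactor d := vertexFactor_monotone (show 1 ≤ d by omega)
  have hc : 0 < pairFactor #(pairs F) * (vertexFactor 1 * vertexFactor d) := by
    rw [hv1]; positivity
  -- If `u` lies in no other pair, the estimates of both branches lose one pair only. Otherwise
  -- discarding `u` forces the other vertex of a second pair.
  rcases Nat.lt_or_ge j 2 with hj2 | hj2
  · have : j = 1 := by omega
    rw [this] at h2
    refine add_le_of_mul_le (weight_nonneg F) hc hc h1 h2 ?_
    rw [← add_mul, ← two_mul]
    refine mul_le_mul_of_nonneg_right ((pairFactor_one_pair (m := #(pairs F)) (by omega)).trans ?_)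
      hc.le
    rw [hv1]
    gcongr
  · obtain ⟨x, hx⟩ : ∃ x, {x} ∈ restrict F {v} {u} := by
      obtain ⟨f, hf, hfe⟩ := exists_mem_ne (show 1 < #{e ∈ pairs F | u ∈ e} from hj2) {v, u}
      obtain ⟨hfp, huf⟩ := mem_filter.1 hf
      obtain ⟨hfF, hfc⟩ := mem_pairs.1 hfp
      obtain ⟨x, hx⟩ := card_eq_one.1
        (show #(f \ {u}) = 1 by rw [sdiff_singleton_eq_erase, card_erase_of_mem huf, hfc])
      refine ⟨x, mem_restrict.2 ⟨f, hfF, ?_, hx⟩⟩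
      rw [disjoint_singleton_right]
      exact fun hvf => hfe (eq_of_degree_eq_one hv hfF hvf he (by simp))
    have h1' := weight_restrict_forced hF hx
    rw [singleton_union, prod_pair huv.symm, hv, ← mul_one (weight F)] at h1'
    refine add_le_of_mul_le (weight_nonneg F) hc hc h1' h2 ?_
    rw [← add_mul]
    refine mul_le_mul_of_nonneg_right ?_ hc.le
    rcases Nat.lt_or_ge j 3 with hj3 | hj3
    · have : j = 2 := by omega
      rw [this]
      refine (pairFactor_two_pairs (by omega)).trans ?_
      rw [hv1]
      have : 163 / 100 ≤ vertexFactor d := vertexFactor_monotone (show 2 ≤ d by omega)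
      gcongr
    -- With three or more pairs at `u`, the crude bound 1 + 3/2 ≤ 151/100 · 333/200 is enough.
    · have h4 : 333 / 200 ≤ vertexFactor d := vertexFactor_monotone (show 3 ≤ d by omega)
      have h5 := pairFactor_le (#(pairs F) - j)
      have h6 := one_le_pairFactor #(pairs F)
      rw [hv1]
      nlinarith

/-- Branching at an isolated hyperedge of size 3. -/
lemma weight_branch_isolated (hF : IsClutter F) {e : Finset α} (he : e ∈ F)
    (hc : #e = 3) (hd : ∀ x ∈ e, degree F x = 1) {x : α} (hx : x ∈ e) :
    weight (restrict F {x} (e.erase x)) * 3 ≤ weight F := by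
  have h := weight_select_discard hF he hx
  have hp : degree (pairs F) x = 0 := by
    by_contra h0
    obtain ⟨f, hf, hxf⟩ := degree_pos_iff.1 (Nat.pos_of_ne_zero h0)
    have := eq_of_degree_eq_one (hd x hx) he hx (mem_pairs.1 hf).1 hxf
    rw [this, (mem_pairs.1 hf).2] at hc
    omega
  rw [hp, Nat.sub_zero, prod_congr rfl fun y hy => by rw [hd y hy], prod_const, hc,
    mul_left_comm, mul_comm (weight F)] at h
  have h1 := le_of_mul_le_mul_left h (pairFactor_pos _)
  have hv1 : vertexFactor 1 = 151 / 100 := rfl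
  rw [hv1] at h1
  -- (151/100) ^ 3 > 3, so one branch takes at most a third of the weight.
  nlinarith [weight_nonneg (restrict F {x} (e.erase x))]

lemma partners_eq_empty (hv : degree (pairs F) v = 0) : partners F v = ∅ := by
  rw [← card_eq_zero, card_partners, hv]

/-- Branching at a vertex of degree 1 in a hyperedge of size 3. -/
lemma weight_branch_degree_one_triple (hF : IsClutter F) (h3 : ∀ e ∈ F, #e ≤ 3)
    (hv : degree F v = 1) {e : Finset α} (he : e ∈ F) (hve : v ∈ e) (hc : #e = 3)
    (hu : u ∈ e) (hd : 2 ≤ degree F u) :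
    weight (restrict F {v} (e.erase v)) + weight (restrict F ∅ {v}) ≤ weight F := by
  have hp : degree (pairs F) v = 0 := by
    by_contra h0
    obtain ⟨f, hf, hxf⟩ := degree_pos_iff.1 (Nat.pos_of_ne_zero h0)
    have := eq_of_degree_eq_one hv he hve (mem_pairs.1 hf).1 hxf
    rw [this, (mem_pairs.1 hf).2] at hc
    omega
  have h1 := weight_select_discard hF he hve
  have h2 := weight_discard (v := v) hF h3 (m := #(pairs F))
    (by rw [partners_eq_empty hp]; simp)
  rw [partners_eq_empty hp, prod_empty, mul_one, hv] at h2
  rw [weight_discard_eq, partners_eq_empty hp]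
  have huv : u ≠ v := by
    rintro rfl
    omega
  obtain ⟨w, hw⟩ := card_eq_one.1 (show #((e.erase v).erase u) = 1 by
    rw [card_erase_of_mem (mem_erase.2 ⟨huv, hu⟩), card_erase_of_mem hve, hc])
  have hwe : w ∈ e := mem_of_mem_erase (mem_of_mem_erase (hw ▸ mem_singleton_self w))
  have hw1 : 151 / 100 ≤ vertexFactor (degree F w) :=
    vertexFactor_monotone (degree_pos_of_mem he hwe)
  have hu2 : 163 / 100 ≤ vertexFactor (degree F u) := vertexFactor_monotone hd
  have hv1 : vertexFactor 1 = 151 / 100 := rfl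
  have hb := pairFactor_pos #(pairs F)
  rw [hp, Nat.sub_zero, ← mul_prod_erase _ _ hve, ← mul_prod_erase _ _ (mem_erase.2 ⟨huv, hu⟩),
    hw, prod_singleton, hv, hv1] at h1
  rw [hv1] at h2
  set a := vertexFactor (degree F u) * vertexFactor (degree F w)
  have ha : 163 / 100 * (151 / 100) ≤ a :=
    mul_le_mul hu2 hw1 (by norm_num) (vertexFactor_pos _).le
  refine add_le_of_mul_le (weight_nonneg F) (by positivity) (by positivity) h1 h2 ?_
  -- With s = 151/100, the two branches take the fractions 1/(s² · 163/100) and 1/s at most, whose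
  -- sum is below 1.
  nlinarith [mul_pos hb hb]

/-- Branching at a vertex `v` that lies in a maximum number of hyperedges of size 2. -/
lemma weight_branch_pair (hF : IsClutter F) (h3 : ∀ e ∈ F, #e ≤ 3)
    (hdeg : ∀ x, degree F x ≠ 1) (hpos : 0 < degree (pairs F) v)
    (hmax : ∀ x, degree (pairs F) x ≤ degree (pairs F) v)
    (hmax' : ∀ x, degree (pairs F) x = degree (pairs F) v → degree F x ≤ degree F v) :
    weight (restrict F {v} ∅) + weight (restrict F (partners F v) {v}) ≤ weight F := by
  have hcard := card_partners F v
  have hX : ∀ x ∈ partners F v, x ≠ v ∧ ∃ e ∈ F, v ∈ e ∧ x ∈ e := fun x hx =>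
    ⟨(mem_partners.1 hx).1, _, (mem_partners.1 hx).2, by simp⟩
  have hdx : ∀ x ∈ partners F v, 2 ≤ degree F x := fun x hx => by
    have := degree_pos_of_mem (mem_partners.1 hx).2 (show x ∈ ({v, x} : Finset α) by simp)
    have := hdeg x
    omega
  have hpx : ∀ x ∈ partners F v, 1 ≤ degree (pairs F) x := fun x hx =>
    degree_pos_of_mem (mem_pairs.2 ⟨(mem_partners.1 hx).2, card_pair (mem_partners.1 hx).1.symm⟩)
      (by simp)
  have hkd := degree_pairs_le F v
  have hkm := degree_le_card (pairs F) v
  have hdv : 2 ≤ degree F v := by have := hdeg v; omega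
  set k := degree (pairs F) v with hk
  set d := degree F v with hd
  set m := #(pairs F) with hm
  have hb := pairFactor_pos m
  have hvd := vertexFactor_pos d
  obtain hk1 | hk2 | hk3 : k = 1 ∨ k = 2 ∨ 3 ≤ k := by omega
  · obtain ⟨x, hx⟩ := card_eq_one.1 (hcard.trans hk1)
    have hxm : x ∈ partners F v := hx ▸ mem_singleton_self x
    -- The partner also attains the maximum number of pairs, so the tie-break bounds its degree by
    -- that of `v`.
    have hpx1 : degree (pairs F) x = 1 := by
      have := hpx x hxm
      have := hmax x
      omega
    have hxd := hmax' x (by omega)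
    have h1 := weight_select hF (partners F v) hX
    have h2 := weight_discard (v := v) hF h3 (m := m + d - 2)
      (by rw [hx, sum_singleton, card_singleton, hpx1, ← hd, ← hm])
    rw [hx, prod_singleton] at h1 h2
    rw [hx]
    rw [← hk, ← hm, ← hd, hk1] at h1
    rw [← hm, ← hd] at h2
    have h4 := vertexFactor_pos (degree F x)
    have h5 := vertexFactor_pos (degree F x - 1)
    refine add_le_of_mul_le (weight_nonneg F) (by positivity) (by positivity) h1 h2 ?_
    have h6 := factors_one_partner (m := m) (d := d) (x := degree F x) (by omega) (hdx x hxm) hxd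
    calc _ = pairFactor m * (vertexFactor d * vertexFactor (degree F x)) /
          vertexFactor (degree F x - 1) * (vertexFactor (degree F x - 1) * pairFactor (m - 1) +
            pairFactor (m + d - 2)) := by field_simp
      _ ≤ pairFactor m * (vertexFactor d * vertexFactor (degree F x)) /
          vertexFactor (degree F x - 1) *
            (pairFactor m * (vertexFactor d * vertexFactor (degree F x))) := by gcongr
      _ = _ := by field_simp
  · obtain ⟨x, y, hxy, hU⟩ := card_eq_two.1 (hcard.trans hk2)
    have hxm : x ∈ partners F v := by simp [hU]
    have hym : y ∈ partners F v := by simp [hU]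
    have h1 := weight_select hF (partners F v) hX
    have h2 := weight_discard (v := v) hF h3
      (m := m + d - 2 - (degree (pairs F) x + degree (pairs F) y)) (by
        rw [hU, sum_pair hxy, card_pair hxy, ← hd, ← hm]
        omega)
    rw [hU, prod_pair hxy] at h1 h2
    rw [hU]
    rw [← hk, ← hm, ← hd, hk2] at h1
    rw [← hm, ← hd] at h2
    have h4 := vertexFactor_pos (degree F x)
    have h5 := vertexFactor_pos (degree F x - 1)
    have h6 := vertexFactor_pos (degree F y)
    have h7 := vertexFactor_pos (degree F y - 1)
    refine add_le_of_mul_le (weight_nonneg F) (by positivity) (by positivity) h1 h2 ?_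
    have h8 := factors_two_partners (m := m) (d := d) (x := degree F x) (y := degree F y)
      (p := degree (pairs F) x) (q := degree (pairs F) y) (by omega) hdv (hdx x hxm) (hdx y hym)
      (mem_Icc.2 ⟨hpx x hxm, (hmax x).trans hk2.le⟩) (mem_Icc.2 ⟨hpx y hym, (hmax y).trans hk2.le⟩)
      (fun h => hmax' x (h.trans hk2.symm)) (fun h => hmax' y (h.trans hk2.symm))
    set p := pairFactor (m + d - 2 - (degree (pairs F) x + degree (pairs F) y))
    calc _ = pairFactor m * (vertexFactor d * (vertexFactor (degree F x) *
            vertexFactor (degree F y))) /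
          (vertexFactor (degree F x - 1) * vertexFactor (degree F y - 1)) *
            (vertexFactor (degree F x - 1) * vertexFactor (degree F y - 1) *
              pairFactor (m - 2) + p) := by field_simp
      _ ≤ pairFactor m * (vertexFactor d * (vertexFactor (degree F x) *
            vertexFactor (degree F y))) /
          (vertexFactor (degree F x - 1) * vertexFactor (degree F y - 1)) *
            (pairFactor m * (vertexFactor d * (vertexFactor (degree F x) *
              vertexFactor (degree F y)))) := by gcongr
      _ = _ := by field_simp
  -- No pairs are counted in the discarding branch, and degree drops are ignored in the selecting
  -- one.
  · have h1 := weight_select (v := v) hF ∅ (by simp)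
    have h2 := weight_discard (v := v) hF h3 (m := 0) (Nat.zero_le _)
    rw [prod_empty, mul_one, ← hk, ← hm, ← hd] at h1
    rw [← hm, ← hd] at h2
    have h4 := pow_le_prod_vertexFactor (F := F) (partners F v) 2 hdx
    rw [hcard] at h4
    have hv2 : vertexFactor 2 = 163 / 100 := rfl
    have hb0 : pairFactor 0 = 3 / 2 := rfl
    rw [hv2] at h4
    set a := ∏ u ∈ partners F v, vertexFactor (degree F u)
    have ha : (0 : ℚ) < (163 / 100) ^ k := by positivity
    have h5 : weight (restrict F (partners F v) {v}) *
        (pairFactor m * (vertexFactor d * (163 / 100) ^ k)) ≤ weight F * (3 / 2) := by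
      rw [hb0] at h2
      refine le_trans ?_ h2
      have := weight_nonneg (restrict F (partners F v) {v})
      gcongr
    refine add_le_of_mul_le (weight_nonneg F) (by positivity) (by positivity) h1 h5 ?_
    have h6 := factors_many_partners hk3 hkm hkd
    calc _ = (pairFactor m * vertexFactor d) * ((163 / 100) ^ k * pairFactor (m - k) + 3 / 2) := by
          ring
      _ ≤ (pairFactor m * vertexFactor d) *
          (pairFactor m * (vertexFactor d * (163 / 100) ^ k)) := by gcongr

/-- The estimate for discarding a vertex if all hyperedges have size 3. -/
lemma weight_discard_of_triples (hF : IsClutter F) (h3 : ∀ e ∈ F, #e = 3) (v : α) :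
    weight (restrict F ∅ {v}) * (3 / 2 * vertexFactor (degree F v)) ≤
      weight F * pairFactor (degree F v) := by
  have hp : pairs F = ∅ := by
    rw [pairs, filter_eq_empty_iff]
    intro e he
    have := h3 e he
    omega
  have hU : partners F v = ∅ := partners_eq_empty (by rw [hp]; simp [degree])
  have h := weight_discard (v := v) hF (fun e he => (h3 e he).le) (m := degree F v)
    (by rw [hU, hp]; simp)
  rw [← weight_discard_eq, hU, prod_empty, mul_one, hp, card_empty] at h
  exact h

lemma pairs_eq_empty {β : Type*} {F : Finset (Finset β)} (h3 : ∀ e ∈ F, #e = 3) : pairs F = ∅ := by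
  rw [pairs, filter_eq_empty_iff]
  intro e he
  have := h3 e he
  omega

/-- Branching at a vertex `v` of maximum degree, if this is at least 3. -/
lemma weight_branch_degree_three (hF : IsClutter F) (h3 : ∀ e ∈ F, #e = 3)
    (hd : 3 ≤ degree F v) (hmax : ∀ x, degree F x ≤ degree F v) :
    weight (restrict F {v} ∅) + weight (restrict F ∅ {v}) ≤ weight F := by
  have h2 := weight_discard_of_triples hF h3 v
  set d := degree F v with hdd
  set q := vertexFactor d / vertexFactor (d - 1) with hq
  have hq0 : 0 < q := div_pos (vertexFactor_pos _) (vertexFactor_pos _)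
  set N := ({e ∈ F | v ∈ e}.biUnion id).erase v with hN
  set c : α → ℕ := fun x => #{e ∈ F | v ∈ e ∧ x ∈ e} with hc
  have hcd : ∀ x, c x ≤ degree F x := fun x =>
    card_le_card fun e => by simp only [mem_filter]; tauto
  -- Double counting of incidences: each of the `d` triples through `v` has two other vertices.
  have hsum : ∑ x ∈ N, c x = 2 * d := by
    have h := sum_card_bipartiteAbove_eq_sum_card_bipartiteBelow
      (s := N) (t := {e ∈ F | v ∈ e}) (fun x e => x ∈ e)
    simp only [bipartiteAbove, bipartiteBelow, filter_filter] at h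
    rw [h, sum_const_nat (m := 2), mul_comm]
    · rfl
    · intro e he
      rw [show {x ∈ N | x ∈ e} = e.erase v by
        ext x
        simp only [hN, mem_filter, mem_erase, mem_biUnion, id]
        constructor
        · tauto
        · exact fun hx => ⟨⟨hx.1, e, mem_filter.1 he, hx.2⟩, hx.2⟩]
      rw [card_erase_of_mem (mem_filter.1 he).2, h3 e (mem_filter.1 he).1]
  have h1 := weight_restrict_mul_le (P := {v}) (D := ∅) hF (insert v N)
    (fun x => if x = v then vertexFactor d else q ^ c x)
    (fun x _ => by
      have := vertexFactor_pos d
      split_ifs <;> positivity)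
    (fun x _ => by
      split_ifs with hx
      · rw [degree_core_restrict_eq_zero (by simp [hx]), hx]
        simp [vertexFactor, hdd]
      · have hle : degree (core (restrict F {v} ∅)) x ≤ degree F x - c x := by
          refine (degree_core_restrict_le F {v} ∅ x).trans ?_
          have : #{e ∈ F | x ∈ e ∧ Disjoint e {v}} + c x = degree F x := by
            rw [degree, ← card_filter_add_card_filter_not (s := {e ∈ F | x ∈ e})
              (fun e => Disjoint e {v}), filter_filter, filter_filter]
            congr 1
            simp only [hc]
            congr 1
            ext e
            simp only [mem_filter, disjoint_singleton_right, not_not]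
            tauto
          omega
        exact (mul_le_mul_of_nonneg_right (vertexFactor_monotone hle) (by positivity)).trans
          (vertexFactor_sub_mul_pow_le hd (hmax x) _ (hcd x)))
    (m := 0) (Nat.zero_le _)
  rw [prod_insert (notMem_erase _ _), if_pos rfl,
    prod_congr rfl fun x hx => if_neg (ne_of_mem_erase hx), prod_pow_eq_pow_sum, hsum,
    pairs_eq_empty h3, card_empty] at h1
  have hb0 : pairFactor 0 = 3 / 2 := rfl
  rw [hb0] at h1
  have h4 := vertexFactor_pos d
  refine add_le_of_mul_le (weight_nonneg F) (by positivity) (by positivity) h1 h2 ?_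
  have h5 := factors_triples hd
  rw [← hq] at h5
  calc _ = 3 / 2 * vertexFactor d * (3 / 2 + pairFactor d * q ^ (2 * d)) := by ring
    _ ≤ 3 / 2 * vertexFactor d * (3 / 2 * (vertexFactor d * q ^ (2 * d))) := by gcongr
    _ = _ := by ring

/-- Branching at a vertex `v` of degree 2 that shares both its hyperedges with `u`. -/
lemma weight_branch_twins (hF : IsClutter F) (h3 : ∀ e ∈ F, #e = 3)
    (hv : degree F v = 2) (hu : degree F u = 2) (huv : u ≠ v) :
    weight (restrict F {v} {u}) + weight (restrict F ∅ {v}) ≤ weight F := by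
  have h2 := weight_discard_of_triples hF h3 v
  have h1 := weight_restrict_mul_le_of_gone (P := {v}) (D := {u}) hF {v, u}
    (fun x hx => degree_core_restrict_eq_zero hx) (m := 0) (Nat.zero_le _)
  have hv2 : vertexFactor 2 = 163 / 100 := rfl
  have hb0 : pairFactor 0 = 3 / 2 := rfl
  have hb2 : pairFactor 2 = 63 / 50 := rfl
  rw [prod_pair huv.symm, hv, hu, pairs_eq_empty h3, card_empty, hb0, hv2] at h1
  rw [hv, hv2, hb2] at h2
  -- With t = 163/100, the branches take at most 1/t² and 0.84/t, where 0.84 = (63/50)/(3/2).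
  linarith [weight_nonneg F]

/-- Branching at a vertex `v` of degree 2 whose hyperedges have no other common vertex. -/
lemma weight_branch_degree_two (hF : IsClutter F) (h3 : ∀ e ∈ F, #e = 3)
    (hdeg : ∀ x ∈ F.biUnion id, degree F x = 2) {u₁ u₂ w₂ : α} {e₁ e₂ : Finset α}
    (he₁ : e₁ ∈ F) (he₂ : e₂ ∈ F) (hve₁ : v ∈ e₁) (hu₁ : u₁ ∈ e₁) (hu₁v : u₁ ≠ v)
    (he : e₂ = {v, u₂, w₂}) (hu₁₂ : u₁ ∉ e₂) :
    weight (restrict F {v, u₁} {u₂, w₂}) + weight (restrict F {v} {u₁}) +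
      weight (restrict F ∅ {v}) ≤ weight F := by
  subst he
  have hmem : ∀ {x e}, e ∈ F → x ∈ e → degree F x = 2 := fun he hx =>
    hdeg _ (mem_biUnion.2 ⟨_, he, hx⟩)
  have hdv := hmem he₁ hve₁
  have hdu₁ := hmem he₁ hu₁
  have hdu₂ := hmem (x := u₂) he₂ (by simp)
  have hdw₂ := hmem (x := w₂) he₂ (by simp)
  obtain ⟨hvu₂, hvw₂, hu₂w₂⟩ : v ≠ u₂ ∧ v ≠ w₂ ∧ u₂ ≠ w₂ := by
    have h := h3 _ he₂
    refine ⟨?_, ?_, ?_⟩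
    · rintro rfl
      have := card_le_two (a := v) (b := w₂)
      simp only [insert_idem] at h
      omega
    · rintro rfl
      have := card_le_two (a := u₂) (b := v)
      rw [insert_eq_of_mem (by simp)] at h
      omega
    · rintro rfl
      have := card_le_two (a := v) (b := u₂)
      simp only [insert_eq_of_mem (mem_singleton_self u₂)] at h
      omega
  simp only [mem_insert, mem_singleton, not_or] at hu₁₂
  have hv2 : vertexFactor 2 = 163 / 100 := rfl
  have hv1 : vertexFactor (2 - 1) = 151 / 100 := rfl
  have hb0 : pairFactor 0 = 3 / 2 := rfl
  have hb2 : pairFactor 2 = 63 / 50 := rfl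
  have hdisj : Disjoint ({v, u₁} : Finset α) {u₂, w₂} := by
    simp [hvu₂.symm, hvw₂.symm, Ne.symm hu₁₂.2.1, Ne.symm hu₁₂.2.2]
  have h1 := weight_restrict_mul_le_of_gone (P := {v, u₁}) (D := {u₂, w₂}) hF
    ({v, u₁} ∪ {u₂, w₂}) (fun x hx => degree_core_restrict_eq_zero hx) (m := 0) (Nat.zero_le _)
  rw [prod_union hdisj, prod_pair hu₁v.symm, prod_pair hu₂w₂, hdv, hdu₁, hdu₂,
    hdw₂, pairs_eq_empty h3, card_empty, hb0, hv2] at h1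
  -- Selecting `v` removes the second hyperedge, so `u₂` and `w₂` drop from degree 2.
  have h2 := weight_restrict_mul_le_of_drop (P := {v}) (D := {u₁}) hF {v, u₁} {u₂, w₂}
    hdisj (fun x hx => degree_core_restrict_eq_zero hx)
    (fun x hx => degree_core_restrict_lt he₂ (mem_insert_of_mem hx) (by simp))
    (m := 0) (Nat.zero_le _)
  rw [prod_pair hu₁v.symm, prod_pair hu₂w₂, hdv, hdu₁, hdu₂, hdw₂, pairs_eq_empty h3, card_empty, hb0,
    hv1, hv2] at h2
  have h4 := weight_discard_of_triples hF h3 v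
  rw [hdv, hv2, hb2] at h4
  -- With t = 163/100, the fractions are 1/t⁴, 1.51²/t⁴ and 0.84/t; their sum is about 0.98.
  linarith [weight_nonneg F]

end Branching

/-! ### Results of the timed computations -/

section Values

variable {β γ : Type}

@[simp] lemma val_pure (b : β) : (pure b : Timed β).val = b := rfl
@[simp] lemma val_bind (x : Timed β) (f : β → Timed γ) : (x >>= f).val = (f x.val).val := rfl
@[simp] lemma val_step (x : Timed β) : (step x).val = x.val := rfl

lemma val_ite (c : Prop) [Decidable c] (x y : Timed β) :
    (if c then x else y).val = if c then x.val else y.val := apply_ite _ _ _ _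

@[simp] lemma anyT_val (p : β → Timed Bool) (l : List β) :
    (anyT p l).val = l.any fun b => (p b).val := by
  induction l with
  | nil => rfl
  | cons b l ih =>
    simp only [anyT, val_step, val_bind, val_ite, val_pure, ih, List.any_cons]
    cases (p b).val <;> rfl

@[simp] lemma allT_val (p : β → Timed Bool) (l : List β) :
    (allT p l).val = l.all fun b => (p b).val := by
  induction l with
  | nil => rfl
  | cons b l ih =>
    simp only [allT, val_step, val_bind, val_ite, val_pure, ih, List.all_cons]
    cases (p b).val <;> rfl

@[simp] lemma findT_val (p : β → Timed Bool) (l : List β) :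
    (findT p l).val = l.find? fun b => (p b).val := by
  induction l with
  | nil => rfl
  | cons b l ih =>
    simp only [findT, val_step, val_bind, val_ite, val_pure, ih, List.find?_cons]
    cases (p b).val <;> rfl

@[simp] lemma filterT_val (p : β → Timed Bool) (l : List β) :
    (filterT p l).val = l.filter fun b => (p b).val := by
  induction l with
  | nil => rfl
  | cons b l ih =>
    simp only [filterT, val_step, val_bind, val_pure, ih, List.filter_cons]

@[simp] lemma countT_val (p : β → Timed Bool) (l : List β) :
    (countT p l).val = l.countP fun b => (p b).val := by
  induction l with
  | nil => rfl
  | cons b l ih =>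
    simp only [countT, val_step, val_bind, val_pure, ih, List.countP_cons]
    split_ifs <;> rfl

@[simp] lemma lengthT_val (l : List β) : (lengthT l).val = l.length := by
  induction l with
  | nil => rfl
  | cons b l ih => simp only [lengthT, val_step, val_bind, val_pure, ih, List.length_cons]

@[simp] lemma mapT_val (f : β → Timed γ) (l : List β) :
    (mapT f l).val = l.map fun b => (f b).val := by
  induction l with
  | nil => rfl
  | cons b l ih => simp only [mapT, val_step, val_bind, val_pure, ih, List.map_cons]

@[simp] lemma appendT_val (l m : List β) : (appendT l m).val = l ++ m := by
  induction l with
  | nil => rfl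
  | cons b l ih => simp only [appendT, val_step, val_bind, val_pure, ih, List.cons_append]

@[simp] lemma flatMapT_val (f : β → Timed (List γ)) (l : List β) :
    (flatMapT f l).val = l.flatMap fun b => (f b).val := by
  induction l with
  | nil => rfl
  | cons b l ih => simp only [flatMapT, val_step, val_bind, appendT_val, ih, List.flatMap_cons]

lemma argmaxT_eq_none {f : β → Timed ℕ} {l : List β} (h : (argmaxT f l).val = none) : l = [] := by
  cases l with
  | nil => rfl
  | cons b l =>
    simp only [argmaxT, val_step, val_bind] at h
    split at h
    · simp at h
    · simp only [val_pure] at h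
      split_ifs at h

lemma argmaxT_eq_some {f : β → Timed ℕ} {l : List β} {b : β} {k : ℕ}
    (h : (argmaxT f l).val = some (b, k)) :
    b ∈ l ∧ k = (f b).val ∧ ∀ b' ∈ l, (f b').val ≤ k := by
  induction l generalizing b k with
  | nil => simp [argmaxT] at h
  | cons a l ih =>
    simp only [argmaxT, val_step, val_bind] at h
    split at h
    · rename_i hn
      simp only [val_pure, Option.some.injEq, Prod.mk.injEq] at h
      obtain ⟨rfl, rfl⟩ := h
      simp [argmaxT_eq_none hn]
    · rename_i b' k' hs
      obtain ⟨h1, h2, h3⟩ := ih hs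
      simp only [val_pure] at h
      split_ifs at h with hle
      · simp only [Option.some.injEq, Prod.mk.injEq] at h
        obtain ⟨rfl, rfl⟩ := h
        refine ⟨by simp, rfl, fun c hc => ?_⟩
        rcases List.mem_cons.1 hc with rfl | hc
        exacts [le_rfl, (h3 c hc).trans hle]
      · simp only [Option.some.injEq, Prod.mk.injEq] at h
        obtain ⟨rfl, rfl⟩ := h
        refine ⟨by simp [h1], h2, fun c hc => ?_⟩
        rcases List.mem_cons.1 hc with rfl | hc
        exacts [(not_le.1 hle).le, h3 c hc]

variable {α : Type} [DecidableEq α]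

/-- The set of sets described by a list of lists. -/
def family (E : List (List α)) : Finset (Finset α) := (E.map List.toFinset).toFinset

lemma mem_family {E : List (List α)} {s : Finset α} :
    s ∈ family E ↔ ∃ e ∈ E, e.toFinset = s := by
  simp [family]

@[simp] lemma eqT_val (x y : α) : (eqT x y).val = decide (x = y) := by
  rw [Bool.eq_iff_iff]
  simp [eqT]

@[simp] lemma neT_val (x y : α) : (neT x y).val = !decide (x = y) := by
  rw [Bool.eq_iff_iff]
  simp [neT]

@[simp] lemma memT_val (x : α) (e : List α) : (memT x e).val = decide (x ∈ e) := by
  rw [Bool.eq_iff_iff]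
  simp [memT]

@[simp] lemma subsetT_val (e f : List α) :
    (subsetT e f).val = decide (e.toFinset ⊆ f.toFinset) := by
  rw [Bool.eq_iff_iff]
  simp [subsetT, Finset.subset_iff]

@[simp] lemma sameSetT_val (e f : List α) :
    (sameSetT e f).val = decide (e.toFinset = f.toFinset) := by
  rw [Bool.eq_iff_iff]
  simp only [sameSetT, val_bind, val_ite, subsetT_val, val_pure]
  simp [Finset.Subset.antisymm_iff]

@[simp] lemma ssubsetT_val (e f : List α) :
    (ssubsetT e f).val = decide (e.toFinset ⊂ f.toFinset) := by
  rw [Bool.eq_iff_iff]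
  simp only [ssubsetT, val_bind, val_ite, subsetT_val, val_pure]
  simp [Finset.ssubset_def]

@[simp] lemma hasSizeT_val {β : Type} (k : ℕ) (e : List β) :
    (hasSizeT k e).val = (e.length == k) := by
  simp [hasSizeT]

@[simp] lemma degreeT_val (E : List (List α)) (v : α) :
    (degreeT E v).val = E.countP fun e => decide (v ∈ e) := by
  simp [degreeT]

@[simp] lemma hasDegreeT_val (E : List (List α)) (k : ℕ) (v : α) :
    (hasDegreeT E k v).val = ((degreeT E v).val == k) := by
  simp [hasDegreeT]

@[simp] lemma isPairAtT_val (v : α) (e : List α) :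
    (isPairAtT v e).val = decide (e.length = 2 ∧ v ∈ e) := by
  rw [Bool.eq_iff_iff]
  simp only [isPairAtT, val_bind, val_ite, hasSizeT_val, memT_val, val_pure]
  simp

@[simp] lemma containsBothT_val (v u : α) (e : List α) :
    (containsBothT v u e).val = decide (v ∈ e ∧ u ∈ e) := by
  rw [Bool.eq_iff_iff]
  simp only [containsBothT, val_bind, val_ite, memT_val, val_pure]
  simp

@[simp] lemma hitsAllT_val (E : List (List α)) (T : List α) :
    (hitsAllT E T).val = decide (∀ s ∈ family E, (s ∩ T.toFinset).Nonempty) := by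
  rw [Bool.eq_iff_iff]
  simp [hitsAllT, mem_family, Finset.Nonempty]

lemma dedupT_sublist (E : List (List α)) : (dedupT E).val.Sublist E := by
  induction E with
  | nil => exact List.Sublist.refl _
  | cons e E ih =>
    simp only [dedupT, val_step, val_bind, val_ite, val_pure]
    split_ifs
    · exact ih.cons e
    · exact ih.cons_cons e

lemma family_dedupT (E : List (List α)) : family (dedupT E).val = family E := by
  induction E with
  | nil => rfl
  | cons e E ih =>
    simp only [dedupT, val_step, val_bind, val_ite, val_pure, anyT_val, sameSetT_val]
    split_ifs with h
    · rw [ih]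
      rw [List.any_eq_true] at h
      obtain ⟨f, hf, hef⟩ := h
      have : e.toFinset ∈ family E := by
        rw [← ih, mem_family]
        exact ⟨f, hf, (of_decide_eq_true hef).symm⟩
      ext s
      rw [show family (e :: E) = insert e.toFinset (family E) by simp [family], Finset.mem_insert]
      constructor
      · exact Or.inr
      · rintro (rfl | h)
        exacts [this, h]
    · simp only [family, List.map_cons, List.toFinset_cons] at ih ⊢
      rw [ih]

lemma nodup_dedupT (E : List (List α)) : ((dedupT E).val.map List.toFinset).Nodup := by
  induction E with
  | nil => exact List.nodup_nil
  | cons e E ih =>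
    simp only [dedupT, val_step, val_bind, val_ite, val_pure, anyT_val, sameSetT_val]
    split_ifs with h
    · exact ih
    · rw [List.map_cons, List.nodup_cons]
      refine ⟨fun hm => h ?_, ih⟩
      obtain ⟨f, hf, hef⟩ := List.mem_map.1 hm
      exact List.any_eq_true.2 ⟨f, hf, decide_eq_true hef.symm⟩

@[simp] lemma selectT_val (v : α) (I : Inst α) : (selectT v I).val =
    ⟨I.V.filter fun x => !decide (v = x), I.E.filter fun e => !decide (v ∈ e), v :: I.S⟩ := by
  simp [selectT]

@[simp] lemma discardT_val (v : α) (I : Inst α) : (discardT v I).val =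
    ⟨I.V.filter fun x => !decide (v = x),
      (dedupT (I.E.map fun e => e.filter fun x => !decide (v = x))).val, I.S⟩ := by
  simp [discardT]

end Values

/-! ### Instances, their invariants and their solutions -/

section Instances

open Finset

variable {α : Type} [DecidableEq α]

/-- The set `T` meets all members of `F`, and each element of `T` is the only element of `T` in
some member of `F`. -/
def IsMinimalHittingSet (F : Finset (Finset α)) (T : Finset α) : Prop :=
  (∀ s ∈ F, (s ∩ T).Nonempty) ∧ ∀ x ∈ T, ∃ s ∈ F, s ∩ T = {x}

lemma toFinset_filter_ne (l : List α) (v : α) :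
    (l.filter fun x => !decide (v = x)).toFinset = l.toFinset.erase v := by
  ext y
  simp only [List.mem_toFinset, List.mem_filter, mem_erase, Bool.not_eq_true',
    decide_eq_false_iff_not]
  exact ⟨fun h => ⟨Ne.symm h.2, h.1⟩, fun h => ⟨h.2, Ne.symm h.1⟩⟩

/-- When `T` hits everything, removing `x` leaves a hyperedge unhit exactly when that hyperedge
meets `T` in `x` alone. -/
lemma isMinimalT_val (E : List (List α)) (T : List α) :
    (isMinimalT E T).val = true ↔ IsMinimalHittingSet (family E) T.toFinset := by
  simp only [isMinimalT, val_bind, val_ite, hitsAllT_val, allT_val, val_pure, filterT_val,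
    neT_val, IsMinimalHittingSet]
  split_ifs with h
  · have h' := of_decide_eq_true h
    simp only [List.all_eq_true, Bool.not_eq_true', decide_eq_false_iff_not, List.mem_toFinset]
    rw [and_iff_right h']
    refine forall₂_congr fun x hx => ?_
    rw [toFinset_filter_ne]
    push Not
    refine exists_congr fun s => and_congr_right fun hs => ?_
    constructor
    · intro h0
      refine Finset.Subset.antisymm (fun y hy => ?_) ?_
      · by_contra hyx
        rw [mem_singleton] at hyx
        rw [mem_inter] at hy
        have : y ∈ s ∩ T.toFinset.erase x := mem_inter.2 ⟨hy.1, mem_erase.2 ⟨hyx, hy.2⟩⟩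
        simp [h0] at this
      · obtain ⟨y, hy⟩ := h' s hs
        by_cases hyx : y = x
        · rwa [singleton_subset_iff, ← hyx]
        · rw [mem_inter] at hy
          have : y ∈ s ∩ T.toFinset.erase x := mem_inter.2 ⟨hy.1, mem_erase.2 ⟨hyx, hy.2⟩⟩
          simp [h0] at this
    · intro h0
      rw [inter_erase, h0]
      simp
  · have h' := of_decide_eq_false (Bool.eq_false_iff.2 h)
    simp [h']

/-- The invariants of the instances `I` that arise from the input hyperedges `F₀`. -/
structure Inst.Valid (F₀ : Finset (Finset α)) (I : Inst α) : Prop where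
  nodup_vertices : I.V.Nodup
  nodup_selected : I.S.Nodup
  notMem_selected : ∀ x ∈ I.V, x ∉ I.S
  nodup_edge : ∀ e ∈ I.E, e.Nodup
  subset_vertices : ∀ e ∈ I.E, ∀ x ∈ e, x ∈ I.V
  length_le : ∀ e ∈ I.E, e.length ≤ 3
  nodup_edges : (I.E.map List.toFinset).Nodup
  -- These two fields link current and input hyperedges. Only inclusions are required, because
  -- removing supersets destroys any exact correspondence.
  exists_original : ∀ s ∈ family I.E, ∃ e₀ ∈ F₀, ∀ x ∈ e₀, x ∈ I.S ∨ x ∈ I.V → x ∈ s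
  exists_remaining : ∀ e₀ ∈ F₀, (∃ x ∈ e₀, x ∈ I.S) ∨ ∃ s ∈ family I.E, s ⊆ e₀

/-- The sets that the algorithm has to output on the instance `I`. -/
def Inst.IsSolution (F₀ : Finset (Finset α)) (I : Inst α) (T : Finset α) : Prop :=
  IsMinimalHittingSet F₀ T ∧ I.S.toFinset ⊆ T ∧ T ⊆ I.S.toFinset ∪ I.V.toFinset

/-- The instance `J` arises from `I` by selecting the vertices in `P` and discarding those
in `D`. -/
structure Inst.Reaches (F₀ : Finset (Finset α)) (I : Inst α) (P D : Finset α) (J : Inst α) :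
    Prop where
  valid : J.Valid F₀
  selected : J.S.toFinset = I.S.toFinset ∪ P
  vertices : J.V.toFinset = I.V.toFinset \ (P ∪ D)
  edges : family J.E = restrict (family I.E) P D
  select_subset : P ⊆ I.V.toFinset
  discard_subset : D ⊆ I.V.toFinset
  disjoint : Disjoint P D
  length_vertices : J.V.length + (#P + #D) = I.V.length
  length_selected : J.S.length = I.S.length + #P
  length_edges : J.E.length ≤ I.E.length

variable {F₀ : Finset (Finset α)} {I J : Inst α} {P D : Finset α} {v : α}

/-- A solution contains no discarded vertex, so the vertex in which it meets the original hyperedge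
is still present in `s`. -/
lemma Inst.Valid.inter_nonempty (hI : I.Valid F₀) {T : Finset α} (hT : I.IsSolution F₀ T)
    {s : Finset α} (hs : s ∈ family I.E) : (s ∩ T).Nonempty := by
  obtain ⟨e₀, he₀, h⟩ := hI.exists_original s hs
  obtain ⟨x, hx⟩ := hT.1.1 e₀ he₀
  rw [mem_inter] at hx
  refine ⟨x, mem_inter.2 ⟨h x hx.1 ?_, hx.2⟩⟩
  simpa using hT.2.2 hx.2

/-- The private input hyperedge of `x` is not hit by the selected vertices, since these belong to
`T` and differ from `x`. A current hyperedge inside it therefore remains, and it is private for `x`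
too. -/
lemma Inst.Valid.exists_private (hI : I.Valid F₀) {T : Finset α} (hT : I.IsSolution F₀ T)
    {x : α} (hx : x ∈ T) (hxS : x ∉ I.S) : ∃ s ∈ family I.E, s ∩ T = {x} := by
  obtain ⟨e₀, he₀, h⟩ := hT.1.2 x hx
  rcases hI.exists_remaining e₀ he₀ with ⟨y, hy, hyS⟩ | ⟨s, hs, hse⟩
  · have : y ∈ e₀ ∩ T := mem_inter.2 ⟨hy, hT.2.1 (List.mem_toFinset.2 hyS)⟩
    rw [h, mem_singleton] at this
    exact absurd (this ▸ hyS) hxS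
  · refine ⟨s, hs, (subset_singleton_iff.1 ?_).resolve_left
      (hI.inter_nonempty hT hs).ne_empty⟩
    rw [← h]
    exact inter_subset_inter_right hse

/-- Solutions are defined by the input family, so selecting and discarding merely prescribe elements
and non-elements of `T`. -/
lemma Inst.Reaches.isSolution_iff (h : I.Reaches F₀ P D J) (hI : I.Valid F₀) (T : Finset α) :
    J.IsSolution F₀ T ↔ I.IsSolution F₀ T ∧ P ⊆ T ∧ Disjoint T D := by
  rw [IsSolution, IsSolution, h.selected, h.vertices, union_subset_iff]
  constructor
  · rintro ⟨h1, ⟨h2, h3⟩, h4⟩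
    refine ⟨⟨h1, h2, h4.trans ?_⟩, h3, ?_⟩
    · exact union_subset (union_subset subset_union_left
        (h.select_subset.trans subset_union_right)) (sdiff_subset.trans subset_union_right)
    · rw [Finset.disjoint_left]
      intro x hx hxD
      have := h4 hx
      rw [mem_union, mem_union, mem_sdiff, mem_union] at this
      rcases this with (hxS | hxP) | hxV
      · exact hI.notMem_selected x (by simpa using h.discard_subset hxD) (by simpa using hxS)
      · exact Finset.disjoint_left.1 h.disjoint hxP hxD
      · exact hxV.2 (Or.inr hxD)
  · rintro ⟨⟨h1, h2, h4⟩, h3, h5⟩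
    refine ⟨h1, ⟨h2, h3⟩, fun x hx => ?_⟩
    have h6 := h4 hx
    have h7 := Finset.disjoint_left.1 h5 hx
    rw [mem_union] at h6
    simp only [mem_union, mem_sdiff]
    tauto

lemma Inst.Valid.reaches_refl (hI : I.Valid F₀) : I.Reaches F₀ ∅ ∅ I where
  valid := hI
  selected := by simp
  vertices := by simp
  edges := restrict_empty.symm
  select_subset := empty_subset _
  discard_subset := empty_subset _
  disjoint := disjoint_empty_left _
  length_vertices := by simp
  length_selected := by simp
  length_edges := le_rfl

lemma family_select (E : List (List α)) (v : α) :
    family (E.filter fun e => !decide (v ∈ e)) = restrict (family E) {v} ∅ := by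
  ext s
  simp only [mem_family, mem_restrict, List.mem_filter, sdiff_empty, disjoint_singleton_right]
  constructor
  · rintro ⟨e, ⟨he, hv⟩, rfl⟩
    exact ⟨_, ⟨e, he, rfl⟩, by simpa using hv, rfl⟩
  · rintro ⟨_, ⟨e, he, rfl⟩, hv, rfl⟩
    exact ⟨e, ⟨he, by simpa using hv⟩, rfl⟩

lemma family_discard (E : List (List α)) (v : α) :
    family (E.map fun e => e.filter fun x => !decide (v = x)) = restrict (family E) ∅ {v} := by
  ext s
  simp only [mem_family, mem_restrict, List.mem_map, disjoint_empty_right, true_and,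
    sdiff_singleton_eq_erase]
  constructor
  · rintro ⟨_, ⟨e, he, rfl⟩, rfl⟩
    exact ⟨_, ⟨e, he, rfl⟩, (toFinset_filter_ne e v).symm⟩
  · rintro ⟨_, ⟨e, he, rfl⟩, rfl⟩
    exact ⟨_, ⟨e, he, rfl⟩, toFinset_filter_ne e v⟩

lemma length_filter_ne {l : List α} (hl : l.Nodup) (hv : v ∈ l) :
    (l.filter fun x => !decide (v = x)).length + 1 = l.length := by
  rw [← List.toFinset_card_of_nodup (hl.filter _), toFinset_filter_ne,
    card_erase_add_one (List.mem_toFinset.2 hv), List.toFinset_card_of_nodup hl]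

lemma Inst.Valid.select (hI : I.Valid F₀) (hv : v ∈ I.V) : (selectT v I).val.Valid F₀ := by
  rw [selectT_val]
  constructor
  · exact hI.nodup_vertices.filter _
  · exact List.nodup_cons.2 ⟨hI.notMem_selected v hv, hI.nodup_selected⟩
  · intro x hx
    simp only [List.mem_filter, Bool.not_eq_true', decide_eq_false_iff_not] at hx
    simp only [List.mem_cons, not_or]
    exact ⟨Ne.symm hx.2, hI.notMem_selected x hx.1⟩
  · exact fun e he => hI.nodup_edge e (List.mem_of_mem_filter he)
  · intro e he x hx
    simp only [List.mem_filter, Bool.not_eq_true', decide_eq_false_iff_not] at he ⊢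
    exact ⟨hI.subset_vertices e he.1 x hx, fun h => he.2 (h ▸ hx)⟩
  · exact fun e he => hI.length_le e (List.mem_of_mem_filter he)
  · exact hI.nodup_edges.sublist (List.filter_sublist.map _)
  · intro s hs
    rw [family_select, mem_restrict] at hs
    obtain ⟨s, hs, -, rfl⟩ := hs
    obtain ⟨e₀, he₀, h⟩ := hI.exists_original s hs
    refine ⟨e₀, he₀, fun x hx hxI => ?_⟩
    rw [sdiff_empty]
    refine h x hx ?_
    simp only [List.mem_filter, List.mem_cons] at hxI
    rcases hxI with (rfl | h) | h
    exacts [Or.inr hv, Or.inl h, Or.inr h.1]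
  · intro e₀ he₀
    rcases hI.exists_remaining e₀ he₀ with ⟨x, hx, hxS⟩ | ⟨s, hs, hse⟩
    · exact Or.inl ⟨x, hx, List.mem_cons_of_mem _ hxS⟩
    · by_cases hvs : v ∈ s
      · exact Or.inl ⟨v, hse hvs, List.mem_cons_self⟩
      · refine Or.inr ⟨s, ?_, hse⟩
        rw [family_select, mem_restrict]
        exact ⟨s, hs, by simpa using hvs, sdiff_empty⟩

lemma Inst.Valid.discard (hI : I.Valid F₀) (hv : v ∈ I.V) : (discardT v I).val.Valid F₀ := by
  rw [discardT_val]
  have hsub := dedupT_sublist (I.E.map fun e => e.filter fun x => !decide (v = x))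
  constructor
  · exact hI.nodup_vertices.filter _
  · exact hI.nodup_selected
  · exact fun x hx => hI.notMem_selected x (List.mem_of_mem_filter hx)
  · intro e he
    obtain ⟨f, hf, rfl⟩ := List.mem_map.1 (hsub.subset he)
    exact (hI.nodup_edge f hf).filter _
  · intro e he x hx
    obtain ⟨f, hf, rfl⟩ := List.mem_map.1 (hsub.subset he)
    rw [List.mem_filter] at hx ⊢
    exact ⟨hI.subset_vertices f hf x hx.1, hx.2⟩
  · intro e he
    obtain ⟨f, hf, rfl⟩ := List.mem_map.1 (hsub.subset he)
    exact (List.length_filter_le _ _).trans (hI.length_le f hf)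
  · exact nodup_dedupT _
  · intro s hs
    rw [family_dedupT, family_discard, mem_restrict] at hs
    obtain ⟨s, hs, -, rfl⟩ := hs
    obtain ⟨e₀, he₀, h⟩ := hI.exists_original s hs
    refine ⟨e₀, he₀, fun x hx hxI => ?_⟩
    rw [mem_sdiff, mem_singleton]
    simp only [List.mem_filter, Bool.not_eq_true', decide_eq_false_iff_not] at hxI
    rcases hxI with hxI | hxI
    · exact ⟨h x hx (Or.inl hxI), fun hxv => hI.notMem_selected v hv (hxv ▸ hxI)⟩
    · exact ⟨h x hx (Or.inr hxI.1), fun hxv => hxI.2 hxv.symm⟩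
  · intro e₀ he₀
    rcases hI.exists_remaining e₀ he₀ with h | ⟨s, hs, hse⟩
    · exact Or.inl h
    · refine Or.inr ⟨s \ {v}, ?_, sdiff_subset.trans hse⟩
      rw [family_dedupT, family_discard, mem_restrict]
      exact ⟨s, hs, by simp, rfl⟩

lemma Inst.Reaches.mem_vertices (h : I.Reaches F₀ P D J) {x : α} :
    x ∈ J.V ↔ x ∈ I.V ∧ x ∉ P ∪ D := by
  rw [← List.mem_toFinset, h.vertices, mem_sdiff, List.mem_toFinset]

lemma Inst.Reaches.select (h : I.Reaches F₀ P D J) (hv : v ∈ I.V) (hP : v ∉ P) (hD : v ∉ D) :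
    I.Reaches F₀ (insert v P) D (selectT v J).val := by
  have hvJ : v ∈ J.V := h.mem_vertices.2 ⟨hv, by simp [hP, hD]⟩
  have hval := h.valid.select hvJ
  rw [selectT_val] at hval ⊢
  constructor
  · exact hval
  · rw [List.toFinset_cons, h.selected, union_insert]
  · rw [toFinset_filter_ne, h.vertices]
    ext x
    simp only [mem_erase, mem_sdiff, mem_union, mem_insert]
    tauto
  · rw [family_select, h.edges, restrict_restrict (by simpa using hD), union_empty, union_comm,
      ← insert_eq]
  · exact insert_subset (List.mem_toFinset.2 hv) h.select_subset
  · exact h.discard_subset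
  · exact disjoint_insert_left.2 ⟨hD, h.disjoint⟩
  · have h1 := length_filter_ne h.valid.nodup_vertices hvJ
    have h2 := h.length_vertices
    rw [card_insert_of_notMem hP]
    simp only
    omega
  · have := h.length_selected
    rw [card_insert_of_notMem hP, List.length_cons]
    omega
  · exact (List.length_filter_le _ _).trans h.length_edges

lemma Inst.Reaches.discard (h : I.Reaches F₀ P D J) (hv : v ∈ I.V) (hP : v ∉ P) (hD : v ∉ D) :
    I.Reaches F₀ P (insert v D) (discardT v J).val := by
  have hvJ : v ∈ J.V := h.mem_vertices.2 ⟨hv, by simp [hP, hD]⟩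
  have hval := h.valid.discard hvJ
  rw [discardT_val] at hval ⊢
  constructor
  · exact hval
  · exact h.selected
  · rw [toFinset_filter_ne, h.vertices]
    ext x
    simp only [mem_erase, mem_sdiff, mem_union, mem_insert]
    tauto
  · rw [family_dedupT, family_discard, h.edges, restrict_restrict (disjoint_empty_right _),
      union_empty, union_comm D, ← insert_eq]
  · exact h.select_subset
  · exact insert_subset (List.mem_toFinset.2 hv) h.discard_subset
  · exact disjoint_insert_right.2 ⟨hP, h.disjoint⟩
  · have h1 := length_filter_ne h.valid.nodup_vertices hvJ
    have h2 := h.length_vertices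
    rw [card_insert_of_notMem hD]
    simp only
    omega
  · exact h.length_selected
  · refine (dedupT_sublist _).length_le.trans ?_
    rw [List.length_map]
    exact h.length_edges

lemma Inst.Reaches.selectAll (h : I.Reaches F₀ P D J) (l : List α) (hl : l.Nodup)
    (hV : ∀ v ∈ l, v ∈ I.V ∧ v ∉ P ∧ v ∉ D) :
    I.Reaches F₀ (l.toFinset ∪ P) D (selectAllT l J).val := by
  induction l generalizing P J with
  | nil => simpa [selectAllT] using h
  | cons v l ih =>
    rw [List.nodup_cons] at hl
    obtain ⟨hv, hvP, hvD⟩ := hV v List.mem_cons_self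
    have := ih (h.select hv hvP hvD) hl.2 fun u hu => by
      obtain ⟨h1, h2, h3⟩ := hV u (List.mem_cons_of_mem _ hu)
      refine ⟨h1, ?_, h3⟩
      rw [mem_insert, not_or]
      exact ⟨fun huv => hl.1 (huv ▸ hu), h2⟩
    rw [List.toFinset_cons, insert_union, ← union_insert]
    exact this

lemma Inst.Reaches.discardAll (h : I.Reaches F₀ P D J) (l : List α) (hl : l.Nodup)
    (hV : ∀ v ∈ l, v ∈ I.V ∧ v ∉ P ∧ v ∉ D) :
    I.Reaches F₀ P (l.toFinset ∪ D) (discardAllT l J).val := by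
  induction l generalizing D J with
  | nil => simpa [discardAllT] using h
  | cons v l ih =>
    rw [List.nodup_cons] at hl
    obtain ⟨hv, hvP, hvD⟩ := hV v List.mem_cons_self
    have := ih (h.discard hv hvP hvD) hl.2 fun u hu => by
      obtain ⟨h1, h2, h3⟩ := hV u (List.mem_cons_of_mem _ hu)
      refine ⟨h1, h2, ?_⟩
      rw [mem_insert, not_or]
      exact ⟨fun huv => hl.1 (huv ▸ hu), h3⟩
    rw [List.toFinset_cons, insert_union, ← union_insert]
    exact this

/-- No set is listed twice, so counting lists is counting sets; degrees computed by the algorithm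
are those of the family. -/
lemma Inst.Valid.card_filter_family (hI : I.Valid F₀) (p : Finset α → Prop) [DecidablePred p] :
    #{s ∈ family I.E | p s} = I.E.countP fun e => decide (p e.toFinset) := by
  have h : {s ∈ family I.E | p s} =
      ((I.E.map List.toFinset).filter fun s => decide (p s)).toFinset := by
    ext s
    simp [family]
  rw [h, List.toFinset_card_of_nodup (hI.nodup_edges.filter _), List.countP_eq_length_filter,
    List.filter_map, List.length_map]
  rfl

lemma Inst.Valid.degree_eq (hI : I.Valid F₀) (v : α) :
    (degreeT I.E v).val = degree (family I.E) v := by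
  rw [degreeT_val, degree, hI.card_filter_family]
  simp

lemma Inst.Valid.card_eq (hI : I.Valid F₀) {e : List α} (he : e ∈ I.E) :
    #e.toFinset = e.length := List.toFinset_card_of_nodup (hI.nodup_edge e he)

lemma Inst.Valid.degreeTwo_eq (hI : I.Valid F₀) (v : α) :
    (degreeTwoT I.E v).val = degree (pairs (family I.E)) v := by
  rw [degreeTwoT, countT_val, degree, pairs, filter_filter, hI.card_filter_family]
  exact List.countP_congr fun e he => by simp [hI.card_eq he]

end Instances

/-! ### Correctness of the reduction rules and of branching at degree 1 -/

section Rules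

open Finset

variable {α : Type} [DecidableEq α] {F₀ : Finset (Finset α)} {I J : Inst α} {P D : Finset α}
  {v : α}

/-- The instances `Js` partition the solutions of `I`, are smaller, and do not have a larger total
measure. -/
structure IsGoodBranch (F₀ : Finset (Finset α)) (I : Inst α) (Js : List (Inst α)) : Prop where
  valid : ∀ J ∈ Js, J.Valid F₀
  size_lt : ∀ J ∈ Js, J.V.length + J.E.length < I.V.length + I.E.length
  vertices_le : ∀ J ∈ Js, J.V.length ≤ I.V.length
  edges_le : ∀ J ∈ Js, J.E.length ≤ I.E.length
  selected_le : ∀ J ∈ Js, J.S.length + J.V.length ≤ I.S.length + I.V.length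
  length_le : Js.length ≤ 3
  solution : ∀ T, I.IsSolution F₀ T ↔ ∃ J ∈ Js, J.IsSolution F₀ T
  disjoint : Js.Pairwise fun J J' => ∀ T, J.IsSolution F₀ T → ¬J'.IsSolution F₀ T
  weight : (Js.map fun J => weight (family J.E)).sum ≤ TransversalEnum.weight (family I.E)

/-- The outcome of a rule is correct for the instance `I`. -/
def Outcome.IsGood (F₀ : Finset (Finset α)) (I : Inst α) : Outcome α → Prop
  | .halt out => out.length ≤ 1 ∧ (∀ l ∈ out, l.Nodup) ∧
      ∀ T, T ∈ out.map List.toFinset ↔ I.IsSolution F₀ T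
  | .branch Js => IsGoodBranch F₀ I Js

/-- For rules that only select and discard, three things remain to be checked: every solution fits
some branch, any two branches disagree on a vertex, and the weight inequality. -/
lemma isGoodBranch_of_reaches (hI : I.Valid F₀) (L : List (Finset α × Finset α × Inst α))
    (hlen : L.length ≤ 3)
    (hR : ∀ t ∈ L, I.Reaches F₀ t.1 t.2.1 t.2.2 ∧ 0 < #t.1 + #t.2.1)
    (hsol : ∀ T, I.IsSolution F₀ T → ∃ t ∈ L, t.1 ⊆ T ∧ Disjoint T t.2.1)
    (hdisj : L.Pairwise fun t t' => ¬Disjoint t.1 t'.2.1 ∨ ¬Disjoint t.2.1 t'.1)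
    (hw : (L.map fun t => weight (restrict (family I.E) t.1 t.2.1)).sum ≤ weight (family I.E)) :
    IsGoodBranch F₀ I (L.map fun t => t.2.2) := by
  constructor
  · simp only [List.mem_map, forall_exists_index, and_imp, forall_apply_eq_imp_iff₂]
    exact fun t ht => (hR t ht).1.valid
  · simp only [List.mem_map, forall_exists_index, and_imp, forall_apply_eq_imp_iff₂]
    intro t ht
    have := (hR t ht).1.length_vertices
    have := (hR t ht).1.length_edges
    have := (hR t ht).2
    omega
  · simp only [List.mem_map, forall_exists_index, and_imp, forall_apply_eq_imp_iff₂]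
    intro t ht
    have := (hR t ht).1.length_vertices
    omega
  · simp only [List.mem_map, forall_exists_index, and_imp, forall_apply_eq_imp_iff₂]
    exact fun t ht => (hR t ht).1.length_edges
  · simp only [List.mem_map, forall_exists_index, and_imp, forall_apply_eq_imp_iff₂]
    intro t ht
    have := (hR t ht).1.length_vertices
    have := (hR t ht).1.length_selected
    omega
  · rwa [List.length_map]
  · intro T
    simp only [List.mem_map, exists_exists_and_eq_and]
    constructor
    · intro hT
      obtain ⟨t, ht, h1, h2⟩ := hsol T hT
      exact ⟨t, ht, ((hR t ht).1.isSolution_iff hI T).2 ⟨hT, h1, h2⟩⟩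
    · rintro ⟨t, ht, hT⟩
      exact (((hR t ht).1.isSolution_iff hI T).1 hT).1
  · rw [List.pairwise_map]
    refine hdisj.imp_of_mem fun {t t'} ht ht' h T hT hT' => ?_
    have h1 := ((hR t ht).1.isSolution_iff hI T).1 hT
    have h2 := ((hR t' ht').1.isSolution_iff hI T).1 hT'
    rcases h with h | h
    · exact h (h2.2.2.mono_left h1.2.1)
    · exact h (h1.2.2.symm.mono_right h2.2.1)
  · rw [List.map_map]
    refine le_trans (le_of_eq ?_) hw
    congr 1
    exact List.map_congr_left fun t ht => by simp [(hR t ht).1.edges]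

lemma Inst.Valid.exists_private_edge (hI : I.Valid F₀) {T : Finset α} (hT : I.IsSolution F₀ T)
    (hv : v ∈ I.V) (hvT : v ∈ T) :
    ∃ s ∈ family I.E, v ∈ s ∧ ∀ y ∈ s, y ∈ T → y = v := by
  obtain ⟨s, hs, h⟩ := hI.exists_private hT hvT (hI.notMem_selected v hv)
  have hy : ∀ y, y ∈ s ∩ T ↔ y = v := fun y => by rw [h, mem_singleton]
  exact ⟨s, hs, (mem_inter.1 ((hy v).2 rfl)).1, fun y hys hyT => (hy y).1 (mem_inter.2 ⟨hys, hyT⟩)⟩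

lemma isGood_halt_of_empty_mem (hI : I.Valid F₀) (h : ∅ ∈ family I.E) :
    (Outcome.halt []).IsGood F₀ I := by
  refine ⟨by simp, by simp, fun T => iff_of_false (by simp) fun hT => ?_⟩
  simpa using hI.inter_nonempty hT h

/-- An unselected element of `T` would need a private hyperedge among those remaining, and there are
none. -/
lemma isSolution_of_edges_eq_nil (hI : I.Valid F₀) (h : I.E = []) (T : Finset α) :
    I.IsSolution F₀ T ↔ T = I.S.toFinset ∧ IsMinimalHittingSet F₀ I.S.toFinset := by
  constructor
  · intro hT
    have : T = I.S.toFinset := by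
      refine Finset.Subset.antisymm (fun x hx => ?_) hT.2.1
      by_contra hxS
      obtain ⟨s, hs, -⟩ := hI.exists_private hT hx (by simpa using hxS)
      simp [h, family] at hs
    exact ⟨this, this ▸ hT.1⟩
  · rintro ⟨rfl, h⟩
    exact ⟨h, Finset.Subset.refl _, subset_union_left⟩

/-- A vertex in no current hyperedge has no private one, so no solution contains it; discarding it
leaves the family as it is. -/
lemma isGoodBranch_degree_zero (hI : I.Valid F₀) (hv : v ∈ I.V)
    (hd : degree (family I.E) v = 0) : IsGoodBranch F₀ I [(discardT v I).val] := by
  have hve : ∀ s ∈ family I.E, v ∉ s := fun s hs hvs => by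
    have := degree_pos_of_mem hs hvs
    omega
  refine isGoodBranch_of_reaches hI [(∅, {v}, (discardT v I).val)] (by simp) ?_ ?_ (by simp) ?_
  · simpa using hI.reaches_refl.discard hv (notMem_empty v) (notMem_empty v)
  · intro T hT
    simp only [List.mem_singleton, exists_eq_left, empty_subset, true_and,
      disjoint_singleton_right]
    intro hvT
    obtain ⟨s, hs, hvs, -⟩ := hI.exists_private_edge hT hv hvT
    exact hve s hs hvs
  · have : restrict (family I.E) ∅ {v} = family I.E := by
      ext s
      rw [mem_restrict]
      constructor
      · rintro ⟨s, hs, -, rfl⟩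
        rwa [sdiff_singleton_eq_erase, erase_eq_of_notMem (hve s hs)]
      · exact fun hs => ⟨s, hs, by simp, by
          rw [sdiff_singleton_eq_erase, erase_eq_of_notMem (hve s hs)]⟩
    simp [this]

/-- Neither `V` nor `S` changes, so the solutions are literally the same. Wherever the removed set
served in the invariants, `e` takes its place. -/
lemma isGoodBranch_superset (hI : I.Valid F₀) {e f : List α} (he : e ∈ I.E) (hf : f ∈ I.E)
    (hef : e.toFinset ⊂ f.toFinset) :
    IsGoodBranch F₀ I [⟨I.V, I.E.filter fun e => !decide (e.toFinset = f.toFinset), I.S⟩] := by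
  have hfam : family (I.E.filter fun e => !decide (e.toFinset = f.toFinset)) =
      (family I.E).erase f.toFinset := by
    ext s
    simp only [mem_family, List.mem_filter, mem_erase, Bool.not_eq_true', decide_eq_false_iff_not]
    constructor
    · rintro ⟨g, ⟨hg, hgf⟩, rfl⟩
      exact ⟨hgf, g, hg, rfl⟩
    · rintro ⟨hgf, g, hg, rfl⟩
      exact ⟨g, ⟨hg, hgf⟩, rfl⟩
  have hlen : (I.E.filter fun e => !decide (e.toFinset = f.toFinset)).length < I.E.length :=
    List.length_filter_lt_length_iff_exists.2 ⟨f, hf, by simp⟩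
  constructor <;> simp only [List.mem_singleton, forall_eq, exists_eq_left, List.length_singleton,
    List.pairwise_singleton, List.map_singleton, List.sum_singleton]
  · constructor
    · exact hI.nodup_vertices
    · exact hI.nodup_selected
    · exact hI.notMem_selected
    · exact fun e he => hI.nodup_edge e (List.mem_of_mem_filter he)
    · exact fun e he => hI.subset_vertices e (List.mem_of_mem_filter he)
    · exact fun e he => hI.length_le e (List.mem_of_mem_filter he)
    · exact hI.nodup_edges.sublist (List.filter_sublist.map _)
    · intro s hs
      simp only [hfam] at hs
      exact hI.exists_original s (mem_of_mem_erase hs)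
    · intro e₀ he₀
      refine (hI.exists_remaining e₀ he₀).imp_right ?_
      rintro ⟨s, hs, hse⟩
      simp only [hfam]
      by_cases hsf : s = f.toFinset
      · subst hsf
        exact ⟨e.toFinset, mem_erase.2 ⟨hef.ne, mem_family.2 ⟨e, he, rfl⟩⟩, hef.subset.trans hse⟩
      · exact ⟨s, mem_erase.2 ⟨hsf, hs⟩, hse⟩
  · omega
  · exact le_rfl
  · exact hlen.le
  · exact le_rfl
  · norm_num
  · exact fun T => Iff.rfl
  · rw [hfam, weight_eq_of_core_eq (core_erase (mem_family.2 ⟨e, he, rfl⟩) hef)]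

lemma isGoodBranch_singleton (hI : I.Valid F₀) {e : List α} (he : e ∈ I.E) (hc : e.length = 1) :
    IsGoodBranch F₀ I [(selectAllT e I).val] := by
  obtain ⟨v, rfl⟩ := List.length_eq_one_iff.1 hc
  have hv : v ∈ I.V := hI.subset_vertices _ he v (by simp)
  have hvF : {v} ∈ family I.E := mem_family.2 ⟨[v], he, by simp⟩
  refine isGoodBranch_of_reaches hI [({v}, ∅, (selectAllT [v] I).val)] (by simp) ?_ ?_ (by simp) ?_
  · simpa using hI.reaches_refl.selectAll [v] (by simp) (by simpa using hv)
  · intro T hT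
    simp only [List.mem_singleton, exists_eq_left, disjoint_empty_right, and_true,
      singleton_subset_iff]
    obtain ⟨x, hx⟩ := hI.inter_nonempty hT hvF
    rw [mem_inter, mem_singleton] at hx
    exact hx.1 ▸ hx.2
  · simp [weight_eq_of_core_eq (core_restrict_of_singletons
      (F := family I.E) (P := {v}) (by simpa using hvF))]

lemma Inst.Valid.card_le (hI : I.Valid F₀) : ∀ s ∈ family I.E, #s ≤ 3 := by
  intro s hs
  obtain ⟨e, he, rfl⟩ := mem_family.1 hs
  exact (List.toFinset_card_le e).trans (hI.length_le e he)

lemma Inst.Valid.mem_vertices (hI : I.Valid F₀) {s : Finset α} (hs : s ∈ family I.E) {x : α}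
    (hx : x ∈ s) : x ∈ I.V := by
  obtain ⟨e, he, rfl⟩ := mem_family.1 hs
  exact hI.subset_vertices e he x (List.mem_toFinset.1 hx)

lemma isGood_branchDegreeOne (hI : I.Valid F₀) (hC : IsClutter (family I.E)) (hv : v ∈ I.V)
    (hd : degree (family I.E) v = 1) {e : List α} (he : e ∈ I.E) (hve : v ∈ e) :
    (branchDegreeOne I v e).val.IsGood F₀ I := by
  have heF : e.toFinset ∈ family I.E := mem_family.2 ⟨e, he, rfl⟩
  have her := toFinset_filter_ne e v
  have hlen := length_filter_ne (hI.nodup_edge e he) hve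
  have hnd := (hI.nodup_edge e he).filter fun x => !decide (v = x)
  have hc2 := (hC _ heF).1
  rw [hI.card_eq he] at hc2
  have hc3 := hI.length_le e he
  -- A vertex of degree 1 that is in `T` can only have `e` as private hyperedge, so `T` avoids the
  -- rest of `e`.
  have hpriv : ∀ {x T}, x ∈ I.V → x ∈ e → degree (family I.E) x = 1 → I.IsSolution F₀ T → x ∈ T →
      ∀ y ∈ e, y ∈ T → y = x := by
    intro x T hx hxe hdx hT hxT y hy hyT
    obtain ⟨s, hs, hvs, h⟩ := hI.exists_private_edge hT hx hxT
    have := eq_of_degree_eq_one hdx hs hvs heF (List.mem_toFinset.2 hxe)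
    exact h y (this ▸ List.mem_toFinset.2 hy) hyT
  have hsub : ∀ x ∈ e.filter fun x => !decide (v = x), x ∈ e ∧ x ∈ I.V ∧ x ≠ v := by
    intro x hx
    simp only [List.mem_filter, Bool.not_eq_true', decide_eq_false_iff_not] at hx
    exact ⟨hx.1, hI.subset_vertices e he x hx.1, Ne.symm hx.2⟩
  have hcons : e.toFinset = insert v (e.filter fun x => !decide (v = x)).toFinset := by
    rw [her, insert_erase (List.mem_toFinset.2 hve)]
  simp only [branchDegreeOne, val_bind, filterT_val, neT_val]
  rcases hr : e.filter fun x => !decide (v = x) with _ | ⟨u, _ | ⟨w, _ | ⟨y, l⟩⟩⟩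
  · rw [hr] at hlen
    simp at hlen
    omega
  · rw [hr] at hsub hcons her
    obtain ⟨hue, huV, huv⟩ := hsub u (by simp)
    simp only [val_bind, val_pure]
    refine isGoodBranch_of_reaches hI [({v}, {u}, _), (∅, {v}, _)] (by simp) ?_ ?_ (by simp) ?_
    · simp only [List.mem_cons, List.not_mem_nil, or_false, forall_eq_or_imp, forall_eq]
      refine ⟨⟨?_, by simp⟩, ?_, by simp⟩
      · exact (hI.reaches_refl.select hv (notMem_empty v) (notMem_empty v)).discard huV
          (by simpa using huv) (notMem_empty u)
      · exact hI.reaches_refl.discard hv (notMem_empty v) (notMem_empty v)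
    · intro T hT
      simp only [List.mem_cons, List.not_mem_nil, or_false, exists_eq_or_imp, exists_eq_left,
        singleton_subset_iff, disjoint_singleton_right, empty_subset, true_and]
      by_cases hvT : v ∈ T
      · exact Or.inl ⟨hvT, fun huT => huv (hpriv hv hve hd hT hvT u hue huT)⟩
      · exact Or.inr hvT
    · simp only [List.map_cons, List.map_nil, List.sum_cons, List.sum_nil, add_zero]
      refine weight_branch_degree_one_pair hC hI.card_le hd huv ?_
      have h : e.toFinset = {v, u} := by simpa using hcons
      exact h ▸ heF
  · rw [hr] at hsub hcons her hnd
    obtain ⟨hue, huV, huv⟩ := hsub u (by simp)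
    obtain ⟨hwe, hwV, hwv⟩ := hsub w (by simp)
    have huw : u ≠ w := by simpa using hnd
    have h : e.toFinset = {v, u, w} := by simpa using hcons
    have hcard : #e.toFinset = 3 := by
      rw [h, card_eq_three]
      exact ⟨v, u, w, huv.symm, hwv.symm, huw, rfl⟩
    have hlist : ∀ x y : α, ([x, y] : List α).toFinset ∪ ∅ = {x, y} := by simp
    simp only [val_bind, val_ite, hI.degree_eq]
    have hR : ∀ {a b c : α}, a ∈ I.V → b ∈ I.V → c ∈ I.V → b ≠ a → c ≠ a → b ≠ c →
        I.Reaches F₀ {a} {b, c} (discardAllT [b, c] (selectT a I).val).val := by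
      intro a b c ha hb hc hba hca hbc
      have := (hI.reaches_refl.select ha (notMem_empty a) (notMem_empty a)).discardAll [b, c]
        (by simpa using hbc) (by simp [hb, hc, hba, hca])
      rwa [hlist] at this
    split_ifs with h1
    · simp only [val_pure]
      have hdall : ∀ x ∈ e.toFinset, degree (family I.E) x = 1 := by
        rw [h]
        simp [hd, h1]
      refine isGoodBranch_of_reaches hI [({v}, {u, w}, _), ({u}, {v, w}, _), ({w}, {v, u}, _)]
        (by simp) ?_ ?_ (by simp) ?_
      · simp only [List.mem_cons, List.not_mem_nil, or_false, forall_eq_or_imp, forall_eq]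
        exact ⟨⟨hR hv huV hwV huv hwv huw, by simp⟩, ⟨hR huV hv hwV huv.symm huw.symm hwv.symm, by simp⟩,
          hR hwV hv huV hwv.symm huw huv.symm, by simp⟩
      · intro T hT
        simp only [List.mem_cons, List.not_mem_nil, or_false, exists_eq_or_imp, exists_eq_left,
          singleton_subset_iff, disjoint_insert_right, disjoint_singleton_right]
        obtain ⟨x, hx⟩ := hI.inter_nonempty hT heF
        obtain ⟨hxe, hxT⟩ := mem_inter.1 hx
        have hp := hpriv (hI.mem_vertices heF hxe) (List.mem_toFinset.1 hxe) (hdall x hxe) hT hxT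
        have hpv := hp v hve
        have hpu := hp u hue
        have hpw := hp w hwe
        rw [h, mem_insert, mem_insert, mem_singleton] at hxe
        rcases hxe with rfl | rfl | rfl
        · exact Or.inl ⟨hxT, fun h => huv (hpu h), fun h => hwv (hpw h)⟩
        · exact Or.inr (Or.inl ⟨hxT, fun h => huv (hpv h).symm, fun h => huw (hpw h).symm⟩)
        · exact Or.inr (Or.inr ⟨hxT, fun h => hwv (hpv h).symm, fun h => huw (hpu h)⟩)
      · simp only [List.map_cons, List.map_nil, List.sum_cons, List.sum_nil, add_zero]
        have hw := fun x hx => weight_branch_isolated hC heF hcard hdall (x := x) hx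
        have hev : e.toFinset.erase v = {u, w} := by
          rw [h, erase_insert (by simp [huv.symm, hwv.symm])]
        have heu : e.toFinset.erase u = {v, w} := by
          rw [h, Finset.insert_comm, erase_insert (by simp [huv, huw])]
        have hew : e.toFinset.erase w = {v, u} := by
          rw [h, pair_comm u w, Finset.insert_comm, erase_insert (by simp [hwv, huw.symm])]
        have h1 := hw v (by simpa using hve)
        have h2 := hw u (by simpa using hue)
        have h3 := hw w (by simpa using hwe)
        rw [hev] at h1
        rw [heu] at h2
        rw [hew] at h3
        linarith
    · simp only [val_pure]
      refine isGoodBranch_of_reaches hI [({v}, {u, w}, _), (∅, {v}, _)] (by simp) ?_ ?_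
        (by simp) ?_
      · simp only [List.mem_cons, List.not_mem_nil, or_false, forall_eq_or_imp, forall_eq]
        exact ⟨⟨hR hv huV hwV huv hwv huw, by simp⟩,
          hI.reaches_refl.discard hv (notMem_empty v) (notMem_empty v), by simp⟩
      · intro T hT
        simp only [List.mem_cons, List.not_mem_nil, or_false, exists_eq_or_imp, exists_eq_left,
          singleton_subset_iff, disjoint_insert_right, disjoint_singleton_right, empty_subset,
          true_and]
        by_cases hvT : v ∈ T
        · exact Or.inl ⟨hvT, fun huT => huv (hpriv hv hve hd hT hvT u hue huT),
            fun hwT => hwv (hpriv hv hve hd hT hvT w hwe hwT)⟩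
        · exact Or.inr hvT
      · simp only [List.map_cons, List.map_nil, List.sum_cons, List.sum_nil, add_zero]
        have hev : e.toFinset.erase v = {u, w} := by
          rw [h, erase_insert (by simp [huv.symm, hwv.symm])]
        rw [← hev]
        have hpu := degree_pos_of_mem heF (List.mem_toFinset.2 hue)
        have hpw := degree_pos_of_mem heF (List.mem_toFinset.2 hwe)
        -- Not both of `u` and `w` have degree 1; one of degree at least 2 is needed for the
        -- estimate.
        by_cases hdu : degree (family I.E) u = 1
        · exact weight_branch_degree_one_triple hC hI.card_le hd heF (List.mem_toFinset.2 hve) hcard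
            (List.mem_toFinset.2 hwe) (by omega)
        · exact weight_branch_degree_one_triple hC hI.card_le hd heF (List.mem_toFinset.2 hve) hcard
            (List.mem_toFinset.2 hue) (by omega)
  · rw [hr] at hlen
    simp at hlen
    omega

end Rules

/-! ### Correctness of branching at pairs and triples, and of the choice of rule -/

section Rules

open Finset

variable {α : Type} [DecidableEq α] {F₀ : Finset (Finset α)} {I J : Inst α} {P D : Finset α}
  {v : α}

lemma Inst.Valid.isPairPartnerT_val (hI : I.Valid F₀) (v u : α) :
    (isPairPartnerT I.E v u).val = decide (u ∈ partners (family I.E) v) := by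
  rw [Bool.eq_iff_iff, decide_eq_true_iff, mem_partners]
  simp only [isPairPartnerT, val_bind, val_ite, neT_val, anyT_val, isPairAtT_val, memT_val,
    val_pure]
  by_cases huv : u = v
  · simp [huv]
  · simp only [Ne.symm huv, decide_false, Bool.not_false, if_true, List.any_eq_true, mem_family,
      ne_eq, huv, not_false_eq_true, true_and]
    refine exists_congr fun e => and_congr_right fun he => ?_
    simp only [decide_eq_true_eq, Bool.if_false_right, Bool.and_eq_true]
    rw [← hI.card_eq he]
    constructor
    · rintro ⟨⟨hc, hv⟩, hu⟩
      refine (eq_of_subset_of_card_le ?_ ?_).symm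
      · simp [insert_subset_iff, hv, hu]
      · rw [hc, card_pair (Ne.symm huv)]
    · intro h
      refine ⟨⟨by rw [h, card_pair (Ne.symm huv)], ?_⟩, ?_⟩ <;> rw [← List.mem_toFinset, h] <;> simp

lemma Inst.Valid.degree_eq_zero (hI : I.Valid F₀) {x : α} (hx : x ∉ I.V) :
    degree (family I.E) x = 0 := by
  by_contra h
  obtain ⟨s, hs, hxs⟩ := degree_pos_iff.1 (Nat.pos_of_ne_zero h)
  exact hx (hI.mem_vertices hs hxs)

lemma isGood_branchPair (hI : I.Valid F₀) (hC : IsClutter (family I.E))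
    (hd : ∀ x ∈ I.V, 2 ≤ degree (family I.E) x) (h2 : ∃ e ∈ I.E, e.length = 2) :
    (branchPair I).val.IsGood F₀ I := by
  obtain ⟨e, he, hc⟩ := h2
  obtain ⟨y, hy⟩ := List.exists_mem_of_length_pos (show 0 < e.length by omega)
  have hyV := hI.subset_vertices e he y hy
  have hdy : 0 < degree (pairs (family I.E)) y :=
    degree_pos_of_mem (mem_pairs.2 ⟨mem_family.2 ⟨e, he, rfl⟩, by rw [hI.card_eq he, hc]⟩)
      (List.mem_toFinset.2 hy)
  simp only [branchPair, val_bind]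
  rcases hm : (argmaxT (degreeTwoT I.E) I.V).val with _ | ⟨x, k⟩
  · rw [argmaxT_eq_none hm] at hyV
    simp at hyV
  · obtain ⟨hx, hk, hmax⟩ := argmaxT_eq_some hm
    simp only [val_bind, filterT_val, val_pure, hI.degreeTwo_eq] at hk hmax ⊢
    rcases hm' : (argmaxT (degreeT I.E) (I.V.filter fun x =>
      degree (pairs (family I.E)) x == k)).val with _ | ⟨v, k'⟩
    · have h := argmaxT_eq_none hm'
      rw [List.filter_eq_nil_iff] at h
      exact absurd hk.symm (by simpa using h x hx)
    · obtain ⟨hv, hk', hmax'⟩ := argmaxT_eq_some hm'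
      simp only [List.mem_filter, beq_iff_eq, hI.degree_eq, and_imp] at hv hk' hmax'
      obtain ⟨hv, hvk⟩ := hv
      simp only [val_bind, filterT_val, val_pure, hI.isPairPartnerT_val]
      have hU : (I.V.filter fun u => decide (u ∈ partners (family I.E) v)).toFinset =
          partners (family I.E) v := by
        ext u
        simp only [List.mem_toFinset, List.mem_filter, decide_eq_true_eq, and_iff_right_iff_imp]
        exact fun hu => hI.mem_vertices (mem_partners.1 hu).2 (by simp)
      have hR2 := (hI.reaches_refl.discard hv (notMem_empty v) (notMem_empty v)).selectAll
        (I.V.filter fun u => decide (u ∈ partners (family I.E) v))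
        (hI.nodup_vertices.filter _) (fun u hu => by
          simp only [List.mem_filter, decide_eq_true_eq] at hu
          exact ⟨hu.1, notMem_empty u, by simpa using (mem_partners.1 hu.2).1⟩)
      rw [hU, union_empty] at hR2
      refine isGoodBranch_of_reaches hI [({v}, ∅, _), (partners (family I.E) v, {v}, _)] (by simp)
        ?_ ?_ (by simp) ?_
      · simp only [List.mem_cons, List.not_mem_nil, or_false, forall_eq_or_imp, forall_eq]
        exact ⟨⟨hI.reaches_refl.select hv (notMem_empty v) (notMem_empty v), by simp⟩, hR2, by simp⟩
      · intro T hT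
        simp only [List.mem_cons, List.not_mem_nil, or_false, exists_eq_or_imp, exists_eq_left,
          singleton_subset_iff, disjoint_singleton_right, disjoint_empty_right, and_true]
        by_cases hvT : v ∈ T
        · exact Or.inl hvT
        · refine Or.inr ⟨fun u hu => ?_, hvT⟩
          obtain ⟨z, hz⟩ := hI.inter_nonempty hT (mem_partners.1 hu).2
          simp only [mem_inter, mem_insert, mem_singleton] at hz
          rcases hz with ⟨rfl | rfl, hz⟩
          exacts [absurd hz hvT, hz]
      · simp only [List.map_cons, List.map_nil, List.sum_cons, List.sum_nil, add_zero]
        -- The algorithm maximizes over `V` only, whereas the estimate wants all vertices of the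
        -- type; those outside have degree 0.
        have hz : ∀ x, x ∉ I.V → degree (pairs (family I.E)) x = 0 := fun x hx =>
          Nat.le_zero.1 ((degree_pairs_le _ x).trans (hI.degree_eq_zero hx).le)
        refine weight_branch_pair hC hI.card_le ?_ ?_ ?_ ?_
        · intro x hx
          by_cases hxV : x ∈ I.V
          · have := hd x hxV
            omega
          · have := hI.degree_eq_zero hxV
            omega
        · have := hmax y hyV
          omega
        · intro x
          by_cases hxV : x ∈ I.V
          · rw [hvk]
            exact hmax x hxV
          · rw [hz x hxV]
            exact Nat.zero_le _
        · intro x hxk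
          by_cases hxV : x ∈ I.V
          · rw [← hk']
            exact hmax' x hxV (hxk.trans hvk)
          · rw [hI.degree_eq_zero hxV]
            exact Nat.zero_le _

lemma isGood_branchTriple (hI : I.Valid F₀) (hC : IsClutter (family I.E))
    (hd : ∀ x ∈ I.V, 2 ≤ degree (family I.E) x) (h3 : ∀ e ∈ I.E, e.length = 3)
    (hE : I.E ≠ []) : (branchTriple I).val.IsGood F₀ I := by
  have h3' : ∀ s ∈ family I.E, #s = 3 := by
    intro s hs
    obtain ⟨e, he, rfl⟩ := mem_family.1 hs
    rw [hI.card_eq he, h3 e he]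
  simp only [branchTriple, val_bind]
  rcases hm : (argmaxT (degreeT I.E) I.V).val with _ | ⟨v, d⟩
  · obtain ⟨e, he⟩ := List.exists_mem_of_ne_nil _ hE
    have h := h3 e he
    obtain ⟨y, hy⟩ := List.exists_mem_of_length_pos (show 0 < e.length by omega)
    have hyV := hI.subset_vertices e he y hy
    rw [argmaxT_eq_none hm] at hyV
    simp at hyV
  · obtain ⟨hv, hdv, hmax⟩ := argmaxT_eq_some hm
    simp only [hI.degree_eq] at hdv hmax
    have hmax' : ∀ x, degree (family I.E) x ≤ degree (family I.E) v := by
      intro x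
      by_cases hxV : x ∈ I.V
      · rw [← hdv]
        exact hmax x hxV
      · rw [hI.degree_eq_zero hxV]
        exact Nat.zero_le _
    have hR := hI.reaches_refl
    have hRv := hR.select hv (notMem_empty v) (notMem_empty v)
    have hRv' := hR.discard hv (notMem_empty v) (notMem_empty v)
    simp only [val_bind, val_ite]
    split_ifs with hd3
    · simp only [val_pure]
      refine isGoodBranch_of_reaches hI [({v}, ∅, _), (∅, {v}, _)] (by simp) ?_ ?_ (by simp) ?_
      · simp only [List.mem_cons, List.not_mem_nil, or_false, forall_eq_or_imp, forall_eq]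
        exact ⟨⟨hRv, by simp⟩, hRv', by simp⟩
      · intro T hT
        simp only [List.mem_cons, List.not_mem_nil, or_false, exists_eq_or_imp, exists_eq_left,
          singleton_subset_iff, disjoint_singleton_right, disjoint_empty_right, and_true,
          empty_subset, true_and]
        exact em _
      · simp only [List.map_cons, List.map_nil, List.sum_cons, List.sum_nil, add_zero]
        exact weight_branch_degree_three hC h3' (by omega) hmax'
    · have hdv2 : degree (family I.E) v = 2 := by
        have := hd v hv
        omega
      have hboth : ∀ u, (countT (containsBothT v u) I.E).val =
          #{s ∈ family I.E | v ∈ s ∧ u ∈ s} := by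
        intro u
        rw [countT_val, hI.card_filter_family]
        simp
      -- As `v` has degree 2, a vertex sharing two hyperedges with it lies in all hyperedges through
      -- `v`.
      have htwin : ∀ u, #{s ∈ family I.E | v ∈ s ∧ u ∈ s} = 2 →
          ∀ s ∈ family I.E, v ∈ s → u ∈ s := by
        intro u hu s hs hvs
        have : {s ∈ family I.E | v ∈ s ∧ u ∈ s} = {s ∈ family I.E | v ∈ s} :=
          eq_of_subset_of_card_le (fun s => by simp only [mem_filter]; tauto)
            (by rw [hu]; exact hdv2.le)
        have hs' : s ∈ {s ∈ family I.E | v ∈ s} := mem_filter.2 ⟨hs, hvs⟩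
        rw [← this] at hs'
        exact (mem_filter.1 hs').2.2
      have hdeg2 : ∀ x ∈ I.V, degree (family I.E) x = 2 := fun x hx => by
        have := hd x hx
        have := hmax' x
        omega
      simp only [findT_val, val_bind, val_ite, neT_val, val_pure, hboth]
      rcases hu : I.V.find? fun u => if (!decide (v = u)) = true then
          #{s ∈ family I.E | v ∈ s ∧ u ∈ s} == 2 else false with _ | u
      · simp only [val_bind, filterT_val, mapT_val, memT_val, neT_val]
        have hlen : (I.E.filter fun e => decide (v ∈ e)).length = 2 := by
          rw [← List.countP_eq_length_filter, ← degreeT_val, hI.degree_eq, hdv2]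
        obtain ⟨f₁, f₂, hf⟩ := List.length_eq_two.1 hlen
        have hmem : ∀ f, f = f₁ ∨ f = f₂ ↔ f ∈ I.E ∧ v ∈ f := by
          intro f
          have : f ∈ I.E.filter (fun e => decide (v ∈ e)) ↔ f ∈ [f₁, f₂] := by rw [hf]
          simpa using this.symm
        obtain ⟨hf₁, hvf₁⟩ := (hmem f₁).1 (Or.inl rfl)
        obtain ⟨hf₂, hvf₂⟩ := (hmem f₂).1 (Or.inr rfl)
        have hl : ∀ f ∈ I.E, v ∈ f → (f.filter fun x => !decide (v = x)).length = 2 := by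
          intro f hf hvf
          have := length_filter_ne (hI.nodup_edge f hf) hvf
          have := h3 f hf
          omega
        obtain ⟨u₁, w₁, hf₁'⟩ := List.length_eq_two.1 (hl f₁ hf₁ hvf₁)
        obtain ⟨u₂, w₂, hf₂'⟩ := List.length_eq_two.1 (hl f₂ hf₂ hvf₂)
        have hsub : ∀ f ∈ I.E, ∀ x ∈ f.filter fun x => !decide (v = x), x ∈ f ∧ x ∈ I.V ∧ x ≠ v := by
          intro f hf x hx
          simp only [List.mem_filter, Bool.not_eq_true', decide_eq_false_iff_not] at hx
          exact ⟨hx.1, hI.subset_vertices f hf x hx.1, Ne.symm hx.2⟩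
        obtain ⟨hu₁, hu₁V, hu₁v⟩ := hsub f₁ hf₁ u₁ (by simp [hf₁'])
        obtain ⟨hu₂, hu₂V, hu₂v⟩ := hsub f₂ hf₂ u₂ (by simp [hf₂'])
        obtain ⟨hw₂, hw₂V, hw₂v⟩ := hsub f₂ hf₂ w₂ (by simp [hf₂'])
        have hu₂w₂ : u₂ ≠ w₂ := by
          have := (hI.nodup_edge f₂ hf₂).filter fun x => !decide (v = x)
          rw [hf₂'] at this
          simpa using this
        have hf₂s : f₂.toFinset = {v, u₂, w₂} := by
          have := toFinset_filter_ne f₂ v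
          rw [hf₂'] at this
          rw [← insert_erase (List.mem_toFinset.2 hvf₂), ← this]
          simp
        have hF : ∀ s ∈ family I.E, v ∈ s → s = f₁.toFinset ∨ s = f₂.toFinset := by
          intro s hs hvs
          obtain ⟨f, hf, rfl⟩ := mem_family.1 hs
          exact ((hmem f).2 ⟨hf, List.mem_toFinset.1 hvs⟩).imp (congrArg List.toFinset) (congrArg List.toFinset)
        -- Otherwise `u₁` would share both hyperedges with `v`, and the search for such a vertex
        -- would not have failed.
        have hu₁₂ : u₁ ∉ f₂ := by
          intro h
          have hall : ∀ s ∈ family I.E, v ∈ s → u₁ ∈ s := by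
            intro s hs hvs
            rcases hF s hs hvs with rfl | rfl <;> simpa
          have h2 : #{s ∈ family I.E | v ∈ s ∧ u₁ ∈ s} = 2 := by
            rw [← hdv2, degree]
            congr 1
            exact filter_congr fun s hs => and_iff_left_of_imp (hall s hs)
          have := List.find?_eq_none.1 hu u₁ hu₁V
          simp [h2, Ne.symm hu₁v] at this
        have hu₁u₂ : u₁ ≠ u₂ := fun h => hu₁₂ (h ▸ hu₂)
        have hu₁w₂ : u₁ ≠ w₂ := fun h => hu₁₂ (h ▸ hw₂)
        rw [hf, List.map_cons, List.map_cons, List.map_nil, hf₁', hf₂']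
        simp only [val_bind, val_pure]
        have hR1 := (hRv.select hu₁V (by simpa using hu₁v) (notMem_empty u₁)).discardAll [u₂, w₂]
          (by simpa using hu₂w₂) (by
            simp [hu₂V, hw₂V, hu₂v, hw₂v, hu₁u₂.symm, hu₁w₂.symm])
        have hR2 := hRv.discard hu₁V (by simpa using hu₁v) (notMem_empty u₁)
        refine isGoodBranch_of_reaches hI
          [({v, u₁}, {u₂, w₂}, _), ({v}, {u₁}, _), (∅, {v}, _)] (by simp) ?_ ?_ (by simp) ?_
        · simp only [List.mem_cons, List.not_mem_nil, or_false, forall_eq_or_imp, forall_eq]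
          refine ⟨⟨?_, by simp⟩, ⟨hR2, by simp⟩, hRv', by simp⟩
          simpa [pair_comm u₁ v] using hR1
        · intro T hT
          simp only [List.mem_cons, List.not_mem_nil, or_false, exists_eq_or_imp, exists_eq_left,
            singleton_subset_iff, disjoint_insert_right, disjoint_singleton_right, empty_subset,
            true_and, insert_subset_iff]
          by_cases hvT : v ∈ T
          · by_cases hu₁T : u₁ ∈ T
            -- With `u₁` in `T`, the first hyperedge is not private for `v`, so the second one is
            -- and `T` avoids its other vertices.
            · refine Or.inl ⟨⟨hvT, hu₁T⟩, ?_⟩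
              obtain ⟨s, hs, hvs, h⟩ := hI.exists_private_edge hT hv hvT
              rcases hF s hs hvs with rfl | rfl
              · exact absurd (h u₁ (by simpa using hu₁) hu₁T) hu₁v
              · exact ⟨fun hT => hu₂v (h u₂ (by simpa using hu₂) hT),
                  fun hT => hw₂v (h w₂ (by simpa using hw₂) hT)⟩
            · exact Or.inr (Or.inl ⟨hvT, hu₁T⟩)
          · exact Or.inr (Or.inr hvT)
        · simp only [List.map_cons, List.map_nil, List.sum_cons, List.sum_nil, add_zero]
          rw [← add_assoc]
          refine weight_branch_degree_two hC h3' (fun x hx => ?_) (mem_family.2 ⟨f₁, hf₁, rfl⟩)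
            (mem_family.2 ⟨f₂, hf₂, rfl⟩) (List.mem_toFinset.2 hvf₁) (List.mem_toFinset.2 hu₁) hu₁v
            hf₂s (by simpa using hu₁₂)
          obtain ⟨s, hs, hxs⟩ := mem_biUnion.1 hx
          exact hdeg2 x (hI.mem_vertices hs hxs)
      · have hu' := List.find?_some hu
        have huV := List.mem_of_find?_eq_some hu
        simp only [Bool.not_eq_true', decide_eq_false_iff_not, Bool.if_false_right,
          Bool.and_eq_true, decide_eq_true_eq, beq_iff_eq] at hu'
        obtain ⟨hvu, hu2⟩ := hu'
        simp only [val_bind, val_pure]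
        have hR1 := hRv.discard huV (by simpa using Ne.symm hvu) (notMem_empty u)
        refine isGoodBranch_of_reaches hI [({v}, {u}, _), (∅, {v}, _)] (by simp) ?_ ?_ (by simp) ?_
        · simp only [List.mem_cons, List.not_mem_nil, or_false, forall_eq_or_imp, forall_eq]
          exact ⟨⟨hR1, by simp⟩, hRv', by simp⟩
        · intro T hT
          simp only [List.mem_cons, List.not_mem_nil, or_false, exists_eq_or_imp, exists_eq_left,
            singleton_subset_iff, disjoint_singleton_right, empty_subset, true_and]
          by_cases hvT : v ∈ T
          · obtain ⟨s, hs, hvs, h⟩ := hI.exists_private_edge hT hv hvT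
            exact Or.inl ⟨hvT, fun huT => hvu (h u (htwin u hu2 s hs hvs) huT).symm⟩
          · exact Or.inr hvT
        · simp only [List.map_cons, List.map_nil, List.sum_cons, List.sum_nil, add_zero]
          exact weight_branch_twins hC h3' hdv2 (hdeg2 u huV) (Ne.symm hvu)

/-- The outcome of the first applicable rule is correct. -/
lemma isGood_applyRule {E₀ : List (List α)} (hI : I.Valid (family E₀)) :
    (applyRule E₀ I).val.IsGood (family E₀) I := by
  simp only [applyRule, val_bind, val_ite, anyT_val, hasSizeT_val, val_pure]
  split_ifs with h0 hE hmin
  · rw [List.any_eq_true] at h0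
    obtain ⟨e, he, hc⟩ := h0
    rw [beq_iff_eq, List.length_eq_zero_iff] at hc
    subst hc
    exact isGood_halt_of_empty_mem hI (mem_family.2 ⟨[], he, rfl⟩)
  · rw [List.isEmpty_iff] at hE
    rw [isMinimalT_val] at hmin
    refine ⟨by simp, by simpa using hI.nodup_selected, fun T => ?_⟩
    rw [isSolution_of_edges_eq_nil hI hE, and_iff_left hmin]
    simp
  · rw [List.isEmpty_iff] at hE
    rw [isMinimalT_val] at hmin
    refine ⟨by simp, by simp, fun T => ?_⟩
    rw [isSolution_of_edges_eq_nil hI hE]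
    simp [hmin]
  · have hE' : I.E ≠ [] := by simpa using hE
    rcases hz : I.V.find? fun v => (hasDegreeT I.E 0 v).val with _ | v
    swap
    · have hv := List.find?_some hz
      simp only [hasDegreeT_val, hI.degree_eq, beq_iff_eq] at hv
      simp only [findT_val, hz, val_bind, val_pure]
      exact isGoodBranch_degree_zero hI (List.mem_of_find?_eq_some hz) hv
    simp only [findT_val, hz, val_bind, val_ite, hasSizeT_val, anyT_val, ssubsetT_val, val_pure]
    have hd0 : ∀ x ∈ I.V, degree (family I.E) x ≠ 0 := fun x hx => by
      have := List.find?_eq_none.1 hz x hx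
      simp only [hasDegreeT_val, hI.degree_eq, beq_iff_eq] at this
      exact this
    split
    · rename_i f hs
      have hf := List.find?_some hs
      simp only [Bool.if_false_right, Bool.and_eq_true, List.any_eq_true, decide_eq_true_eq] at hf
      obtain ⟨-, e, he, hef⟩ := hf
      simp only [val_bind, filterT_val, sameSetT_val, val_pure]
      exact isGoodBranch_superset hI he (List.mem_of_find?_eq_some hs) hef
    rename_i hs
    simp only [val_bind, findT_val, hasSizeT_val]
    split
    · rename_i e h1
      have he := List.find?_some h1
      simp only [val_bind, val_pure]
      exact isGoodBranch_singleton hI (List.mem_of_find?_eq_some h1) (by simpa using he)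
    rename_i h1
    have hlen : ∀ e ∈ I.E, 2 ≤ e.length := fun e he => by
      have h2 := List.find?_eq_none.1 h1 e he
      have h3 : e.length ≠ 0 := fun h => h0 (List.any_eq_true.2 ⟨e, he, by simpa using h⟩)
      simp only [beq_iff_eq] at h2
      omega
    -- All sizes are now 2 or 3, so a proper inclusion has a triple as its larger set, which the
    -- superset rule would have removed.
    have hC : IsClutter (family I.E) := by
      intro s hsF
      obtain ⟨e, he, rfl⟩ := mem_family.1 hsF
      rw [hI.card_eq he]
      refine ⟨hlen e he, fun t ht hte => ?_⟩
      obtain ⟨f, hf, rfl⟩ := mem_family.1 ht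
      by_contra hne
      have hss : f.toFinset ⊂ e.toFinset := hte.ssubset_of_ne hne
      have hlt := card_lt_card hss
      rw [hI.card_eq he, hI.card_eq hf] at hlt
      have := hI.length_le e he
      have := hlen f hf
      have h2 := List.find?_eq_none.1 hs e he
      rw [if_pos (by simp; omega)] at h2
      exact h2 (List.any_eq_true.2 ⟨f, hf, by simpa using hss⟩)
    simp only [val_bind, findT_val]
    split
    · rename_i v hone
      have hv := List.find?_some hone
      have hvV := List.mem_of_find?_eq_some hone
      simp only [hasDegreeT_val, hI.degree_eq, beq_iff_eq] at hv
      simp only [val_bind, findT_val, memT_val]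
      rcases he : I.E.find? fun e => decide (v ∈ e) with _ | e
      · obtain ⟨s, hs, hvs⟩ := degree_pos_iff.1 (show 0 < degree (family I.E) v by omega)
        obtain ⟨e, heE, rfl⟩ := mem_family.1 hs
        have := List.find?_eq_none.1 he e heE
        simp at this hvs
        exact absurd hvs this
      · have hve := List.find?_some he
        exact isGood_branchDegreeOne hI hC hvV hv (List.mem_of_find?_eq_some he) (by simpa using hve)
    rename_i hone
    have hd : ∀ x ∈ I.V, 2 ≤ degree (family I.E) x := fun x hx => by
      have h2 := List.find?_eq_none.1 hone x hx
      have h3 := hd0 x hx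
      simp only [hasDegreeT_val, hI.degree_eq, beq_iff_eq] at h2
      omega
    simp only [val_bind, val_ite, anyT_val, hasSizeT_val]
    split_ifs with h2
    · rw [List.any_eq_true] at h2
      obtain ⟨e, he, hc⟩ := h2
      exact isGood_branchPair hI hC hd ⟨e, he, by simpa using hc⟩
    · refine isGood_branchTriple hI hC hd (fun e he => ?_) hE'
      have h3 : e.length ≠ 2 := fun h => h2 (List.any_eq_true.2 ⟨e, he, by simpa using h⟩)
      have := hlen e he
      have := hI.length_le e he
      omega

end Rules

/-! ### Time bounds for a single rule -/

section Times

variable {β γ : Type}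

@[simp] lemma time_pure (b : β) : (pure b : Timed β).time = 0 := rfl
@[simp] lemma time_bind (x : Timed β) (f : β → Timed γ) :
    (x >>= f).time = x.time + (f x.val).time := rfl
@[simp] lemma time_step (x : Timed β) : (step x).time = x.time + 1 := rfl

lemma time_ite_le {c : Prop} [Decidable c] {x y : Timed β} {t : ℕ} (hx : x.time ≤ t)
    (hy : y.time ≤ t) : (if c then x else y).time ≤ t := by
  split_ifs <;> assumption

/-- Counts consecutive computations in units of `t`. Blocks of at most 16 units are then absorbed by
one power of `M` through `sixteen_mul_le`. -/
lemma time_bind_le {x : Timed β} {f : β → Timed γ} {s t : ℕ} (hx : x.time ≤ t)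
    (hf : (f x.val).time ≤ s * t) : (x >>= f).time ≤ (s + 1) * t := by
  rw [time_bind, add_mul, one_mul]
  omega

lemma anyT_time_le {p : β → Timed Bool} {l : List β} {t : ℕ} (h : ∀ b ∈ l, (p b).time ≤ t) :
    (anyT p l).time ≤ (l.length + 1) * (t + 1) := by
  induction l with
  | nil => simp [anyT]
  | cons b l ih =>
    have h1 := h b List.mem_cons_self
    have h2 := ih fun c hc => h c (List.mem_cons_of_mem _ hc)
    have h3 : ((l.length + 1) + 1) * (t + 1) = (l.length + 1) * (t + 1) + (t + 1) := by ring
    simp only [anyT, time_step, time_bind, List.length_cons]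
    split_ifs <;> first | (simp only [time_pure]; omega) | omega

lemma allT_time_le {p : β → Timed Bool} {l : List β} {t : ℕ} (h : ∀ b ∈ l, (p b).time ≤ t) :
    (allT p l).time ≤ (l.length + 1) * (t + 1) := by
  induction l with
  | nil => simp [allT]
  | cons b l ih =>
    have h1 := h b List.mem_cons_self
    have h2 := ih fun c hc => h c (List.mem_cons_of_mem _ hc)
    have h3 : ((l.length + 1) + 1) * (t + 1) = (l.length + 1) * (t + 1) + (t + 1) := by ring
    simp only [allT, time_step, time_bind, List.length_cons]
    split_ifs <;> first | (simp only [time_pure]; omega) | omega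

lemma findT_time_le {p : β → Timed Bool} {l : List β} {t : ℕ} (h : ∀ b ∈ l, (p b).time ≤ t) :
    (findT p l).time ≤ (l.length + 1) * (t + 1) := by
  induction l with
  | nil => simp [findT]
  | cons b l ih =>
    have h1 := h b List.mem_cons_self
    have h2 := ih fun c hc => h c (List.mem_cons_of_mem _ hc)
    have h3 : ((l.length + 1) + 1) * (t + 1) = (l.length + 1) * (t + 1) + (t + 1) := by ring
    simp only [findT, time_step, time_bind, List.length_cons]
    split_ifs <;> first | (simp only [time_pure]; omega) | omega

lemma filterT_time_le {p : β → Timed Bool} {l : List β} {t : ℕ} (h : ∀ b ∈ l, (p b).time ≤ t) :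
    (filterT p l).time ≤ (l.length + 1) * (t + 1) := by
  induction l with
  | nil => simp [filterT]
  | cons b l ih =>
    have h1 := h b List.mem_cons_self
    have h2 := ih fun c hc => h c (List.mem_cons_of_mem _ hc)
    have h3 : ((l.length + 1) + 1) * (t + 1) = (l.length + 1) * (t + 1) + (t + 1) := by ring
    simp only [filterT, time_step, time_bind, List.length_cons, time_pure]
    omega

lemma countT_time_le {p : β → Timed Bool} {l : List β} {t : ℕ} (h : ∀ b ∈ l, (p b).time ≤ t) :
    (countT p l).time ≤ (l.length + 1) * (t + 1) := by
  induction l with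
  | nil => simp [countT]
  | cons b l ih =>
    have h1 := h b List.mem_cons_self
    have h2 := ih fun c hc => h c (List.mem_cons_of_mem _ hc)
    have h3 : ((l.length + 1) + 1) * (t + 1) = (l.length + 1) * (t + 1) + (t + 1) := by ring
    simp only [countT, time_step, time_bind, List.length_cons, time_pure]
    omega

lemma mapT_time_le {f : β → Timed γ} {l : List β} {t : ℕ} (h : ∀ b ∈ l, (f b).time ≤ t) :
    (mapT f l).time ≤ (l.length + 1) * (t + 1) := by
  induction l with
  | nil => simp [mapT]
  | cons b l ih =>
    have h1 := h b List.mem_cons_self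
    have h2 := ih fun c hc => h c (List.mem_cons_of_mem _ hc)
    have h3 : ((l.length + 1) + 1) * (t + 1) = (l.length + 1) * (t + 1) + (t + 1) := by ring
    simp only [mapT, time_step, time_bind, List.length_cons, time_pure]
    omega

lemma argmaxT_time_le {f : β → Timed ℕ} {l : List β} {t : ℕ} (h : ∀ b ∈ l, (f b).time ≤ t) :
    (argmaxT f l).time ≤ (l.length + 1) * (t + 1) := by
  induction l with
  | nil => simp [argmaxT]
  | cons b l ih =>
    have h1 := h b List.mem_cons_self
    have h2 := ih fun c hc => h c (List.mem_cons_of_mem _ hc)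
    have h3 : ((l.length + 1) + 1) * (t + 1) = (l.length + 1) * (t + 1) + (t + 1) := by ring
    simp only [argmaxT, time_step, time_bind, List.length_cons]
    split <;> simp only [time_pure] <;> omega

lemma lengthT_time (l : List β) : (lengthT l).time = l.length + 1 := by
  induction l with
  | nil => rfl
  | cons b l ih =>
    simp only [lengthT, time_step, time_bind, time_pure, ih, List.length_cons, add_zero]

lemma appendT_time (l m : List β) : (appendT l m).time = l.length + 1 := by
  induction l with
  | nil => rfl
  | cons b l ih =>
    simp only [appendT, time_step, time_bind, time_pure, ih, List.length_cons, add_zero]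

lemma flatMapT_time (f : β → Timed (List γ)) (l : List β) :
    (flatMapT f l).time = (l.map fun b => (f b).time + (f b).val.length + 2).sum + 1 := by
  induction l with
  | nil => rfl
  | cons b l ih =>
    simp only [flatMapT, time_step, time_bind, appendT_time, ih, List.map_cons, List.sum_cons]
    omega

variable {α : Type} [DecidableEq α] {M k : ℕ}

/-- A loop costs two powers of `M`: one for the length of the list, one for the step added in each
iteration. -/
lemma loop_le (hM : 16 ≤ M) {n t : ℕ} (hn : n < M) (ht : t ≤ M ^ k) :
    (n + 1) * (t + 1) ≤ M ^ (k + 2) := by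
  have h1 : 1 ≤ M ^ k := Nat.one_le_pow _ _ (by omega)
  calc (n + 1) * (t + 1) ≤ M * (M * M ^ k) := by
        refine Nat.mul_le_mul hn ?_
        calc t + 1 ≤ 2 * M ^ k := by omega
          _ ≤ M * M ^ k := Nat.mul_le_mul_right _ (by omega)
    _ = M ^ (k + 2) := by ring

lemma sixteen_mul_le (hM : 16 ≤ M) : 16 * M ^ k ≤ M ^ (k + 1) := by
  rw [pow_succ, mul_comm]
  exact Nat.mul_le_mul_left _ hM

lemma le_pow_of_le {t a b : ℕ} (hM : 16 ≤ M) (h : t ≤ M ^ a) (hab : a ≤ b) : t ≤ M ^ b :=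
  h.trans (Nat.pow_le_pow_right (by omega) hab)

/-- All lists in the instance have length less than `M`. -/
structure Inst.Bounded (M : ℕ) (I : Inst α) : Prop where
  vertices : I.V.length < M
  edges : I.E.length < M
  edge : ∀ e ∈ I.E, e.length < M

lemma hasSizeT_time {β : Type} {e : List β} (he : e.length < M) (k : ℕ) :
    (hasSizeT k e).time ≤ M ^ 1 := by
  simp only [hasSizeT, time_bind, lengthT_time, time_pure, pow_one]
  omega

lemma memT_time (hM : 16 ≤ M) {e : List α} (he : e.length < M) (x : α) :
    (memT x e).time ≤ M ^ 2 :=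
  (anyT_time_le (t := 1) fun _ _ => le_rfl).trans (loop_le (k := 0) hM he (by simp))

lemma filterT_neT_time (hM : 16 ≤ M) {e : List α} (he : e.length < M) (x : α) :
    (filterT (neT x) e).time ≤ M ^ 2 :=
  (filterT_time_le (t := 1) fun _ _ => le_rfl).trans (loop_le (k := 0) hM he (by simp))

lemma subsetT_time (hM : 16 ≤ M) {e f : List α} (he : e.length < M) (hf : f.length < M) :
    (subsetT e f).time ≤ M ^ 4 :=
  (allT_time_le fun x _ => memT_time hM hf x).trans (loop_le hM he le_rfl)

lemma sameSetT_time (hM : 16 ≤ M) {e f : List α} (he : e.length < M) (hf : f.length < M) :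
    (sameSetT e f).time ≤ M ^ 5 := by
  refine le_trans ?_ (sixteen_mul_le hM)
  refine time_bind_le (subsetT_time hM he hf) (time_ite_le ?_ (Nat.zero_le _))
  exact (subsetT_time hM hf he).trans (Nat.le_mul_of_pos_left _ (by norm_num))

lemma ssubsetT_time (hM : 16 ≤ M) {e f : List α} (he : e.length < M) (hf : f.length < M) :
    (ssubsetT e f).time ≤ M ^ 5 := by
  refine le_trans ?_ (sixteen_mul_le hM)
  refine time_bind_le (subsetT_time hM he hf) (time_ite_le ?_ (Nat.zero_le _))
  exact time_bind_le (subsetT_time hM hf he) (Nat.zero_le _)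

lemma dedupT_time (hM : 16 ≤ M) {E : List (List α)} (hE : E.length < M)
    (he : ∀ e ∈ E, e.length < M) : (dedupT E).time ≤ M ^ 9 := by
  have key : ∀ E : List (List α), E.length < M → (∀ e ∈ E, e.length < M) →
      (dedupT E).time ≤ (E.length + 1) * (M ^ 7 + 1) := by
    intro E
    induction E with
    | nil => simp [dedupT]
    | cons e E ih =>
      intro hE he
      rw [List.length_cons] at hE
      have h1 := ih (by omega) fun f hf => he f (List.mem_cons_of_mem _ hf)
      have hs := dedupT_sublist E
      have h2 : (anyT (sameSetT e) (dedupT E).val).time ≤ M ^ 7 :=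
        (anyT_time_le fun f hf => sameSetT_time hM (he e List.mem_cons_self)
          (he f (List.mem_cons_of_mem _ (hs.subset hf)))).trans
          (loop_le hM (by have := hs.length_le; omega) le_rfl)
      have h3 : ((E.length + 1) + 1) * (M ^ 7 + 1) =
        (E.length + 1) * (M ^ 7 + 1) + (M ^ 7 + 1) := by ring
      simp only [dedupT, time_step, time_bind, List.length_cons]
      split_ifs <;> (simp only [time_pure]; omega)
  exact (key E hE he).trans (loop_le hM hE le_rfl)

lemma degreeT_time (hM : 16 ≤ M) {E : List (List α)} (hE : E.length < M)
    (he : ∀ e ∈ E, e.length < M) (v : α) : (degreeT E v).time ≤ M ^ 4 :=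
  (countT_time_le fun e h => memT_time hM (he e h) v).trans (loop_le hM hE le_rfl)

lemma hasDegreeT_time (hM : 16 ≤ M) {E : List (List α)} (hE : E.length < M)
    (he : ∀ e ∈ E, e.length < M) (k : ℕ) (v : α) : (hasDegreeT E k v).time ≤ M ^ 4 := by
  simpa [hasDegreeT] using degreeT_time hM hE he v

lemma isPairAtT_time (hM : 16 ≤ M) {e : List α} (he : e.length < M) (v : α) :
    (isPairAtT v e).time ≤ M ^ 3 := by
  refine le_trans ?_ (sixteen_mul_le hM)
  refine time_bind_le (le_pow_of_le hM (hasSizeT_time he 2) (by norm_num))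
    (time_ite_le ?_ (Nat.zero_le _))
  exact (memT_time hM he v).trans (Nat.le_mul_of_pos_left _ (by norm_num))

lemma degreeTwoT_time (hM : 16 ≤ M) {E : List (List α)} (hE : E.length < M)
    (he : ∀ e ∈ E, e.length < M) (v : α) : (degreeTwoT E v).time ≤ M ^ 5 :=
  (countT_time_le fun e h => isPairAtT_time hM (he e h) v).trans (loop_le hM hE le_rfl)

lemma containsBothT_time (hM : 16 ≤ M) {e : List α} (he : e.length < M) (v u : α) :
    (containsBothT v u e).time ≤ M ^ 3 := by
  refine le_trans ?_ (sixteen_mul_le hM)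
  refine time_bind_le (memT_time hM he v) (time_ite_le ?_ (Nat.zero_le _))
  exact (memT_time hM he u).trans (Nat.le_mul_of_pos_left _ (by norm_num))

lemma isPairPartnerT_time (hM : 16 ≤ M) {E : List (List α)} (hE : E.length < M)
    (he : ∀ e ∈ E, e.length < M) (v u : α) : (isPairPartnerT E v u).time ≤ M ^ 7 := by
  refine le_trans ?_ (sixteen_mul_le hM)
  refine time_bind_le (Nat.one_le_pow _ _ (by omega)) (time_ite_le ?_ (Nat.zero_le _))
  refine le_trans ?_ (Nat.le_mul_of_pos_left _ (by norm_num))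
  refine (anyT_time_le (t := M ^ 4) fun e h => ?_).trans (loop_le hM hE le_rfl)
  refine le_trans ?_ (sixteen_mul_le hM)
  refine time_bind_le (isPairAtT_time hM (he e h) v) (time_ite_le ?_ (Nat.zero_le _))
  exact (le_pow_of_le hM (memT_time hM (he e h) u) (by norm_num)).trans
    (Nat.le_mul_of_pos_left _ (by norm_num))

lemma hitsAllT_time (hM : 16 ≤ M) {E : List (List α)} {T : List α} (hE : E.length < M)
    (he : ∀ e ∈ E, e.length < M) (hT : T.length < M) : (hitsAllT E T).time ≤ M ^ 6 :=
  (allT_time_le fun e h => (anyT_time_le fun x _ => memT_time hM hT x).trans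
    (loop_le hM (he e h) le_rfl)).trans (loop_le hM hE le_rfl)

lemma isMinimalT_time (hM : 16 ≤ M) {E : List (List α)} {T : List α} (hE : E.length < M)
    (he : ∀ e ∈ E, e.length < M) (hT : T.length < M) : (isMinimalT E T).time ≤ M ^ 10 := by
  refine le_trans ?_ (sixteen_mul_le hM)
  refine time_bind_le (le_pow_of_le hM (hitsAllT_time hM hE he hT) (by norm_num))
    (time_ite_le ?_ (Nat.zero_le _))
  refine le_trans ?_ (Nat.le_mul_of_pos_left _ (by norm_num))
  refine (allT_time_le (t := M ^ 7) fun v _ => ?_).trans (loop_le hM hT le_rfl)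
  refine le_trans ?_ (sixteen_mul_le hM)
  refine time_bind_le (le_pow_of_le hM (filterT_neT_time hM hT v) (by norm_num)) ?_
  refine time_bind_le (hitsAllT_time hM hE he ?_) (Nat.zero_le _)
  rw [filterT_val]
  exact (List.length_filter_le _ _).trans_lt hT

variable {I : Inst α}

lemma Inst.Bounded.select (hI : I.Bounded M) (v : α) : (selectT v I).val.Bounded M := by
  rw [selectT_val]
  exact ⟨(List.length_filter_le _ _).trans_lt hI.vertices,
    (List.length_filter_le _ _).trans_lt hI.edges,
    fun e he => hI.edge e (List.mem_of_mem_filter he)⟩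

lemma Inst.Bounded.discard (hI : I.Bounded M) (v : α) : (discardT v I).val.Bounded M := by
  rw [discardT_val]
  have hs := dedupT_sublist (I.E.map fun e => e.filter fun x => !decide (v = x))
  refine ⟨(List.length_filter_le _ _).trans_lt hI.vertices, ?_, fun e he => ?_⟩
  · have h := hs.length_le
    rw [List.length_map] at h
    exact h.trans_lt hI.edges
  · obtain ⟨f, hf, rfl⟩ := List.mem_map.1 (hs.subset he)
    exact (List.length_filter_le _ _).trans_lt (hI.edge f hf)

lemma selectT_time (hM : 16 ≤ M) (hI : I.Bounded M) (v : α) : (selectT v I).time ≤ M ^ 5 := by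
  refine le_trans ?_ (sixteen_mul_le hM)
  refine time_bind_le (le_pow_of_le hM (filterT_neT_time hM hI.vertices v) (by norm_num)) ?_
  refine time_bind_le ?_ (Nat.zero_le _)
  refine (filterT_time_le (t := M ^ 2) fun e he => ?_).trans (loop_le hM hI.edges le_rfl)
  simpa using memT_time hM (hI.edge e he) v

lemma discardT_time (hM : 16 ≤ M) (hI : I.Bounded M) (v : α) :
    (discardT v I).time ≤ M ^ 10 := by
  refine le_trans ?_ (sixteen_mul_le hM)
  refine time_bind_le (le_pow_of_le hM (filterT_neT_time hM hI.vertices v) (by norm_num)) ?_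
  refine time_bind_le (le_pow_of_le hM ((mapT_time_le fun e he =>
    filterT_neT_time hM (hI.edge e he) v).trans (loop_le hM hI.edges le_rfl)) (by norm_num)) ?_
  refine time_bind_le (dedupT_time hM ?_ ?_) (Nat.zero_le _)
  · rw [mapT_val, List.length_map]
    exact hI.edges
  · rw [mapT_val]
    intro e he
    obtain ⟨f, hf, rfl⟩ := List.mem_map.1 he
    rw [filterT_val]
    exact (List.length_filter_le _ _).trans_lt (hI.edge f hf)

lemma selectAllT_time (hM : 16 ≤ M) (hI : I.Bounded M) {l : List α} (hl : l.length < M) :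
    (selectAllT l I).time ≤ M ^ 7 := by
  have key : ∀ (l : List α) (I : Inst α), I.Bounded M →
      (selectAllT l I).time ≤ (l.length + 1) * (M ^ 5 + 1) := by
    intro l
    induction l with
    | nil => simp [selectAllT]
    | cons v l ih =>
      intro I hI
      have h1 := selectT_time hM hI v
      have h2 := ih _ (hI.select v)
      have h3 : ((l.length + 1) + 1) * (M ^ 5 + 1) =
        (l.length + 1) * (M ^ 5 + 1) + (M ^ 5 + 1) := by ring
      simp only [selectAllT, time_step, time_bind, List.length_cons]
      omega
  exact (key l I hI).trans (loop_le hM hl le_rfl)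

lemma discardAllT_time (hM : 16 ≤ M) (hI : I.Bounded M) {l : List α} (hl : l.length < M) :
    (discardAllT l I).time ≤ M ^ 12 := by
  have key : ∀ (l : List α) (I : Inst α), I.Bounded M →
      (discardAllT l I).time ≤ (l.length + 1) * (M ^ 10 + 1) := by
    intro l
    induction l with
    | nil => simp [discardAllT]
    | cons v l ih =>
      intro I hI
      have h1 := discardT_time hM hI v
      have h2 := ih _ (hI.discard v)
      have h3 : ((l.length + 1) + 1) * (M ^ 10 + 1) =
        (l.length + 1) * (M ^ 10 + 1) + (M ^ 10 + 1) := by ring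
      simp only [discardAllT, time_step, time_bind, List.length_cons]
      omega
  exact (key l I hI).trans (loop_le hM hl le_rfl)

lemma branchDegreeOne_time (hM : 16 ≤ M) (hI : I.Bounded M) {e : List α} (he : e.length < M)
    (v : α) : (branchDegreeOne I v e).time ≤ M ^ 13 := by
  refine le_trans ?_ (sixteen_mul_le hM)
  have hsel : ∀ u, (selectT u I).time ≤ M ^ 12 := fun u =>
    le_pow_of_le hM (selectT_time hM hI u) (by norm_num)
  have hdis : ∀ {J : Inst α}, J.Bounded M → ∀ u, (discardT u J).time ≤ M ^ 12 := fun hJ u =>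
    le_pow_of_le hM (discardT_time hM hJ u) (by norm_num)
  have hall : ∀ u a b, (discardAllT [a, b] (selectT u I).val).time ≤ M ^ 12 := fun u a b =>
    discardAllT_time hM (hI.select u) (by simp; omega)
  have hdeg : ∀ u, (degreeT I.E u).time ≤ M ^ 12 := fun u =>
    le_pow_of_le hM (degreeT_time hM hI.edges hI.edge u) (by norm_num)
  refine time_bind_le (le_pow_of_le hM (filterT_neT_time hM he v) (by norm_num)) ?_
  split
  · refine time_bind_le (hsel _) (time_bind_le (hdis (hI.select _) _)
      (time_bind_le (hdis hI _) (Nat.zero_le _)))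
  · refine time_bind_le (hdeg _) (time_bind_le (hdeg _) (time_ite_le ?_ ?_))
    · exact time_bind_le (hsel _) (time_bind_le (hall _ _ _) (time_bind_le (hsel _)
        (time_bind_le (hall _ _ _) (time_bind_le (hsel _) (time_bind_le (hall _ _ _)
          (Nat.zero_le _))))))
    · exact time_bind_le (hsel _) (time_bind_le (hall _ _ _) (time_bind_le (hdis hI _)
        (Nat.zero_le _)))
  · exact Nat.zero_le _

lemma branchPair_time (hM : 16 ≤ M) (hI : I.Bounded M) : (branchPair I).time ≤ M ^ 11 := by
  refine le_trans ?_ (sixteen_mul_le hM)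
  have hlen : ∀ p : α → Timed Bool, (filterT p I.V).val.length < M := fun p => by
    rw [filterT_val]
    exact (List.length_filter_le _ _).trans_lt hI.vertices
  refine time_bind_le (le_pow_of_le hM ((argmaxT_time_le fun x _ =>
    degreeTwoT_time hM hI.edges hI.edge x).trans (loop_le hM hI.vertices le_rfl)) (by norm_num)) ?_
  split
  · refine time_bind_le (le_pow_of_le hM ((filterT_time_le (t := M ^ 5) fun x _ => ?_).trans
      (loop_le hM hI.vertices le_rfl)) (by norm_num)) ?_
    · simpa using degreeTwoT_time hM hI.edges hI.edge x
    refine time_bind_le (le_pow_of_le hM ((argmaxT_time_le fun x _ =>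
      degreeT_time hM hI.edges hI.edge x).trans (loop_le hM (hlen _) le_rfl)) (by norm_num)) ?_
    split
    · refine time_bind_le (le_pow_of_le hM ((filterT_time_le fun x _ =>
        isPairPartnerT_time hM hI.edges hI.edge _ x).trans (loop_le hM hI.vertices le_rfl))
        (by norm_num)) ?_
      refine time_bind_le (le_pow_of_le hM (selectT_time hM hI _) (by norm_num)) ?_
      refine time_bind_le (discardT_time hM hI _) ?_
      exact time_bind_le (le_pow_of_le hM (selectAllT_time hM (hI.discard _) (hlen _))
        (by norm_num)) (Nat.zero_le _)
    · exact Nat.zero_le _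
  · exact Nat.zero_le _

lemma branchTriple_time (hM : 16 ≤ M) (hI : I.Bounded M) : (branchTriple I).time ≤ M ^ 13 := by
  refine le_trans ?_ (sixteen_mul_le hM)
  have hsel : ∀ {J : Inst α}, J.Bounded M → ∀ u, (selectT u J).time ≤ M ^ 12 := fun hJ u =>
    le_pow_of_le hM (selectT_time hM hJ u) (by norm_num)
  have hdis : ∀ {J : Inst α}, J.Bounded M → ∀ u, (discardT u J).time ≤ M ^ 12 := fun hJ u =>
    le_pow_of_le hM (discardT_time hM hJ u) (by norm_num)
  refine time_bind_le (le_pow_of_le hM ((argmaxT_time_le fun x _ =>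
    degreeT_time hM hI.edges hI.edge x).trans (loop_le hM hI.vertices le_rfl)) (by norm_num)) ?_
  split
  · refine time_ite_le ?_ ?_
    · exact time_bind_le (hsel hI _) (time_bind_le (hdis hI _) (Nat.zero_le _))
    · refine time_bind_le (le_pow_of_le hM ((findT_time_le (t := M ^ 6) fun u _ => ?_).trans
        (loop_le hM hI.vertices le_rfl)) (by norm_num)) ?_
      · refine le_trans ?_ (sixteen_mul_le hM)
        refine time_bind_le (Nat.one_le_pow _ _ (by omega)) (time_ite_le ?_ (Nat.zero_le _))
        exact time_bind_le ((countT_time_le fun e he =>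
          containsBothT_time hM (hI.edge e he) _ u).trans (loop_le hM hI.edges le_rfl))
          (Nat.zero_le _)
      split
      · exact time_bind_le (hsel hI _) (time_bind_le (hdis (hI.select _) _)
          (time_bind_le (hdis hI _) (Nat.zero_le _)))
      · refine time_bind_le (le_pow_of_le hM ((filterT_time_le fun e he =>
          memT_time hM (hI.edge e he) _).trans (loop_le hM hI.edges le_rfl)) (by norm_num)) ?_
        refine time_bind_le (le_pow_of_le hM ((mapT_time_le fun e he =>
          filterT_neT_time hM (hI.edge e ?_) _).trans (loop_le hM ?_ le_rfl))
          (by norm_num)) ?_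
        · rw [filterT_val] at he
          exact List.mem_of_mem_filter he
        · rw [filterT_val]
          exact (List.length_filter_le _ _).trans_lt hI.edges
        split
        · exact time_bind_le (hsel hI _) (time_bind_le (hsel (hI.select _) _)
            (time_bind_le (discardAllT_time hM ((hI.select _).select _) (by simp; omega))
              (time_bind_le (hdis (hI.select _) _) (time_bind_le (hdis hI _) (Nat.zero_le _)))))
        · exact Nat.zero_le _
  · exact Nat.zero_le _

lemma applyRule_time (hM : 16 ≤ M) {E₀ : List (List α)} (hE : E₀.length < M)
    (he : ∀ e ∈ E₀, e.length < M) (hI : I.Bounded M) (hS : I.S.length < M) :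
    (applyRule E₀ I).time ≤ M ^ 14 := by
  refine le_trans ?_ (sixteen_mul_le hM)
  have hsize : ∀ k, ∀ e ∈ I.E, (hasSizeT k e).time ≤ M ^ 1 := fun k e he =>
    hasSizeT_time (hI.edge e he) k
  have hany : ∀ k, (anyT (hasSizeT k) I.E).time ≤ M ^ 13 := fun k =>
    le_pow_of_le hM ((anyT_time_le (hsize k)).trans (loop_le hM hI.edges le_rfl)) (by norm_num)
  have hdeg : ∀ k, (findT (hasDegreeT I.E k) I.V).time ≤ M ^ 13 := fun k =>
    le_pow_of_le hM ((findT_time_le fun v _ => hasDegreeT_time hM hI.edges hI.edge k v).trans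
      (loop_le hM hI.vertices le_rfl)) (by norm_num)
  refine time_bind_le (hany 0) (time_ite_le (Nat.zero_le _) (time_ite_le ?_ ?_))
  · exact time_bind_le (le_pow_of_le hM (isMinimalT_time hM hE he hS) (by norm_num))
      (time_ite_le (Nat.zero_le _) (Nat.zero_le _))
  refine time_bind_le (hdeg 0) ?_
  split
  · exact time_bind_le (le_pow_of_le hM (discardT_time hM hI _) (by norm_num)) (Nat.zero_le _)
  refine time_bind_le (le_pow_of_le hM ((findT_time_le (t := M ^ 8) fun f hf => ?_).trans
    (loop_le hM hI.edges le_rfl)) (by norm_num)) ?_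
  · refine le_trans ?_ (sixteen_mul_le hM)
    refine time_bind_le (le_pow_of_le hM (hsize 3 f hf) (by norm_num))
      (time_ite_le ?_ (Nat.zero_le _))
    exact ((anyT_time_le fun e he => ssubsetT_time hM (hI.edge e he) (hI.edge f hf)).trans
      (loop_le hM hI.edges le_rfl)).trans (Nat.le_mul_of_pos_left _ (by norm_num))
  split
  · rename_i f hf
    have hf' : f ∈ I.E := by
      rw [findT_val] at hf
      exact List.mem_of_find?_eq_some hf
    refine time_bind_le (le_pow_of_le hM ((filterT_time_le (t := M ^ 5) fun e he => ?_).trans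
      (loop_le hM hI.edges le_rfl)) (by norm_num)) (Nat.zero_le _)
    simpa using sameSetT_time hM (hI.edge e he) (hI.edge f hf')
  refine time_bind_le (le_pow_of_le hM ((findT_time_le (hsize 1)).trans
    (loop_le hM hI.edges le_rfl)) (by norm_num)) ?_
  split
  · rename_i e he
    have he' : e ∈ I.E := by
      rw [findT_val] at he
      exact List.mem_of_find?_eq_some he
    exact time_bind_le (le_pow_of_le hM (selectAllT_time hM hI (hI.edge e he')) (by norm_num))
      (Nat.zero_le _)
  refine time_bind_le (hdeg 1) ?_
  split
  · refine time_bind_le (le_pow_of_le hM ((findT_time_le fun e he =>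
      memT_time hM (hI.edge e he) _).trans (loop_le hM hI.edges le_rfl)) (by norm_num)) ?_
    split
    · rename_i e he
      have he' : e ∈ I.E := by
        rw [findT_val] at he
        exact List.mem_of_find?_eq_some he
      exact (branchDegreeOne_time hM hI (hI.edge e he') _).trans
        (Nat.le_mul_of_pos_left _ (by norm_num))
    · exact Nat.zero_le _
  refine time_bind_le (hany 2) (time_ite_le ?_ ?_)
  · exact (le_pow_of_le hM (branchPair_time hM hI) (by norm_num)).trans
      (Nat.le_mul_of_pos_left _ (by norm_num))
  · exact (branchTriple_time hM hI).trans (Nat.le_mul_of_pos_left _ (by norm_num))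

end Times

/-! ### The search tree -/

section Search

open Finset

variable {α : Type} [DecidableEq α]

lemma cast_sum_map_le {β : Type} (l : List β) (f : β → ℕ) (w : β → ℚ) (c : ℚ)
    (h : ∀ b ∈ l, (f b : ℚ) ≤ c * w b + 2) :
    (((l.map f).sum : ℕ) : ℚ) ≤ c * (l.map w).sum + 2 * l.length := by
  induction l with
  | nil => simp
  | cons b l ih =>
    have h1 := h b List.mem_cons_self
    have h2 := ih fun b hb => h b (List.mem_cons_of_mem _ hb)
    simp only [List.map_cons, List.sum_cons, List.length_cons, Nat.cast_add, Nat.cast_one]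
    linarith

lemma cast_sum_map_le' {β : Type} (l : List β) (f : β → ℕ) (w : β → ℚ)
    (h : ∀ b ∈ l, (f b : ℚ) ≤ w b) : (((l.map f).sum : ℕ) : ℚ) ≤ (l.map w).sum := by
  induction l with
  | nil => simp
  | cons b l ih =>
    have h1 := h b List.mem_cons_self
    have h2 := ih fun b hb => h b (List.mem_cons_of_mem _ hb)
    simp only [List.map_cons, List.sum_cons, Nat.cast_add]
    linarith

/-- The search tree below the instance `I` yields all solutions of `I`. -/
structure IsGoodResult (F₀ : Finset (Finset α)) (I : Inst α) (K : ℚ)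
    (r : Timed (List (List α))) : Prop where
  nodup : ∀ l ∈ r.val, l.Nodup
  nodup_map : (r.val.map List.toFinset).Nodup
  mem_iff : ∀ T, T ∈ r.val.map List.toFinset ↔ I.IsSolution F₀ T
  length_le : (r.val.length : ℚ) ≤ weight (family I.E)
  time_le : (r.time : ℚ) ≤ K * weight (family I.E)

/-- Induction on the depth. Weights are at least 1 and do not increase in total over the branches.
So the bounded work at a node is a multiple of its weight, and each level of the tree adds at most
one such multiple of the root's weight. By `hd` the depth limit is never hit. -/
lemma isGoodResult_search {M : ℕ} (hM : 16 ≤ M) {E₀ : List (List α)} (hE : E₀.length < M)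
    (he : ∀ e ∈ E₀, e.length < M) (depth : ℕ) (I : Inst α) (hI : I.Valid (family E₀))
    (hb : I.Bounded M) (hS : I.S.length + I.V.length < M)
    (hd : I.V.length + I.E.length < depth) :
    IsGoodResult (family E₀) I (depth * (M ^ 14 + 9)) (search E₀ depth I) := by
  induction depth generalizing I with
  | zero => omega
  | succ depth ih =>
    have hgood := isGood_applyRule hI
    have htime : ((applyRule E₀ I).time : ℚ) ≤ M ^ 14 := by
      exact_mod_cast applyRule_time hM hE he hb (by omega)
    have hw := one_le_weight (family I.E)
    have hK : (0 : ℚ) ≤ depth * (M ^ 14 + 9) := by positivity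
    have hM0 : (0 : ℚ) ≤ M ^ 14 := by positivity
    have hKw : (M ^ 14 + 9 : ℚ) ≤ (M ^ 14 + 9) * weight (family I.E) :=
      le_mul_of_one_le_right (by positivity) hw
    rcases ho : (applyRule E₀ I).val with out | Js
    · rw [ho] at hgood
      obtain ⟨h1, h2, h3⟩ := hgood
      have hv : (search E₀ (depth + 1) I).val = out := by
        simp only [search, val_step, val_bind, ho, val_pure]
      have ht : (search E₀ (depth + 1) I).time = (applyRule E₀ I).time + 1 := by
        simp only [search, time_step, time_bind, ho, time_pure, add_zero]
      refine ⟨by rwa [hv], ?_, by rwa [hv], ?_, ?_⟩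
      · rw [hv]
        refine List.Nodup.of_map (fun _ => ()) ?_
        match out, h1 with
        | [], _ => simp
        | [l], _ => simp
      · rw [hv]
        exact le_trans (by exact_mod_cast h1) hw
      · rw [ht]
        push_cast
        nlinarith [mul_nonneg hK (zero_le_one.trans hw)]
    · rw [ho] at hgood
      have hgood : IsGoodBranch (family E₀) I Js := hgood
      have hr : ∀ J ∈ Js, IsGoodResult (family E₀) J (depth * (M ^ 14 + 9)) (search E₀ depth J) := by
        intro J hJ
        have hJ1 := hgood.size_lt J hJ
        have hJ2 := hgood.selected_le J hJ
        refine ih J (hgood.valid J hJ) ⟨(hgood.vertices_le J hJ).trans_lt hb.vertices,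
          (hgood.edges_le J hJ).trans_lt hb.edges, fun e he' => ?_⟩ (by omega) (by omega)
        have := (hgood.valid J hJ).length_le e he'
        omega
      have hv : (search E₀ (depth + 1) I).val = Js.flatMap fun J => (search E₀ depth J).val := by
        simp only [search, val_step, val_bind, ho, flatMapT_val]
      have ht : (search E₀ (depth + 1) I).time = (applyRule E₀ I).time +
          ((Js.map fun J => (search E₀ depth J).time + (search E₀ depth J).val.length + 2).sum + 1)
            + 1 := by
        simp only [search, time_step, time_bind, ho, flatMapT_time]
      have hmap : (Js.flatMap fun J => (search E₀ depth J).val).map List.toFinset =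
          Js.flatMap fun J => (search E₀ depth J).val.map List.toFinset := List.map_flatMap ..
      refine ⟨?_, ?_, ?_, ?_, ?_⟩
      · rw [hv]
        intro l hl
        obtain ⟨J, hJ, hl⟩ := List.mem_flatMap.1 hl
        exact (hr J hJ).nodup l hl
      · rw [hv, hmap, List.nodup_flatMap]
        refine ⟨fun J hJ => (hr J hJ).nodup_map, hgood.disjoint.imp_of_mem
          fun {J J'} hJ hJ' h T hT hT' => ?_⟩
        exact h T (((hr J hJ).mem_iff T).1 hT) (((hr J' hJ').mem_iff T).1 hT')
      · intro T
        rw [hv, hmap, List.mem_flatMap, hgood.solution]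
        exact exists_congr fun J => and_congr_right fun hJ => (hr J hJ).mem_iff T
      · rw [hv, List.length_flatMap]
        exact (cast_sum_map_le' Js _ _ fun J hJ => (hr J hJ).length_le).trans hgood.weight
      · rw [ht]
        have h1 := cast_sum_map_le Js
          (fun J => (search E₀ depth J).time + (search E₀ depth J).val.length + 2)
          (fun J => weight (family J.E)) (depth * (M ^ 14 + 9) + 1) fun J hJ => by
            have h2 := (hr J hJ).length_le
            have h3 := (hr J hJ).time_le
            push_cast
            linarith
        have h4 : (Js.length : ℚ) ≤ 3 := by exact_mod_cast hgood.length_le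
        have h5 := mul_le_mul_of_nonneg_left hgood.weight
          (show (0 : ℚ) ≤ depth * (M ^ 14 + 9) + 1 by positivity)
        have h6 : (M ^ 14 : ℚ) ≤ M ^ 14 * weight (family I.E) := le_mul_of_one_le_right hM0 hw
        rw [Nat.cast_add, Nat.cast_add, Nat.cast_add, Nat.cast_one, Nat.cast_succ]
        -- The 9 is 6 + 2 + 1: two steps for each of at most three branches, two further steps at
        -- the node, and the copying of the outputs, whose number is at most the weight.
        linarith

end Search

/-! ### From lists to hypergraphs, and the final bounds -/

section Hypergraphs

open Finset

variable {α : Type} [DecidableEq α] {H : Hypergraph α} {V : List α} {E : List (List α)}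

lemma coe_toFinset_eq_setOf (l : List α) : ((l.toFinset : Finset α) : Set α) = {x | x ∈ l} := by
  ext
  simp

/-- Minimality means that every element has a private hyperedge: removing `x` leaves some hyperedge
unhit, and conversely a proper subset lacking `x` misses the private hyperedge of `x`. -/
lemma _root_.Hypergraph.IsListedBy.isMinimalTransversal_iff (h : H.IsListedBy V E)
    (T : Finset α) : H.IsMinimalTransversal (T : Set α) ↔
      IsMinimalHittingSet (family E) T ∧ T ⊆ V.toFinset := by
  have hedge : ∀ {p : Set α → Prop},
      (∀ s ∈ H.edgeSet, p s) ↔ ∀ s ∈ family E, p (s : Set α) := by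
    intro p
    simp only [h.mem_edges, mem_family, forall_exists_index, and_imp, forall_apply_eq_imp_iff₂,
      coe_toFinset_eq_setOf]
  have hT : ∀ T : Finset α, H.IsTransversal (T : Set α) ↔
      T ⊆ V.toFinset ∧ ∀ s ∈ family E, (s ∩ T).Nonempty := by
    intro T
    rw [Hypergraph.IsTransversal, hedge]
    simp only [← coe_inter, coe_nonempty]
    refine and_congr_left fun _ => ?_
    simp only [Set.subset_def, ← h.mem_vertices, mem_coe, subset_iff, List.mem_toFinset]
  rw [Hypergraph.IsMinimalTransversal, minimal_iff_forall_lt]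
  constructor
  · rintro ⟨h1, h2⟩
    rw [hT] at h1
    refine ⟨⟨h1.2, fun x hx => ?_⟩, h1.1⟩
    have h3 := h2 (y := ((T.erase x : Finset α) : Set α))
      (by exact_mod_cast erase_ssubset hx)
    rw [hT, not_and] at h3
    have h4 := h3 ((erase_subset _ _).trans h1.1)
    push Not at h4
    obtain ⟨s, hs, h5⟩ := h4
    refine ⟨s, hs, (subset_singleton_iff.1 ?_).resolve_left (h1.2 s hs).ne_empty⟩
    rw [inter_erase, erase_eq_empty_iff] at h5
    rcases h5 with h5 | h5 <;> rw [h5]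
    exact empty_subset _
  · rintro ⟨⟨h1, h2⟩, h3⟩
    refine ⟨(hT T).2 ⟨h3, h1⟩, fun T' hlt hT' => ?_⟩
    obtain ⟨T', rfl⟩ := (T.finite_toSet.subset hlt.le).exists_finset_coe
    rw [hT] at hT'
    obtain ⟨x, hx, hx'⟩ := Set.exists_of_ssubset hlt
    obtain ⟨s, hs, hsT⟩ := h2 x hx
    obtain ⟨y, hy⟩ := hT'.2 s hs
    rw [mem_inter] at hy
    have : y ∈ s ∩ T := mem_inter.2 ⟨hy.1, hlt.le hy.2⟩
    rw [hsT, mem_singleton] at this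
    exact hx' (this ▸ hy.2)

lemma _root_.Hypergraph.encard_le_of_rank_le {β : Type} {H : Hypergraph β} {k : ℕ∞}
    (hr : H.rank ≤ k) {e : Set β} (he : e ∈ H.edgeSet) : e.encard ≤ k :=
  (le_iSup₂ (f := fun (e : Set β) (_ : e ∈ H.edgeSet) => e.encard) e he).trans hr

lemma _root_.Hypergraph.IsListedBy.length_le (h : H.IsListedBy V E) (hr : H.rank ≤ 3) :
    ∀ e ∈ E, e.length ≤ 3 := by
  intro e he
  have h1 := Hypergraph.encard_le_of_rank_le hr ((h.mem_edges _).2 ⟨e, he, rfl⟩)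
  rw [← coe_toFinset_eq_setOf, Set.encard_coe_eq_coe_finsetCard,
    List.toFinset_card_of_nodup (h.nodup_edge e he)] at h1
  exact_mod_cast h1

lemma _root_.Hypergraph.IsListedBy.valid (h : H.IsListedBy V E) (hr : H.rank ≤ 3) :
    (⟨V, E, []⟩ : Inst α).Valid (family E) where
  nodup_vertices := h.nodup_vertices
  nodup_selected := List.nodup_nil
  notMem_selected := by simp
  nodup_edge := h.nodup_edge
  subset_vertices e he x hx := (h.mem_vertices x).2
    (H.subset_vertexSet_of_mem_edgeSet ((h.mem_edges _).2 ⟨e, he, rfl⟩) hx)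
  length_le := h.length_le hr
  nodup_edges := by
    refine List.Nodup.of_map (fun s : Finset α => (s : Set α)) ?_
    rw [List.map_map]
    simpa only [Function.comp_def, coe_toFinset_eq_setOf] using h.nodup_edges
  exists_original s hs := ⟨s, hs, fun _ hx _ => hx⟩
  exists_remaining s hs := Or.inr ⟨s, hs, Finset.Subset.refl _⟩

/-- There are at most 1 + n + n² + n³ sets of at most three vertices. -/
lemma Inst.Valid.length_edges_le {F₀ : Finset (Finset α)} {I : Inst α} (hI : I.Valid F₀) :
    I.E.length ≤ (I.V.length + 1) ^ 3 := by
  set U := I.V.toFinset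
  set n := I.V.length
  have hU : #U = n := List.toFinset_card_of_nodup hI.nodup_vertices
  calc I.E.length = #(family I.E) := by
        rw [family, List.toFinset_card_of_nodup hI.nodup_edges, List.length_map]
    _ ≤ #((range 4).biUnion fun k => powersetCard k U) := by
        refine card_le_card fun s hs => mem_biUnion.2 ⟨#s, ?_, mem_powersetCard.2 ⟨?_, rfl⟩⟩
        · exact mem_range.2 (Nat.lt_succ_of_le (hI.card_le s hs))
        · exact fun x hx => List.mem_toFinset.2 (hI.mem_vertices hs hx)
    _ ≤ ∑ k ∈ range 4, n ^ k := card_biUnion_le.trans (sum_le_sum fun k _ => by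
        rw [card_powersetCard, hU]
        exact Nat.choose_le_pow n k)
    _ ≤ (n + 1) ^ 3 := by
        simp only [sum_range_succ, sum_range_zero]
        ring_nf
        omega

lemma _root_.Hypergraph.IsListedBy.ncard_eq (h : H.IsListedBy V E) :
    H.vertexSet.ncard = V.length := by
  have : H.vertexSet = (V.toFinset : Set α) := by
    ext x
    simp [← h.mem_vertices]
  rw [this, Set.ncard_coe_finset, List.toFinset_card_of_nodup h.nodup_vertices]

lemma _root_.Hypergraph.IsListedBy.isGoodResult_enumerate (h : H.IsListedBy V E)
    (hr : H.rank ≤ 3) :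
    IsGoodResult (family E) ⟨V, E, []⟩ (2 * ((V.length : ℚ) + 3) ^ 45) (enumerate V E) := by
  have hI := h.valid hr
  have hE := hI.length_edges_le
  set n := V.length with hn
  -- Large enough to exceed the length of every list that occurs and to bound the recursion depth.
  set M := (n + 3) ^ 3 with hM
  have hM27 : 27 ≤ M := by
    calc 27 = 3 ^ 3 := by norm_num
      _ ≤ M := Nat.pow_le_pow_left (by omega) 3
  have hnM : (n + 1) ^ 3 + n + 1 < M := by
    rw [hM]
    ring_nf
    omega
  have he : ∀ e ∈ E, e.length < M := fun e he => by
    have := h.length_le hr e he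
    omega
  have hEM : E.length < M := by
    simp only at hE
    omega
  have hres := isGoodResult_search (M := M) (by omega) hEM he (V.length + E.length + 1)
    ⟨V, E, []⟩ hI ⟨by simp only; omega, hEM, he⟩ (by simp only [List.length_nil]; omega)
    (Nat.lt_succ_self _)
  refine ⟨hres.nodup, hres.nodup_map, hres.mem_iff, hres.length_le, hres.time_le.trans ?_⟩
  refine mul_le_mul_of_nonneg_right ?_ (zero_le_one.trans (one_le_weight _))
  have h1 : ((V.length + E.length + 1 : ℕ) : ℚ) ≤ (M : ℚ) := by
    simp only at hE
    exact_mod_cast (by omega)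
  have h2 : (9 : ℚ) ≤ M ^ 14 := by
    have : (27 : ℚ) ≤ M := by exact_mod_cast hM27
    calc (9 : ℚ) ≤ M ^ 1 := by linarith
      _ ≤ M ^ 14 := pow_le_pow_right₀ (by linarith) (by norm_num)
  -- Depth at most `M`, and work per level at most 2 `M ^ 14` times the weight; the exponent 45 is 3
  -- · 15.
  calc _ ≤ (M : ℚ) * (M ^ 14 + M ^ 14) := by gcongr
    _ = 2 * (M : ℚ) ^ 15 := by ring
    _ = 2 * ((n : ℚ) + 3) ^ 45 := by
        rw [hM]
        push_cast
        ring

/-- Every finite hypergraph can be given by lists. -/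
lemma _root_.Hypergraph.exists_isListedBy {β : Type} {H : Hypergraph β}
    (hV : H.vertexSet.Finite) : ∃ (V : List β) (E : List (List β)), H.IsListedBy V E := by
  classical
  have hfin : ∀ s ∈ H.edgeSet, s.Finite := fun s hs =>
    hV.subset (H.subset_vertexSet_of_mem_edgeSet hs)
  have hE : H.edgeSet.Finite := hV.finite_subsets.subset fun s hs =>
    H.subset_vertexSet_of_mem_edgeSet hs
  set f : Set β → List β := fun s => if hs : s.Finite then hs.toFinset.toList else [] with hf
  have hmem : ∀ s ∈ H.edgeSet, {x | x ∈ f s} = s := by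
    intro s hs
    ext x
    simp [hf, hfin s hs]
  refine ⟨hV.toFinset.toList, hE.toFinset.toList.map f, ?_, ?_, ?_, ?_, ?_⟩
  · exact hV.toFinset.nodup_toList
  · simp
  · intro e he
    obtain ⟨s, -, rfl⟩ := List.mem_map.1 he
    simp only [hf]
    split_ifs
    exacts [Finset.nodup_toList _, List.nodup_nil]
  · rw [List.map_map]
    have : hE.toFinset.toList.map ((fun e => {x | x ∈ e}) ∘ f) = hE.toFinset.toList := by
      conv_rhs => rw [← List.map_id hE.toFinset.toList]
      exact List.map_congr_left fun s hs => hmem s (by simpa using hs)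
    rw [this]
    exact hE.toFinset.nodup_toList
  · intro s
    simp only [List.mem_map, mem_toList, Set.Finite.mem_toFinset, exists_exists_and_eq_and]
    constructor
    · exact fun hs => ⟨s, hs, hmem s hs⟩
    · rintro ⟨t, ht, rfl⟩
      rwa [hmem t ht]

/-- The ratio of 67/40 to 1.6755 is below 1, and its powers beat any polynomial. -/
lemma exists_poly_mul_pow_le : ∃ C : ℝ, 0 < C ∧ ∀ n : ℕ,
    3 * ((n : ℝ) + 3) ^ 45 * (67 / 40) ^ n ≤ C * 1.6755 ^ n := by
  obtain ⟨B, hB⟩ := (tendsto_pow_const_mul_const_pow_of_abs_lt_one 45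
    (r := (67 / 40) / 1.6755) (by rw [abs_of_pos] <;> norm_num)).bddAbove_range
  set r : ℝ := (67 / 40) / 1.6755 with hr
  have hr0 : 0 < r := by norm_num [hr]
  refine ⟨3 * (|B| + 1) / r ^ 3, by positivity, fun n => ?_⟩
  -- Boundedness is applied at `n + 3`, which matches the base of the power; the shift costs the
  -- constant `r ^ 3`.
  have h1 : ((n + 3 : ℕ) : ℝ) ^ 45 * r ^ (n + 3) ≤ B := hB ⟨n + 3, rfl⟩
  have h2 : ((n : ℝ) + 3) ^ 45 * r ^ n ≤ (|B| + 1) / r ^ 3 := by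
    rw [le_div_iff₀ (by positivity)]
    calc _ = ((n + 3 : ℕ) : ℝ) ^ 45 * r ^ (n + 3) := by push_cast; ring
      _ ≤ |B| + 1 := by linarith [le_abs_self B]
  have h3 : (67 / 40 : ℝ) ^ n = r ^ n * 1.6755 ^ n := by
    rw [← mul_pow, hr]
    norm_num
  rw [h3]
  calc _ = 3 * (((n : ℝ) + 3) ^ 45 * r ^ n) * 1.6755 ^ n := by ring
    _ ≤ 3 * ((|B| + 1) / r ^ 3) * 1.6755 ^ n := by gcongr
    _ = _ := by ring

lemma _root_.Hypergraph.IsListedBy.isMinimalTransversal_iff_exists (h : H.IsListedBy V E)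
    (hr : H.rank ≤ 3) (T : Set α) :
    H.IsMinimalTransversal T ↔ ∃ l ∈ (enumerate V E).val, {x | x ∈ l} = T := by
  have hres := h.isGoodResult_enumerate hr
  have key : ∀ T : Finset α, H.IsMinimalTransversal (T : Set α) ↔
      T ∈ (enumerate V E).val.map List.toFinset := by
    intro T
    rw [hres.mem_iff, h.isMinimalTransversal_iff, Inst.IsSolution]
    simp
  constructor
  · intro hT
    have hfin : T.Finite := (V.toFinset.finite_toSet).subset fun x hx => by
      simpa [h.mem_vertices] using hT.prop.1 hx
    obtain ⟨T, rfl⟩ := hfin.exists_finset_coe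
    obtain ⟨l, hl, rfl⟩ := List.mem_map.1 ((key T).1 hT)
    exact ⟨l, hl, (coe_toFinset_eq_setOf l).symm⟩
  · rintro ⟨l, hl, rfl⟩
    rw [← coe_toFinset_eq_setOf, key]
    exact List.mem_map.2 ⟨l, hl, rfl⟩

lemma _root_.Hypergraph.IsListedBy.weight_family_le (h : H.IsListedBy V E) :
    weight (family E) ≤ 3 / 2 * (67 / 40) ^ V.length := by
  rw [← List.toFinset_card_of_nodup h.nodup_vertices]
  refine weight_le fun s hs x hx => ?_
  obtain ⟨e, he, rfl⟩ := mem_family.1 hs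
  rw [List.mem_toFinset, h.mem_vertices]
  exact H.subset_vertexSet_of_mem_edgeSet ((h.mem_edges _).2 ⟨e, he, rfl⟩) (List.mem_toFinset.1 hx)

lemma _root_.Hypergraph.IsListedBy.time_enumerate_le (h : H.IsListedBy V E) (hr : H.rank ≤ 3) :
    ((enumerate V E).time : ℝ) ≤ 3 * ((V.length : ℝ) + 3) ^ 45 * (67 / 40) ^ V.length := by
  have h1 : ((enumerate V E).time : ℚ) ≤
      3 * ((V.length : ℚ) + 3) ^ 45 * (67 / 40) ^ V.length := by
    refine (h.isGoodResult_enumerate hr).time_le.trans ?_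
    calc _ ≤ 2 * ((V.length : ℚ) + 3) ^ 45 * (3 / 2 * (67 / 40) ^ V.length) := by
          gcongr
          exact h.weight_family_le
      _ = _ := by ring
  have h2 := (Rat.cast_le (K := ℝ)).2 h1
  push_cast at h2
  exact h2

/-- The number of outputs is at most the weight; the polynomial factor is added only to let one
constant serve both bounds. -/
lemma _root_.Hypergraph.IsListedBy.length_enumerate_le (h : H.IsListedBy V E) (hr : H.rank ≤ 3) :
    ((enumerate V E).val.length : ℝ) ≤
      3 * ((V.length : ℝ) + 3) ^ 45 * (67 / 40) ^ V.length := by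
  have h1 : ((enumerate V E).val.length : ℚ) ≤
      3 * ((V.length : ℚ) + 3) ^ 45 * (67 / 40) ^ V.length := by
    refine ((h.isGoodResult_enumerate hr).length_le.trans h.weight_family_le).trans ?_
    have h2 : (1 : ℚ) ≤ ((V.length : ℚ) + 3) ^ 45 :=
      one_le_pow₀ (by linarith [Nat.cast_nonneg (α := ℚ) V.length])
    gcongr
    linarith
  have h2 := (Rat.cast_le (K := ℝ)).2 h1
  push_cast at h2
  exact h2

end Hypergraphs

end TransversalEnum

theorem theorem1 :
    ∃ C : ℝ, 0 < C ∧
      -- the algorithm lists every minimal transversal exactly once, in time `O(1.6755 ^ n)`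
      (∀ (α : Type) [DecidableEq α] (H : Hypergraph α) (V : List α) (E : List (List α)),
        H.IsListedBy V E → H.rank ≤ 3 →
          (∀ l ∈ (TransversalEnum.enumerate V E).val, l.Nodup) ∧
          ((TransversalEnum.enumerate V E).val.map fun l => {x | x ∈ l}).Nodup ∧
          (∀ T : Set α, H.IsMinimalTransversal T ↔
            ∃ l ∈ (TransversalEnum.enumerate V E).val, {x | x ∈ l} = T) ∧
          ((TransversalEnum.enumerate V E).time : ℝ) ≤ C * 1.6755 ^ H.vertexSet.ncard) ∧
      -- there are at most `O(1.6755 ^ n)` minimal transversals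
      (∀ (α : Type) (H : Hypergraph α), H.vertexSet.Finite → H.rank ≤ 3 →
        {T | H.IsMinimalTransversal T}.Finite ∧
          ({T | H.IsMinimalTransversal T}.ncard : ℝ) ≤ C * 1.6755 ^ H.vertexSet.ncard) := by
  obtain ⟨C, hC, hbound⟩ := TransversalEnum.exists_poly_mul_pow_le
  refine ⟨C, hC, fun α _ H V E h hr => ?_, fun α H hV hr => ?_⟩
  · have hres := h.isGoodResult_enumerate hr
    refine ⟨hres.nodup, ?_, h.isMinimalTransversal_iff_exists hr, ?_⟩
    · have := hres.nodup_map.map (Finset.coe_injective (α := α))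
      rw [List.map_map] at this
      simpa only [Function.comp_def, TransversalEnum.coe_toFinset_eq_setOf] using this
    · rw [h.ncard_eq]
      exact (h.time_enumerate_le hr).trans (hbound _)
  · classical
    -- The counting bound mentions no lists: any listing of the hypergraph will do, and the output
    -- of the algorithm is counted.
    obtain ⟨V, E, h⟩ := Hypergraph.exists_isListedBy hV
    have heq : {T | H.IsMinimalTransversal T} =
        (((TransversalEnum.enumerate V E).val.map fun l => {x | x ∈ l}).toFinset : Set (Set α)) := by
      ext T
      simp [h.isMinimalTransversal_iff_exists hr]
    rw [heq, Set.ncard_coe_finset, h.ncard_eq]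
    refine ⟨Finset.finite_toSet _, le_trans ?_ ((h.length_enumerate_le hr).trans (hbound _))⟩
    have := List.toFinset_card_le
      ((TransversalEnum.enumerate V E).val.map fun l => {x | x ∈ l})
    rw [List.length_map] at this
    exact_mod_cast this
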